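/- **Setting.** Let $(\mathbb X,\mathcal X)$ be a measurable space, $\mu$ a complex measure on it, and $|\mu|$ its total variation. Let $u:\mathbb X\times\mathbb X\to\mathbb C\cup\{\infty\}$ be measurable and symmetric, where the value $\infty$ means $\operatorname{Re}u=+\infty$ and $e^{-\infty}=0$. Put $\zeta(x,y)=e^{-u(x,y)}-1$ (so $\zeta=-1$ where $u=\infty$), and let $\overline u(x,y)=u(x,y)$ where $u(x,y)\neq\infty$ and $\overline u(x,y)=1$ where $u(x,y)=\infty$. The partition function is $$Z=\sum_{n\ge0}\frac1{n!}\int d\mu(x_1)\cdots\int d\mu(x_n)\,\exp\Bigl\{-\sum_{1\le i<j\le n}u(x_i,x_j)\Bigr\},$$ the term $n=0$ being $1$. Let $\mathcal C_n$ be the set of connected (simple, unoriented) graphs on the vertex set $\{1,\dots,n\}$, and let $\varphi(x_1)=1$ and $$\varphi(x_1,\dots,x_n)=\frac1{n!}\sum_{G\in\mathcal C_n}\prod_{\{i,j\}\in G}\zeta(x_i,x_j)\qquad(n\ge2),$$ the product being over the edges of $G$. **Theorem (Cluster expansions).** Let $a,b:\mathbb X\to[0,\infty)$ be measurable functions such that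 1. (stability) for every $n$ and $|\mu|^{\otimes n}$-almost all $(x_1,\dots,x_n)$, $$\prod_{1\le i<j\le n}|1+\zeta(x_i,x_j)|\le\prod_{i=1}^n e^{b(x_i)};$$ and such that at least one of the following two conditions holds: 2. for $|\mu|$-almost all $x$, $\displaystyle\int d|\mu|(y)\,|\zeta(x,y)|\,e^{a(y)+2b(y)}\le a(x)$; 2′. for $|\mu|$-almost all $x$, $\displaystyle\int d|\mu|(y)\,|\overline u(x,y)|\,e^{a(y)+b(y)}\le a(x)$. Suppose also that $\int d|\mu|(y)\,e^{a(y)+2b(y)}<\infty$. Then the series defining $Z$ converges absolutely, and $$Z=\exp\Bigl\{\sum_{n\ge1}\int d\mu(x_1)\cdots d\mu(x_n)\,\varphi(x_1,\dots,x_n)\Bigr\},$$ where the series in the exponential converges absolutely, in the sense that $\sum_{n\ge1}\int d|\mu|(x_1)\cdots d|\mu|(x_n)\,|\varphi(x_1,\dots,x_n)|<\infty$. Furthermore, if condition 2 holds, then for $|\mu|$-almost all $x_1$, $$\sum_{n\ge2}n\int d|\mu|(x_2)\cdots\int d|\mu|(x_n)\,|\varphi(x_1,\dots,x_n)|\le(e^{a(x_1)}-1)\,e^{2b(x_1)};$$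 if condition 2′ holds, the same bound holds with $e^{b(x_1)}$ in place of $e^{2b(x_1)}$. -/

import Mathlib

open MeasureTheory
open scoped ENNReal Nat

noncomputable section

namespace ClusterExpansion

/-- The σ-algebra on `ℂ ∪ {⊤}`: a set is measurable iff its trace on `ℂ` is a Borel set.
The point `⊤` stands for a value whose real part is `+∞`. -/
instance extComplexMeasurableSpace : MeasurableSpace (WithTop ℂ) :=
  MeasurableSpace.map (fun w : ℂ => (w : WithTop ℂ)) inferInstance

/-- `w ↦ e^{-w}` on `ℂ ∪ {⊤}`, with `e^{-⊤} = 0`. -/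
def expNeg (w : WithTop ℂ) : ℂ := (w.map fun z : ℂ => Complex.exp (-z)).untopD 0

theorem expNeg_top : expNeg ⊤ = 0 := rfl

theorem expNeg_coe (z : ℂ) : expNeg (z : WithTop ℂ) = Complex.exp (-z) := rfl

section Model

variable {X : Type*}

/-- `ζ(x,y) = e^{-u(x,y)} - 1`. -/
def zeta (u : X → X → WithTop ℂ) (x y : X) : ℂ := expNeg (u x y) - 1

/-- `ū(x,y)`: equal to `u(x,y)` where this is finite and to `1` where `Re u(x,y) = ∞`. -/
def ubar (u : X → X → WithTop ℂ) (x y : X) : ℂ := (u x y).untopD 1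

/-- The pairs `(i,j)` with `i < j`. -/
def pairs (n : ℕ) : Finset (Fin n × Fin n) := Finset.univ.filter fun p => p.1 < p.2

/-- `exp(-∑_{i<j} u(x_i,x_j))`. -/
def boltzmann (u : X → X → WithTop ℂ) {n : ℕ} (x : Fin n → X) : ℂ :=
  expNeg (∑ p ∈ pairs n, u (x p.1) (x p.2))

open Classical in
/-- `φ(x_1,…,x_n) = (1/n!) ∑_G ∏_{{i,j} ∈ G} ζ(x_i,x_j)`, the sum being over the connected graphs
on `n` vertices. For `n = 1` this is `1`, see `phi_one`. -/
def phi (u : X → X → WithTop ℂ) {n : ℕ} (x : Fin n → X) : ℂ :=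
  ((n ! : ℕ) : ℂ)⁻¹ * ∑ G ∈ (Finset.univ : Finset (SimpleGraph (Fin n))).filter fun G => G.Connected,
    ∏ p ∈ (pairs n).filter fun p => G.Adj p.1 p.2, zeta u (x p.1) (x p.2)

open Classical in
theorem phi_one (u : X → X → WithTop ℂ) (x : Fin 1 → X) : phi u x = 1 := by
  have h : ((Finset.univ : Finset (SimpleGraph (Fin 1))).filter fun G => G.Connected)
      = Finset.univ :=
    Finset.filter_true_of_mem fun G _ => SimpleGraph.Connected.of_subsingleton
  have hp : pairs 1 = ∅ := by decide
  rw [phi, h]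
  simp [hp]

variable [MeasurableSpace X]

/-- The iterated integral `∫ dμ(x_1) ⋯ ∫ dμ(x_n) f(x_1,…,x_n)` against a complex measure. -/
def iterIntegral (μ : ComplexMeasure X) : (n : ℕ) → ((Fin n → X) → ℂ) → ℂ
  | 0, f => f Fin.elim0
  | n + 1, f =>
    ∫ᵛ x₁, iterIntegral μ n (fun y => f (Fin.cons x₁ y)) ∂[ContinuousLinearMap.mul ℝ ℂ; μ]

/-- The `n`-fold product `|μ| ⊗ ⋯ ⊗ |μ|` of the total variation of `μ`. -/
def absPi (μ : ComplexMeasure X) (n : ℕ) : Measure (Fin n → X) :=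
  Measure.pi fun _ => μ.variation

/-- The `n`-th term of the series defining the partition function. -/
def partitionTerm (μ : ComplexMeasure X) (u : X → X → WithTop ℂ) (n : ℕ) : ℂ :=
  ((n ! : ℕ) : ℂ)⁻¹ * iterIntegral μ n (boltzmann u)

/-- The partition function `Z`. -/
def partitionFunction (μ : ComplexMeasure X) (u : X → X → WithTop ℂ) : ℂ :=
  ∑' n : ℕ, partitionTerm μ u n

/-- The `n`-th cluster term `∫ dμ(x_1) ⋯ dμ(x_n) φ(x_1,…,x_n)`. -/
def clusterTerm (μ : ComplexMeasure X) (u : X → X → WithTop ℂ) (n : ℕ) : ℂ :=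
  iterIntegral μ n (phi u)

/-- Stability of the interaction, with stability function `b`. -/
def Stable (μ : ComplexMeasure X) (u : X → X → WithTop ℂ) (b : X → ℝ) : Prop :=
  ∀ n : ℕ, ∀ᵐ x ∂absPi μ n,
    ∏ p ∈ pairs n, ‖1 + zeta u (x p.1) (x p.2)‖ ≤ ∏ i, Real.exp (b (x i))

/-- The criterion of Kotecký–Preiss type, in terms of `|ζ|`. -/
def ZetaCriterion (μ : ComplexMeasure X) (u : X → X → WithTop ℂ) (a b : X → ℝ) : Prop :=
  ∀ᵐ x ∂μ.variation,
    ∫⁻ y, ENNReal.ofReal (‖zeta u x y‖ * Real.exp (a y + 2 * b y)) ∂μ.variation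
      ≤ ENNReal.ofReal (a x)

/-- The criterion in terms of `|ū|`. -/
def UbarCriterion (μ : ComplexMeasure X) (u : X → X → WithTop ℂ) (a b : X → ℝ) : Prop :=
  ∀ᵐ x ∂μ.variation,
    ∫⁻ y, ENNReal.ofReal (‖ubar u x y‖ * Real.exp (a y + b y)) ∂μ.variation
      ≤ ENNReal.ofReal (a x)

/-- `∑_{n ≥ 2} n ∫ d|μ|(x_2) ⋯ ∫ d|μ|(x_n) |φ(x_1,x_2,…,x_n)|` (with `n = m + 2`). -/
def rootedClusterSum (μ : ComplexMeasure X) (u : X → X → WithTop ℂ) (x₁ : X) : ℝ≥0∞ :=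
  ∑' m : ℕ, ((m + 2 : ℕ) : ℝ≥0∞) *
    ∫⁻ y : Fin (m + 1) → X, ENNReal.ofReal ‖phi u (Fin.cons x₁ y : Fin (m + 2) → X)‖ ∂absPi μ (m + 1)

end Model

end ClusterExpansion

end

/-!
Writing `dμ = h d|μ|` with `|h| = 1`, everything reduces to sums over graphs integrated against
products of `|μ|`, where a graph on `V` is a finset of unordered pairs of elements of `V`.

Under either criterion `n! |φ|` is dominated by a sum over trees with one weight per edge and one
per vertex. In terms of `ζ`, this follows by induction from the Kirkwood–Salsburg recursion, which
removes a root `k` chosen so that, by stability, its interaction with the other points is at most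
`e ^ {2 b k}`. In terms of `u`, one replaces `u` by `t u`, and both the sum over connected graphs
and the sum over trees satisfy the same differential equation (inequality) in `t`, obtained by
cutting a graph into two connected pieces; the hard core is the limit of finite repulsions.

The integral of the sum over trees is controlled by cutting the branch at a given vertex, which is
attached to the root: if `T` is the total weight of the rooted trees, then `T ≤ c exp (∫ K T)`, and
`T ≤ c exp a` is preserved by this recursion because `∫ K c exp a ≤ a`.

Finally, extracting from each graph the connected component of the vertex `0` gives
`(n + 1) p (n + 1) = ∑ k ≤ n, (k + 1) c (k + 1) p (n - k)` for the coefficients `p` and `c` of the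
two series, that is `P' = C' P` for their generating functions, so that `P = exp C`.
-/

noncomputable section

namespace ClusterExpansion

open Finset

/-! ### Connected graphs and trees as edge sets -/

section FinsetSums

variable {α β R : Type*} [AddCommMonoid R] [PartialOrder R] [IsOrderedAddMonoid R]
  {s : Finset α} {t : Finset β} {f : α → R} {g : β → R}

theorem sum_le_sum_of_injOn (i : α → β) (hi : ∀ x ∈ s, i x ∈ t) (hinj : Set.InjOn i s)
    (hfg : ∀ x ∈ s, f x ≤ g (i x)) (hg : ∀ y ∈ t, 0 ≤ g y) :
    ∑ x ∈ s, f x ≤ ∑ y ∈ t, g y := by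
  classical
  calc ∑ x ∈ s, f x ≤ ∑ x ∈ s, g (i x) := sum_le_sum hfg
    _ = ∑ y ∈ s.image i, g y := (sum_image hinj).symm
    _ ≤ ∑ y ∈ t, g y :=
        sum_le_sum_of_subset_of_nonneg (image_subset_iff.2 hi) fun y hy _ => hg y hy

theorem sum_le_sum_of_surjOn (i : β → α) (h : ∀ x ∈ s, ∃ y ∈ t, i y = x ∧ f x ≤ g y)
    (hg : ∀ y ∈ t, 0 ≤ g y) : ∑ x ∈ s, f x ≤ ∑ y ∈ t, g y := by
  classical
  refine (sum_le_sum fun x hx => ?_).trans (sum_fiberwise_le_sum_of_sum_fiber_nonneg (g := i)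
    fun x _ => sum_nonneg fun y hy => hg y (mem_filter.1 hy).1)
  obtain ⟨y, hy, hyx, hfg⟩ := h x hx
  exact hfg.trans (single_le_sum (fun z hz => hg z (mem_filter.1 hz).1)
    (mem_filter.2 ⟨hy, hyx⟩))

end FinsetSums

section NoCross

variable {ι : Type*} {P : Set ι} {V : Finset ι} {E E' : Finset (Sym2 ι)} {v : ι}

/-- The edge set `E` has no edge joining `P` to its complement. -/
def NoCross (P : Set ι) (E : Finset (Sym2 ι)) : Prop :=
  ∀ i j, s(i, j) ∈ E → i ∈ P → j ∈ P

theorem NoCross.mono (h : NoCross P E') (hE : E ⊆ E') : NoCross P E :=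
  fun i j hij => h i j (hE hij)

theorem NoCross.compl (h : NoCross P E) : NoCross Pᶜ E :=
  fun i j hij hi hj => hi (h j i (by rwa [Sym2.eq_swap]) hj)

/-- The graph with vertex set `V` and edge set `E` is connected, in the sense that a set of
vertices that no edge leaves contains all of `V` or none of it. -/
def ConnectedOn (V : Finset ι) (E : Finset (Sym2 ι)) : Prop :=
  ∀ P : Set ι, NoCross P E → ∀ i ∈ V, ∀ j ∈ V, i ∈ P → j ∈ P

theorem connectedOn_singleton (v : ι) (E : Finset (Sym2 ι)) : ConnectedOn {v} E := by
  intro P _ i hi j hj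
  rw [mem_singleton.1 hi, mem_singleton.1 hj]
  exact id

theorem connectedOn_of_root (h : ∀ P : Set ι, NoCross P E → v ∈ P → ∀ j ∈ V, j ∈ P) :
    ConnectedOn V E := by
  intro P hP i hi j hj hiP
  by_cases hvP : v ∈ P
  · exact h P hP hvP j hj
  · exact absurd hiP (h _ hP.compl hvP i hi)

open Classical in
/-- The vertices of the connected component of `v` in the graph on `V` with edge set `E`. -/
def component (V : Finset ι) (E : Finset (Sym2 ι)) (v : ι) : Finset ι :=
  V.filter fun i => ∀ P : Set ι, NoCross P E → v ∈ P → i ∈ P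

theorem mem_component {i : ι} :
    i ∈ component V E v ↔ i ∈ V ∧ ∀ P : Set ι, NoCross P E → v ∈ P → i ∈ P := by
  simp [component]

theorem self_mem_component (hv : v ∈ V) : v ∈ component V E v :=
  mem_component.2 ⟨hv, fun _ _ h => h⟩

end NoCross

variable {ι : Type*} [DecidableEq ι]

section Edges

variable {V W : Finset ι}

/-- The edges of the complete graph on `V`. A graph on `V` is a subset of `edges V`. -/
def edges (V : Finset ι) : Finset (Sym2 ι) := V.sym2.filter fun e => ¬ e.IsDiag

@[simp]
theorem mk_mem_edges {i j : ι} : s(i, j) ∈ edges V ↔ i ∈ V ∧ j ∈ V ∧ i ≠ j := by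
  simp [edges, and_assoc]

theorem edges_mono (h : V ⊆ W) : edges V ⊆ edges W :=
  filter_subset_filter _ (sym2_mono h)

theorem disjoint_edges (h : Disjoint V W) : Disjoint (edges V) (edges W) := by
  rw [disjoint_left] at h ⊢
  intro e
  induction e with | _ i j
  simp only [mk_mem_edges]
  exact fun hV hW => h hV.1 hW.1

@[simp]
theorem edges_empty : edges (∅ : Finset ι) = ∅ := by simp [edges]

@[simp]
theorem edges_singleton (v : ι) : edges ({v} : Finset ι) = ∅ := by
  ext e
  induction e with | _ i j
  simp only [mk_mem_edges, mem_singleton, notMem_empty, iff_false]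
  rintro ⟨rfl, rfl, h⟩
  exact h rfl

theorem edges_insert {k : ι} (hk : k ∉ W) :
    edges (insert k W) = W.image (fun j => s(k, j)) ∪ edges W := by
  ext e
  induction e with | _ i j
  simp only [mk_mem_edges, mem_insert, mem_union, mem_image, Sym2.eq_iff]
  grind

@[to_additive]
theorem prod_edges_insert {R : Type*} [CommMonoid R] {k : ι} (hk : k ∉ W) (f : Sym2 ι → R) :
    ∏ e ∈ edges (insert k W), f e = (∏ j ∈ W, f s(k, j)) * ∏ e ∈ edges W, f e := by
  rw [edges_insert hk, prod_union, prod_image fun _ _ _ _ h => Sym2.congr_right.1 h]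
  rw [disjoint_left]
  intro e he
  obtain ⟨j, -, rfl⟩ := mem_image.1 he
  exact fun h => hk (mk_mem_edges.1 h).1

@[to_additive]
theorem prod_edges_union {R : Type*} [CommMonoid R] (h : Disjoint V W) (f : Sym2 ι → R) :
    ∏ e ∈ edges (V ∪ W), f e =
      (∏ e ∈ edges V, f e) * (∏ e ∈ edges W, f e) * ∏ i ∈ V, ∏ j ∈ W, f s(i, j) := by
  induction V using Finset.induction_on with
  | empty => simp
  | insert k V hk ih =>
    obtain ⟨hkW, hVW⟩ := disjoint_insert_left.1 h
    rw [insert_union, prod_edges_insert (by simp [hk, hkW]), ih hVW, prod_edges_insert hk,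
      prod_union hVW, prod_insert hk]
    simp only [mul_assoc, mul_left_comm, mul_comm]

theorem disjoint_insert_sdiff {v : ι} {S : Finset ι} (hv : v ∉ V) :
    Disjoint (insert v S) (V \ S) :=
  disjoint_insert_left.2 ⟨fun h => hv (mem_sdiff.1 h).1, disjoint_sdiff⟩

variable {E₁ E₂ : Finset (Sym2 ι)}

theorem noCross_union (h : Disjoint V W) (h₁ : E₁ ⊆ edges V) (h₂ : E₂ ⊆ edges W) :
    NoCross (V : Set ι) (E₁ ∪ E₂) := by
  intro i j hij hi
  rcases mem_union.1 hij with hij | hij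
  · exact (mk_mem_edges.1 (h₁ hij)).2.1
  · exact absurd (mk_mem_edges.1 (h₂ hij)).1 (disjoint_left.1 h hi)

theorem mk_notMem_union {i j : ι} (hd : Disjoint V W) (h₁ : E₁ ⊆ edges V) (h₂ : E₂ ⊆ edges W)
    (hi : i ∈ V) (hj : j ∈ W) : s(i, j) ∉ E₁ ∪ E₂ :=
  fun h => disjoint_left.1 hd (noCross_union hd h₁ h₂ i j h hi) hj

theorem union_inter_edges_left (hd : Disjoint V W) (h₁ : E₁ ⊆ edges V) (h₂ : E₂ ⊆ edges W) :
    (E₁ ∪ E₂) ∩ edges V = E₁ := by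
  rw [union_inter_distrib_right, inter_eq_left.2 h₁,
    disjoint_iff_inter_eq_empty.1 ((disjoint_edges hd).symm.mono_left h₂), union_empty]

theorem union_inter_edges_right (hd : Disjoint V W) (h₁ : E₁ ⊆ edges V) (h₂ : E₂ ⊆ edges W) :
    (E₁ ∪ E₂) ∩ edges W = E₂ := by
  rw [union_comm, union_inter_edges_left hd.symm h₂ h₁]

theorem NoCross.inter_edges_union_inter_edges_sdiff {T : Finset ι} {E : Finset (Sym2 ι)}
    (hT : NoCross (T : Set ι) E) (hE : E ⊆ edges V) :
    E ∩ edges T ∪ E ∩ edges (V \ T) = E := by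
  rw [← inter_union_distrib_left, inter_eq_left]
  intro e he
  induction e with | _ i j
  obtain ⟨hi, hj, hij⟩ := mk_mem_edges.1 (hE he)
  by_cases hiT : i ∈ T
  · exact mem_union_left _ (mk_mem_edges.2 ⟨hiT, hT i j he hiT, hij⟩)
  · exact mem_union_right _ (mk_mem_edges.2
      ⟨mem_sdiff.2 ⟨hi, hiT⟩, mem_sdiff.2 ⟨hj, hT.compl i j he hiT⟩, hij⟩)

end Edges

section Connected

variable {V : Finset ι} {E : Finset (Sym2 ι)} {v : ι}

theorem noCross_component (hE : E ⊆ edges V) : NoCross (component V E v : Set ι) E := by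
  intro i j hij hi
  obtain ⟨-, hreach⟩ := mem_component.1 hi
  exact mem_component.2 ⟨(mk_mem_edges.1 (hE hij)).2.1,
    fun P hP hvP => hP i j hij (hreach P hP hvP)⟩

theorem connectedOn_component (hE : E ⊆ edges V) (hv : v ∈ V) :
    ConnectedOn (component V E v) (E ∩ edges (component V E v)) := by
  set T := component V E v
  refine connectedOn_of_root (v := v) fun P hP hvP j hj => ?_
  have hvT : v ∈ T := self_mem_component hv
  have hPT : NoCross (P ∩ T) E := by
    intro i k hik hi
    have hk : k ∈ T := noCross_component hE i k hik hi.2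
    have hik' : s(i, k) ∈ edges T := mk_mem_edges.2 ⟨hi.2, hk, (mk_mem_edges.1 (hE hik)).2.2⟩
    exact ⟨hP i k (mem_inter.2 ⟨hik, hik'⟩) hi.1, hk⟩
  exact ((mem_component.1 hj).2 (P ∩ T) hPT ⟨hvP, hvT⟩).1

theorem exists_connectedOn_insert (hv : v ∉ V) (hE : E ⊆ edges (insert v V)) :
    ∃ S ⊆ V, ConnectedOn (insert v S) (E ∩ edges (insert v S)) ∧
      E ∩ edges (insert v S) ∪ E ∩ edges (V \ S) = E := by
  set T := component (insert v V) E v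
  have hvT : v ∈ T := self_mem_component (mem_insert_self v V)
  have hTV : T ⊆ insert v V := fun i hi => (mem_component.1 hi).1
  refine ⟨T.erase v, subset_insert_iff.1 hTV, ?_, ?_⟩
  · rw [insert_erase hvT]
    exact connectedOn_component hE (mem_insert_self v V)
  · have hsdiff : V \ T.erase v = insert v V \ T := by
      ext i
      simp only [mem_sdiff, mem_erase, mem_insert]
      grind
    rw [insert_erase hvT, hsdiff]
    exact (noCross_component hE).inter_edges_union_inter_edges_sdiff hE

theorem ConnectedOn.subset_of_union {A A' B' : Finset ι} {E₁ E₂ E₁' E₂' : Finset (Sym2 ι)}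
    (hc : ConnectedOn A E₁) (hd' : Disjoint A' B') (h₁' : E₁' ⊆ edges A') (h₂' : E₂' ⊆ edges B')
    (hv : v ∈ A) (hv' : v ∈ A') (h : E₁ ∪ E₂ = E₁' ∪ E₂') : A ⊆ A' :=
  fun j hj => hc A' ((h ▸ noCross_union hd' h₁' h₂').mono subset_union_left) v hv j hj hv'

theorem eq_of_connectedOn_insert {S S' : Finset ι} {E₁ E₂ E₁' E₂' : Finset (Sym2 ι)} (hv : v ∉ V)
    (hS : S ⊆ V) (hS' : S' ⊆ V) (hE₁ : E₁ ⊆ edges (insert v S)) (hE₂ : E₂ ⊆ edges (V \ S))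
    (hE₁' : E₁' ⊆ edges (insert v S')) (hE₂' : E₂' ⊆ edges (V \ S'))
    (hc : ConnectedOn (insert v S) E₁) (hc' : ConnectedOn (insert v S') E₁')
    (h : E₁ ∪ E₂ = E₁' ∪ E₂') : S = S' ∧ E₁ = E₁' ∧ E₂ = E₂' := by
  have hd := disjoint_insert_sdiff (S := S) hv
  have hd' := disjoint_insert_sdiff (S := S') hv
  have hvS : insert v S = insert v S' :=
    (hc.subset_of_union hd' hE₁' hE₂' (mem_insert_self v S) (mem_insert_self v S') h).antisymm
      (hc'.subset_of_union hd hE₁ hE₂ (mem_insert_self v S') (mem_insert_self v S) h.symm)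
  obtain rfl : S = S' := by
    rw [← erase_insert fun hvS => hv (hS hvS), hvS, erase_insert fun hvS => hv (hS' hvS)]
  refine ⟨rfl, ?_, ?_⟩
  · rw [← union_inter_edges_left hd hE₁ hE₂, h, union_inter_edges_left hd hE₁' hE₂']
  · rw [← union_inter_edges_right hd hE₁ hE₂, h, union_inter_edges_right hd hE₁' hE₂']

end Connected

section ConnSum

variable {R : Type*} [CommSemiring R] (ζ : Sym2 ι → R)

/-- The product of `1 + ζ` over all the pairs of elements of `V`; this is the Boltzmann factor of
`V`, and the sum over all the graphs on `V` of the product of `ζ` over the edges. -/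
def fullProd (V : Finset ι) : R := ∏ e ∈ edges V, (1 + ζ e)

open Classical in
/-- The sum over the connected graphs on `V` of the product of `ζ` over the edges, that is,
`n! φ` for `V` of cardinality `n`. -/
def connSum (V : Finset ι) : R :=
  ∑ E ∈ (edges V).powerset.filter (ConnectedOn V), ∏ e ∈ E, ζ e

theorem connSum_singleton (v : ι) : connSum ζ {v} = 1 := by
  simp [connSum, connectedOn_singleton]

@[simp]
theorem fullProd_empty : fullProd ζ ∅ = 1 := by
  simp [fullProd]

theorem fullProd_insert {k : ι} {W : Finset ι} (hk : k ∉ W) :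
    fullProd ζ (insert k W) = (∏ j ∈ W, (1 + ζ s(k, j))) * fullProd ζ W :=
  prod_edges_insert hk _

/-- A graph on `insert v V` is the union of the connected component of `v` and of an arbitrary
graph on the remaining vertices. -/
theorem fullProd_insert_eq_sum_connSum {v : ι} {V : Finset ι} (hv : v ∉ V) :
    fullProd ζ (insert v V) =
      ∑ S ∈ V.powerset, connSum ζ (insert v S) * fullProd ζ (V \ S) := by
  classical
  simp only [fullProd, connSum, prod_one_add, sum_mul_sum, sum_sigma']
  symm
  refine sum_bij (fun p _ => p.2.1 ∪ p.2.2) ?_ ?_ ?_ ?_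
  · rintro ⟨S, E₁, E₂⟩ h
    simp only [mem_sigma, mem_powerset, mem_filter] at h ⊢
    exact union_subset (h.2.1.1.trans (edges_mono (insert_subset_insert _ h.1)))
      (h.2.2.trans (edges_mono (sdiff_subset.trans (subset_insert _ _))))
  · rintro ⟨S, E₁, E₂⟩ h ⟨S', E₁', E₂'⟩ h' heq
    simp only [mem_sigma, mem_powerset, mem_filter] at h h' heq
    obtain ⟨rfl, rfl, rfl⟩ := eq_of_connectedOn_insert hv h.1 h'.1 h.2.1.1 h.2.2 h'.2.1.1 h'.2.2
      h.2.1.2 h'.2.1.2 heq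
    rfl
  · intro E hE
    obtain ⟨S, hS, hc, hu⟩ := exists_connectedOn_insert hv (mem_powerset.1 hE)
    exact ⟨⟨S, E ∩ edges (insert v S), E ∩ edges (V \ S)⟩, by
      simp [hS, hc, inter_subset_right], hu⟩
  · rintro ⟨S, E₁, E₂⟩ h
    simp only [mem_sigma, mem_powerset, mem_filter] at h
    exact (prod_union ((disjoint_edges (disjoint_insert_sdiff hv)).mono h.2.1.1 h.2.2)).symm

end ConnSum

section Tree

/-- Trees, given by their vertex set and their edge set, and built by joining two disjoint trees by
an edge. -/
inductive TreeOn : Finset ι → Finset (Sym2 ι) → Prop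
  | single (v : ι) : TreeOn {v} ∅
  | join {V₁ V₂ : Finset ι} {E₁ E₂ : Finset (Sym2 ι)} {i j : ι} (hd : Disjoint V₁ V₂)
      (h₁ : TreeOn V₁ E₁) (h₂ : TreeOn V₂ E₂) (hi : i ∈ V₁) (hj : j ∈ V₂) :
      TreeOn (V₁ ∪ V₂) (insert s(i, j) (E₁ ∪ E₂))

variable {V : Finset ι} {E : Finset (Sym2 ι)} {r v : ι}

theorem TreeOn.subset_edges (h : TreeOn V E) : E ⊆ edges V := by
  induction h with
  | single v => simp
  | join hd _ _ hi hj ih₁ ih₂ =>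
    refine insert_subset (mk_mem_edges.2 ⟨mem_union_left _ hi, mem_union_right _ hj, ?_⟩)
      (union_subset (ih₁.trans (edges_mono subset_union_left))
        (ih₂.trans (edges_mono subset_union_right)))
    rintro rfl
    exact disjoint_left.1 hd hi hj

theorem TreeOn.connectedOn (h : TreeOn V E) : ConnectedOn V E := by
  induction h with
  | single v => exact connectedOn_singleton v ∅
  | @join V₁ V₂ E₁ E₂ i j _ _ _ hi hj ih₁ ih₂ =>
    refine connectedOn_of_root (v := i) fun P hP hiP k hk => ?_
    rcases mem_union.1 hk with hk | hk
    · exact ih₁ P (hP.mono (subset_union_left.trans (subset_insert _ _))) i hi k hk hiP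
    · have hjP : j ∈ P := hP i j (mem_insert_self _ _) hiP
      exact ih₂ P (hP.mono (subset_union_right.trans (subset_insert _ _))) j hj k hk hjP

/-- `E` is obtained by joining the root `r` of a tree to a vertex `j` of a disjoint tree that
contains `v`; thus `s(r, j)` is the first edge of the path from `r` to `v`. -/
def SplitsAtRoot (r v : ι) (V : Finset ι) (E : Finset (Sym2 ι)) : Prop :=
  ∃ A B E₁ E₂ j, Disjoint A B ∧ TreeOn A E₁ ∧ TreeOn B E₂ ∧ r ∈ A ∧ v ∈ B ∧ j ∈ B ∧
    A ∪ B = V ∧ insert s(r, j) (E₁ ∪ E₂) = E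

/-- If `r` is not the attaching vertex `i` of the second tree, then that tree follows `i` into one
of the two pieces of the first. -/
theorem SplitsAtRoot.join {V₁ V₂ : Finset ι} {F₁ F₂ : Finset (Sym2 ι)} {i j : ι}
    (hd : Disjoint V₁ V₂) (h₁ : TreeOn V₁ F₁) (h₂ : TreeOn V₂ F₂) (hi : i ∈ V₁) (hj : j ∈ V₂)
    (hr : r ∈ V₁) (hv : v ∈ V₁ ∪ V₂) (hrv : r ≠ v)
    (ih : ∀ v ∈ V₁, r ≠ v → SplitsAtRoot r v V₁ F₁) :
    SplitsAtRoot r v (V₁ ∪ V₂) (insert s(i, j) (F₁ ∪ F₂)) := by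
  rcases mem_union.1 hv with hv₁ | hv₂
  · obtain ⟨A, B, E₁, E₂, k, hAB, hA, hB, hrA, hvB, hkB, rfl, rfl⟩ := ih v hv₁ hrv
    rw [disjoint_union_left] at hd
    rcases mem_union.1 hi with hiA | hiB
    · refine ⟨A ∪ V₂, B, _, E₂, k, disjoint_union_left.2 ⟨hAB, hd.2.symm⟩,
        .join hd.1 hA h₂ hiA hj, hB, mem_union_left _ hrA, hvB, hkB, union_right_comm .., ?_⟩
      ext; simp only [mem_insert, mem_union]; tauto
    · refine ⟨A, B ∪ V₂, E₁, _, k, disjoint_union_right.2 ⟨hAB, hd.1⟩, hA,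
        .join hd.2 hB h₂ hiB hj, hrA, mem_union_left _ hvB, mem_union_left _ hkB,
        (union_assoc ..).symm, ?_⟩
      ext; simp only [mem_insert, mem_union]; tauto
  · obtain rfl | hri := eq_or_ne r i
    · exact ⟨V₁, V₂, F₁, F₂, j, hd, h₁, h₂, hr, hv₂, hj, rfl, rfl⟩
    · obtain ⟨A, B, E₁, E₂, k, hAB, hA, hB, hrA, hiB, hkB, rfl, rfl⟩ := ih i hi hri
      rw [disjoint_union_left] at hd
      refine ⟨A, B ∪ V₂, E₁, _, k, disjoint_union_right.2 ⟨hAB, hd.1⟩, hA,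
        .join hd.2 hB h₂ hiB hj, hrA, mem_union_right _ hv₂, mem_union_left _ hkB,
        (union_assoc ..).symm, ?_⟩
      ext; simp only [mem_insert, mem_union]; tauto

theorem TreeOn.splitsAtRoot (h : TreeOn V E) (hr : r ∈ V) (hv : v ∈ V) (hrv : r ≠ v) :
    SplitsAtRoot r v V E := by
  induction h generalizing v with
  | single w => exact absurd ((mem_singleton.1 hr).trans (mem_singleton.1 hv).symm) hrv
  | @join V₁ V₂ F₁ F₂ i j hd h₁ h₂ hi hj ih₁ ih₂ =>
    rcases mem_union.1 hr with hr₁ | hr₂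
    · exact .join hd h₁ h₂ hi hj hr₁ hv hrv fun v => ih₁ hr₁
    · rw [Sym2.eq_swap, union_comm F₁, union_comm V₁]
      exact .join hd.symm h₂ h₁ hj hi hr₂ (by rwa [union_comm]) hrv fun v => ih₂ hr₂

theorem exists_eq_insert_of_union_eq {A B : Finset ι} (hd : Disjoint A B) (hr : r ∈ A)
    (hv : v ∈ B) (hvV : v ∉ V) (hAB : A ∪ B = insert r (insert v V)) :
    ∃ S ⊆ V, B = insert v S ∧ A = insert r (V \ S) := by
  have hrB : r ∉ B := disjoint_left.1 hd hr
  have hvA : v ∉ A := disjoint_right.1 hd hv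
  have hmem (x : ι) := Finset.ext_iff.1 hAB x
  simp only [mem_union, mem_insert] at hmem
  refine ⟨B.erase v, fun x hx => ?_, (insert_erase hv).symm, ?_⟩
  · grind
  · ext x
    have hx : x ∈ A → x ∉ B := fun h => disjoint_left.1 hd h
    grind

theorem TreeOn.join_inj {S S' : Finset ι} {E₁ E₂ E₁' E₂' : Finset (Sym2 ι)} {i j i' j' : ι}
    (hv : v ∉ V) (hS : S ⊆ V) (hS' : S' ⊆ V) (ht₁ : TreeOn (insert v S) E₁)
    (ht₂ : TreeOn (V \ S) E₂) (ht₁' : TreeOn (insert v S') E₁') (ht₂' : TreeOn (V \ S') E₂')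
    (hi : i ∈ insert v S) (hj : j ∈ V \ S) (hi' : i' ∈ insert v S') (hj' : j' ∈ V \ S')
    (hE : insert s(i, j) (E₁ ∪ E₂) = insert s(i', j') (E₁' ∪ E₂')) (he : s(i, j) = s(i', j')) :
    S = S' ∧ i = i' ∧ j = j' ∧ E₁ = E₁' ∧ E₂ = E₂' := by
  have hd {S : Finset ι} := disjoint_insert_sdiff (S := S) hv
  have hunion : E₁ ∪ E₂ = E₁' ∪ E₂' := by
    rw [← erase_insert (mk_notMem_union hd ht₁.subset_edges ht₂.subset_edges hi hj), hE, he,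
      erase_insert (mk_notMem_union hd ht₁'.subset_edges ht₂'.subset_edges hi' hj')]
  obtain ⟨rfl, rfl, rfl⟩ := eq_of_connectedOn_insert hv hS hS' ht₁.subset_edges ht₂.subset_edges
    ht₁'.subset_edges ht₂'.subset_edges ht₁.connectedOn ht₁'.connectedOn hunion
  rcases Sym2.eq_iff.1 he with ⟨rfl, rfl⟩ | ⟨rfl, rfl⟩
  · exact ⟨rfl, rfl, rfl, rfl, rfl⟩
  · exact absurd hj' (disjoint_left.1 hd hi)

end Tree

section TreeSum

variable {R : Type*} [CommSemiring R] {V : Finset ι}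

open Classical in
/-- The edge sets of the trees with vertex set `V`. -/
def trees (V : Finset ι) : Finset (Finset (Sym2 ι)) := (edges V).powerset.filter (TreeOn V)

theorem mem_trees {E : Finset (Sym2 ι)} : E ∈ trees V ↔ TreeOn V E := by
  simp only [trees, mem_filter, mem_powerset, and_iff_right_iff_imp]
  exact fun h => h.subset_edges

@[simp]
theorem trees_singleton (v : ι) : trees {v} = {∅} := by
  ext E
  simp only [mem_trees, mem_singleton]
  constructor
  · intro h
    simpa using h.subset_edges
  · rintro rfl
    exact .single v

/-- The sum over the trees on `V` of the product of `w` over the edges. -/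
def treeSum (w : Sym2 ι → R) (V : Finset ι) : R := ∑ E ∈ trees V, ∏ e ∈ E, w e

/-- The sum over the partitions `{A, B}` of `insert v V`, where `A` contains `v`, of the total
weight of the edges between `A` and `B` times `c A * c B`. -/
def crossSum (m : Sym2 ι → R) (c : Finset ι → R) (v : ι) (V : Finset ι) : R :=
  ∑ S ∈ V.powerset, (∑ i ∈ insert v S, ∑ j ∈ V \ S, m s(i, j)) * (c (insert v S) * c (V \ S))

@[simp]
theorem treeSum_singleton (w : Sym2 ι → R) (v : ι) : treeSum w {v} = 1 := by
  simp [treeSum]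

variable [PartialOrder R] [IsOrderedRing R] {w m : Sym2 ι → R} {r v : ι}

theorem treeSum_nonneg (hw : ∀ e, 0 ≤ w e) (V : Finset ι) : 0 ≤ treeSum w V :=
  sum_nonneg fun _ _ => prod_nonneg fun _ _ => hw _

theorem treeSum_insert_insert_le (hw : ∀ e, 0 ≤ w e) (hv : v ∉ V) (hrv : r ≠ v) :
    treeSum w (insert r (insert v V)) ≤ ∑ S ∈ V.powerset,
      (∑ j ∈ insert v S, w s(r, j)) * treeSum w (insert v S) * treeSum w (insert r (V \ S)) := by
  simp only [treeSum, sum_mul, mul_sum, sum_sigma']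
  refine sum_le_sum_of_surjOn (fun p => insert s(r, p.2.2.2) (p.2.1 ∪ p.2.2.1)) ?_ ?_
  · intro E hE
    obtain ⟨A, B, E₁, E₂, j, hd, hA, hB, hrA, hvB, hjB, hAB, rfl⟩ :=
      (mem_trees.1 hE).splitsAtRoot (mem_insert_self r _)
        (mem_insert_of_mem (mem_insert_self v V)) hrv
    obtain ⟨S, hS, rfl, rfl⟩ := exists_eq_insert_of_union_eq hd hrA hvB hv hAB
    refine ⟨⟨S, E₁, E₂, j⟩, by simp [mem_trees, hS, hA, hB, mem_insert.1 hjB], rfl, le_of_eq ?_⟩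
    rw [prod_insert (mk_notMem_union hd hA.subset_edges hB.subset_edges hrA hjB),
      prod_union ((disjoint_edges hd).mono hA.subset_edges hB.subset_edges)]
    ring
  · intro p _
    exact mul_nonneg (mul_nonneg (hw _) (prod_nonneg fun _ _ => hw _)) (prod_nonneg fun _ _ => hw _)

theorem crossSum_treeSum_le (hw : ∀ e, 0 ≤ w e) (hm : ∀ e, 0 ≤ m e) (hv : v ∉ V) :
    crossSum m (treeSum w) v V ≤
      ∑ E ∈ trees (insert v V), ∑ e ∈ E, m e * ∏ f ∈ E.erase e, w f := by
  simp only [crossSum, treeSum, sum_mul_sum, sum_sigma']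
  refine sum_le_sum_of_injOn
    (fun p => ⟨insert s(p.2.1.1, p.2.1.2) (p.2.2.1 ∪ p.2.2.2), s(p.2.1.1, p.2.1.2)⟩) ?_ ?_ ?_ ?_
  · rintro ⟨S, ⟨i, j⟩, E₁, E₂⟩ h
    simp only [mem_sigma, mem_powerset, mem_trees] at h ⊢
    refine ⟨?_, mem_insert_self _ _⟩
    have hjoin := TreeOn.join (disjoint_insert_sdiff hv) h.2.2.1 h.2.2.2 h.2.1.1 h.2.1.2
    rwa [insert_union, union_sdiff_of_subset h.1] at hjoin
  · rintro ⟨S, ⟨i, j⟩, E₁, E₂⟩ h ⟨S', ⟨i', j'⟩, E₁', E₂'⟩ h' heq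
    simp only [coe_sigma, Set.mem_sigma_iff, mem_coe, mem_powerset, mem_trees] at h h'
    simp only [Sigma.mk.injEq, heq_eq_eq] at heq
    obtain ⟨rfl, rfl, rfl, rfl, rfl⟩ := TreeOn.join_inj hv h.1 h'.1 h.2.2.1 h.2.2.2 h'.2.2.1
      h'.2.2.2 h.2.1.1 h.2.1.2 h'.2.1.1 h'.2.1.2 heq.1 heq.2
    rfl
  · rintro ⟨S, ⟨i, j⟩, E₁, E₂⟩ h
    simp only [mem_sigma, mem_powerset, mem_trees] at h ⊢
    obtain ⟨-, ⟨hi, hj⟩, ht₁, ht₂⟩ := h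
    have hd := disjoint_insert_sdiff (S := S) hv
    rw [erase_insert (mk_notMem_union hd ht₁.subset_edges ht₂.subset_edges hi hj),
      prod_union ((disjoint_edges hd).mono ht₁.subset_edges ht₂.subset_edges)]
  · rintro ⟨E, e⟩ _
    exact mul_nonneg (hm _) (prod_nonneg fun _ _ => hw _)

end TreeSum

/-! ### The tree bound in terms of `ζ` -/

section KirkwoodSalsburg

variable {W V : Finset ι} {E : Finset (Sym2 ι)}

/-- Forests with set of roots `W` and set of other vertices `V`, one tree for each root. A forest is
built by adding a root `k` whose children `S` were roots before. -/
inductive ForestOn : Finset ι → Finset ι → Finset (Sym2 ι) → Prop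
  | empty : ForestOn ∅ ∅ ∅
  | step {W S V : Finset ι} {E : Finset (Sym2 ι)} {k : ι}
      (hkW : k ∉ W) (hkS : k ∉ S) (hkV : k ∉ V) (hWS : Disjoint W S) (hV : Disjoint (W ∪ S) V)
      (h : ForestOn (W ∪ S) V E) :
      ForestOn (insert k W) (S ∪ V) (S.image (fun j => s(k, j)) ∪ E)

theorem ForestOn.subset_edges (h : ForestOn W V E) :
    E ⊆ edges (W ∪ V) := by
  induction h with
  | empty => simp
  | @step W S V E k hkW hkS hkV _ _ _ ih =>
    rw [union_assoc] at ih
    rw [insert_union, edges_insert (by simp [hkW, hkS, hkV])]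
    refine union_subset_union (image_subset_image fun x hx => ?_) ih
    simp [hx]

theorem TreeOn.union_leaves {Q : Finset ι} (h : TreeOn Q E) {k : ι}
    (hk : k ∈ Q) {S : Finset ι} (hS : Disjoint Q S) :
    TreeOn (Q ∪ S) (S.image (fun j => s(k, j)) ∪ E) := by
  induction S using Finset.induction_on with
  | empty => simpa
  | insert a S ha ih =>
    rw [disjoint_insert_right] at hS
    have hjoin := TreeOn.join (disjoint_singleton_right.2 (by simp [hS.1, ha])) (ih hS.2)
      (.single a) (mem_union_left _ hk) (mem_singleton_self a)
    convert hjoin using 1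
    · rw [union_insert, union_singleton]
    · rw [image_insert, insert_union, union_empty]

theorem ForestOn.treeOn_union (h : ForestOn W V E)
    {Q : Finset ι} {E₀ : Finset (Sym2 ι)} (hQ : TreeOn Q E₀) (hWQ : W ⊆ Q) (hQV : Disjoint Q V) :
    TreeOn (Q ∪ V) (E ∪ E₀) := by
  induction h generalizing Q E₀ with
  | empty => simpa
  | @step W S V E k _ _ _ _ hV _ ih =>
    rw [insert_subset_iff] at hWQ
    rw [disjoint_union_right] at hQV
    have htree := ih (hQ.union_leaves hWQ.1 hQV.1) (union_subset_union_left hWQ.2)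
      (disjoint_union_left.2 ⟨hQV.2, hV.mono_left subset_union_right⟩)
    rwa [union_assoc, ← union_assoc E, union_comm E] at htree

open Classical in
/-- The edge sets of the forests with set of roots `W` and set of other vertices `V`. -/
def forests (W V : Finset ι) : Finset (Finset (Sym2 ι)) :=
  (edges (W ∪ V)).powerset.filter (ForestOn W V)

theorem mem_forests : E ∈ forests W V ↔ ForestOn W V E := by
  simp only [forests, mem_filter, mem_powerset, and_iff_right_iff_imp]
  exact fun h => h.subset_edges

section Star

variable {k : ι} {S : Finset ι}

theorem ForestOn.mk_notMem (h : ForestOn W V E) (hkW : k ∉ W) (hkV : k ∉ V) (j : ι) :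
    s(k, j) ∉ E := by
  intro hj
  simpa [hkW, hkV] using (mk_mem_edges.1 (h.subset_edges hj)).1

theorem mk_mem_star_union (hE : ∀ j, s(k, j) ∉ E) (j : ι) :
    s(k, j) ∈ S.image (fun j => s(k, j)) ∪ E ↔ j ∈ S := by
  simp only [mem_union, mem_image, Sym2.congr_right, exists_eq_right, hE, or_false]

theorem disjoint_star (hE : ∀ j, s(k, j) ∉ E) : Disjoint (S.image fun j => s(k, j)) E := by
  rw [disjoint_left]
  intro e he
  obtain ⟨j, -, rfl⟩ := mem_image.1 he
  exact hE j

theorem eq_of_star_union_eq {S' : Finset ι} {E' : Finset (Sym2 ι)} (hE : ∀ j, s(k, j) ∉ E)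
    (hE' : ∀ j, s(k, j) ∉ E')
    (h : S.image (fun j => s(k, j)) ∪ E = S'.image (fun j => s(k, j)) ∪ E') :
    S = S' ∧ E = E' := by
  obtain rfl : S = S' := by
    ext j
    rw [← mk_mem_star_union hE, h, mk_mem_star_union hE']
  exact ⟨rfl, by rw [← union_sdiff_cancel_left (disjoint_star hE), h,
    union_sdiff_cancel_left (disjoint_star hE')]⟩

end Star

section ForestSum

variable {R : Type*} [CommSemiring R]

/-- The sum over the forests rooted in `W` of the product of `w` over the edges. -/
def forestSum (w : Sym2 ι → R) (W V : Finset ι) : R := ∑ E ∈ forests W V, ∏ e ∈ E, w e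

variable [PartialOrder R] [IsOrderedRing R] {w : Sym2 ι → R}

theorem forestSum_nonneg (hw : ∀ e, 0 ≤ w e) (W V : Finset ι) : 0 ≤ forestSum w W V :=
  sum_nonneg fun _ _ => prod_nonneg fun _ _ => hw _

theorem one_le_forestSum_empty (hw : ∀ e, 0 ≤ w e) : 1 ≤ forestSum w ∅ ∅ := by
  simpa [forestSum] using single_le_sum (f := fun E => ∏ e ∈ E, w e)
    (fun E _ => prod_nonneg fun _ _ => hw _) (mem_forests.2 (ForestOn.empty (ι := ι)))

theorem forestSum_singleton_le (hw : ∀ e, 0 ≤ w e) {r : ι} (hr : r ∉ V) :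
    forestSum w {r} V ≤ treeSum w (insert r V) := by
  refine sum_le_sum_of_subset_of_nonneg (fun E hE => mem_trees.2 ?_)
    fun E _ _ => prod_nonneg fun _ _ => hw _
  have htree :=
    (mem_forests.1 hE).treeOn_union (.single r) subset_rfl (disjoint_singleton_left.2 hr)
  rwa [← insert_eq, union_empty] at htree

theorem sum_prod_mul_forestSum_le (hw : ∀ e, 0 ≤ w e) {k : ι} (hkW : k ∉ W) (hkV : k ∉ V)
    (hWV : Disjoint W V) :
    ∑ S ∈ V.powerset, (∏ j ∈ S, w s(k, j)) * forestSum w (W ∪ S) (V \ S) ≤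
      forestSum w (insert k W) V := by
  simp only [forestSum, mul_sum, sum_sigma']
  have hkE {S E} (hS : S ⊆ V) (hE : ForestOn (W ∪ S) (V \ S) E) : ∀ j, s(k, j) ∉ E :=
    hE.mk_notMem (by simp [hkW, mt (@hS k) hkV]) (by simp [hkV])
  refine sum_le_sum_of_injOn (fun p => p.1.image (fun j => s(k, j)) ∪ p.2) ?_ ?_ ?_ ?_
  · rintro ⟨S, E⟩ h
    simp only [mem_sigma, mem_powerset, mem_forests] at h ⊢
    have hstep := ForestOn.step hkW (fun h0 => hkV (h.1 h0)) (fun h0 => hkV (mem_sdiff.1 h0).1)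
      (hWV.mono_right h.1)
      (disjoint_union_left.2 ⟨hWV.mono_right sdiff_subset, disjoint_sdiff⟩) h.2
    rwa [union_sdiff_of_subset h.1] at hstep
  · rintro ⟨S, E⟩ h ⟨S', E'⟩ h' heq
    simp only [coe_sigma, Set.mem_sigma_iff, mem_coe, mem_powerset, mem_forests] at h h' heq
    obtain ⟨rfl, rfl⟩ := eq_of_star_union_eq (hkE h.1 h.2) (hkE h'.1 h'.2) heq
    rfl
  · rintro ⟨S, E⟩ h
    simp only [mem_sigma, mem_powerset, mem_forests] at h
    rw [prod_union (disjoint_star (hkE h.1 h.2)),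
      prod_image fun _ _ _ _ h => Sym2.congr_right.1 h]
  · exact fun E _ => prod_nonneg fun _ _ => hw _

end ForestSum

section RootedSum

theorem sum_powerset_powerset_comm {R : Type*} [AddCommMonoid R] (V : Finset ι)
    (f : Finset ι → Finset ι → Finset ι → R) :
    ∑ Q ∈ V.powerset, ∑ S ∈ Q.powerset, f S (Q \ S) (V \ Q) =
      ∑ S ∈ V.powerset, ∑ T ∈ (V \ S).powerset, f S T ((V \ S) \ T) := by
  simp only [sum_sigma']
  refine sum_bij' (fun p _ => ⟨p.2, p.1 \ p.2⟩) (fun p _ => ⟨p.1 ∪ p.2, p.1⟩) ?_ ?_ ?_ ?_ ?_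
  · rintro ⟨Q, S⟩ h
    simp only [mem_sigma, mem_powerset] at h ⊢
    exact ⟨h.2.trans h.1, sdiff_subset_sdiff h.1 subset_rfl⟩
  · rintro ⟨S, T⟩ h
    simp only [mem_sigma, mem_powerset] at h ⊢
    exact ⟨union_subset h.1 (h.2.trans sdiff_subset), subset_union_left⟩
  · rintro ⟨Q, S⟩ h
    simp only [mem_sigma, mem_powerset] at h ⊢
    rw [union_sdiff_of_subset h.2]
  · rintro ⟨S, T⟩ h
    simp only [mem_sigma, mem_powerset] at h ⊢
    rw [union_sdiff_cancel_left (disjoint_sdiff.mono_right h.2)]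
  · rintro ⟨Q, S⟩ h
    simp only [mem_sigma, mem_powerset] at h ⊢
    rw [sdiff_sdiff_left, sup_eq_union, union_sdiff_of_subset h.2]

variable {R : Type*} [CommRing R]

theorem eq_of_sum_powerset_mul_eq {F f g : Finset ι → R} (hF : F ∅ = 1) (V : Finset ι)
    (h : ∀ Q ⊆ V, ∑ S ∈ Q.powerset, f S * F (Q \ S) = ∑ S ∈ Q.powerset, g S * F (Q \ S)) :
    f V = g V := by
  induction V using Finset.strongInduction with
  | H V ih =>
    have hV := h V subset_rfl
    rw [← insert_erase (mem_powerset_self V), sum_insert (notMem_erase _ _),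
      sum_insert (notMem_erase _ _), sdiff_self, bot_eq_empty, hF, mul_one, mul_one] at hV
    have hproper : ∀ S ∈ V.powerset.erase V, f S * F (V \ S) = g S * F (V \ S) := by
      intro S hS
      obtain ⟨h1, h2⟩ := mem_erase.1 hS
      rw [ih S ((mem_powerset.1 h2).ssubset_of_ne h1)
        fun Q hQ => h Q (hQ.trans (mem_powerset.1 h2))]
    rw [sum_congr rfl hproper] at hV
    exact add_right_cancel hV

/-- The sum over the graphs on `W ∪ V` all of whose connected components meet `W`, as determined
by its convolution with `fullProd`. -/
def rootedSum (ζ : Sym2 ι → R) (W V : Finset ι) : R :=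
  fullProd ζ (W ∪ V) - ∑ S ∈ V.ssubsets.attach, rootedSum ζ W S.1 * fullProd ζ (V \ S.1)
termination_by V.card
decreasing_by exact card_lt_card (mem_ssubsets.1 S.2)

theorem sum_rootedSum_mul_fullProd (ζ : Sym2 ι → R) (W V : Finset ι) :
    ∑ S ∈ V.powerset, rootedSum ζ W S * fullProd ζ (V \ S) = fullProd ζ (W ∪ V) := by
  have h : rootedSum ζ W V = fullProd ζ (W ∪ V) -
      ∑ S ∈ V.ssubsets, rootedSum ζ W S * fullProd ζ (V \ S) := by
    rw [rootedSum, sum_attach _ fun S => rootedSum ζ W S * fullProd ζ (V \ S)]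
  rw [← insert_erase (mem_powerset_self V), sum_insert (notMem_erase _ _), h, ssubsets]
  simp

theorem rootedSum_singleton (ζ : Sym2 ι → R) {r : ι} {V : Finset ι} (hr : r ∉ V) :
    rootedSum ζ {r} V = connSum ζ (insert r V) := by
  refine eq_of_sum_powerset_mul_eq (F := fullProd ζ) (f := rootedSum ζ {r})
    (g := fun S => connSum ζ (insert r S)) (fullProd_empty ζ) V fun Q hQ => ?_
  rw [sum_rootedSum_mul_fullProd, ← insert_eq, fullProd_insert_eq_sum_connSum ζ fun h => hr (hQ h)]

theorem rootedSum_empty_left (ζ : Sym2 ι → R) (V : Finset ι) :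
    rootedSum ζ ∅ V = if V = ∅ then 1 else 0 := by
  refine eq_of_sum_powerset_mul_eq (F := fullProd ζ) (f := rootedSum ζ ∅)
    (g := fun S => if S = ∅ then 1 else 0) (fullProd_empty ζ) V fun Q _ => ?_
  rw [sum_rootedSum_mul_fullProd]
  simp

/-- The Kirkwood–Salsburg recursion. -/
theorem rootedSum_insert (ζ : Sym2 ι → R) {k : ι} {W V : Finset ι} (hkW : k ∉ W) (hkV : k ∉ V)
    (hWV : Disjoint W V) : rootedSum ζ (insert k W) V = (∏ j ∈ W, (1 + ζ s(k, j))) *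
      ∑ S ∈ V.powerset, (∏ j ∈ S, ζ s(k, j)) * rootedSum ζ (W ∪ S) (V \ S) := by
  refine eq_of_sum_powerset_mul_eq (F := fullProd ζ) (f := rootedSum ζ (insert k W))
    (g := fun Q => (∏ j ∈ W, (1 + ζ s(k, j))) *
      ∑ S ∈ Q.powerset, (∏ j ∈ S, ζ s(k, j)) * rootedSum ζ (W ∪ S) (Q \ S))
    (fullProd_empty ζ) V fun Q hQ => ?_
  have h := sum_powerset_powerset_comm Q fun S T U =>
    (∏ j ∈ S, ζ s(k, j)) * rootedSum ζ (W ∪ S) T * fullProd ζ U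
  have hkQ : k ∉ Q := fun h => hkV (hQ h)
  simp only [mul_assoc, sum_mul, ← mul_sum] at h ⊢
  rw [h, sum_rootedSum_mul_fullProd, insert_union,
    fullProd_insert ζ (by simp [hkW, hkQ]), prod_union (hWV.mono_right hQ),
    mul_assoc, prod_one_add (s := Q), sum_mul]
  congr 1
  refine sum_congr rfl fun S hS => ?_
  rw [sum_rootedSum_mul_fullProd, union_assoc, union_sdiff_of_subset (mem_powerset.1 hS)]

end RootedSum

section StabilityBound

theorem prod_prod_erase_eq_sq {M : Type*} [CommMonoid M] (f : Sym2 ι → M) (W : Finset ι) :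
    ∏ k ∈ W, ∏ j ∈ W.erase k, f s(k, j) = (∏ e ∈ edges W, f e) ^ 2 := by
  induction W using Finset.induction_on with
  | empty => simp
  | insert a W ha ih =>
    have hins (k) (hk : k ∈ W) : ∏ j ∈ (insert a W).erase k, f s(k, j) =
        f s(a, k) * ∏ j ∈ W.erase k, f s(k, j) := by
      have hak : a ≠ k := fun h => ha (h ▸ hk)
      rw [erase_insert_of_ne hak, prod_insert (fun h => ha (mem_of_mem_erase h)), Sym2.eq_swap]
    rw [prod_insert ha, erase_insert ha, prod_edges_insert ha, mul_pow, ← ih,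
      prod_congr rfl hins, prod_mul_distrib, ← mul_assoc, ← sq]

/-- Each pair is counted twice in the product over `k`, which gives the factor `2`. -/
theorem exists_prod_erase_le {f : Sym2 ι → ℝ} (hf : ∀ e, 0 ≤ f e) {b : ι → ℝ}
    (hW : W.Nonempty) (h : ∏ e ∈ edges W, f e ≤ ∏ i ∈ W, Real.exp (b i)) :
    ∃ k ∈ W, ∏ j ∈ W.erase k, f s(k, j) ≤ Real.exp (2 * b k) := by
  by_contra! hcon
  refine (prod_lt_prod_of_nonempty (fun _ _ => Real.exp_pos _) hcon hW).not_ge ?_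
  calc ∏ k ∈ W, ∏ j ∈ W.erase k, f s(k, j) = (∏ e ∈ edges W, f e) ^ 2 :=
        prod_prod_erase_eq_sq f W
    _ ≤ (∏ i ∈ W, Real.exp (b i)) ^ 2 := pow_le_pow_left₀ (prod_nonneg fun _ _ => hf _) h 2
    _ = ∏ k ∈ W, Real.exp (2 * b k) := by simp [← prod_pow, ← Real.exp_nat_mul]

variable {𝕜 : Type*} [NormedField 𝕜] {ζ : Sym2 ι → 𝕜} {b : ι → ℝ}

theorem norm_rootedSum_insert_le {k : ι} {B C : ℝ} (hC : 0 ≤ C) (hkW : k ∉ W) (hkV : k ∉ V)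
    (hWV : Disjoint W V) (hB : ∏ j ∈ W, ‖1 + ζ s(k, j)‖ ≤ B)
    (h : ∀ S ⊆ V, ‖rootedSum ζ (W ∪ S) (V \ S)‖ ≤
      C * forestSum (fun e => ‖ζ e‖) (W ∪ S) (V \ S)) :
    ‖rootedSum ζ (insert k W) V‖ ≤ B * (C * forestSum (fun e => ‖ζ e‖) (insert k W) V) := by
  rw [rootedSum_insert ζ hkW hkV hWV, norm_mul, norm_prod]
  refine mul_le_mul hB ?_ (norm_nonneg _) ((prod_nonneg fun _ _ => norm_nonneg _).trans hB)
  calc ‖∑ S ∈ V.powerset, (∏ j ∈ S, ζ s(k, j)) * rootedSum ζ (W ∪ S) (V \ S)‖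
      ≤ ∑ S ∈ V.powerset,
          (∏ j ∈ S, ‖ζ s(k, j)‖) * (C * forestSum (fun e => ‖ζ e‖) (W ∪ S) (V \ S)) := by
        refine norm_sum_le_of_le _ fun S hS => ?_
        rw [norm_mul, norm_prod]
        exact mul_le_mul_of_nonneg_left (h S (mem_powerset.1 hS))
          (prod_nonneg fun _ _ => norm_nonneg _)
    _ = C * ∑ S ∈ V.powerset,
          (∏ j ∈ S, ‖ζ s(k, j)‖) * forestSum (fun e => ‖ζ e‖) (W ∪ S) (V \ S) := by
        simp only [mul_sum, mul_left_comm]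
    _ ≤ C * forestSum (fun e => ‖ζ e‖) (insert k W) V := mul_le_mul_of_nonneg_left
        (sum_prod_mul_forestSum_le (fun _ => norm_nonneg _) hkW hkV hWV) hC

theorem norm_rootedSum_le
    (hst : ∀ V : Finset ι, ∏ e ∈ edges V, ‖1 + ζ e‖ ≤ ∏ i ∈ V, Real.exp (b i))
    (hWV : Disjoint W V) :
    ‖rootedSum ζ W V‖ ≤
      (∏ i ∈ W ∪ V, Real.exp (2 * b i)) * forestSum (fun e => ‖ζ e‖) W V := by
  have hforest := forestSum_nonneg fun e => norm_nonneg (ζ e)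
  induction hn : (W ∪ V).card generalizing W V with
  | zero =>
    obtain ⟨rfl, rfl⟩ := union_eq_empty.1 (card_eq_zero.1 hn)
    simpa [rootedSum_empty_left] using one_le_forestSum_empty (ι := ι) fun e => norm_nonneg (ζ e)
  | succ n ih =>
    rcases W.eq_empty_or_nonempty with rfl | hW
    · have hV : V ≠ ∅ := by rintro rfl; simp at hn
      simp only [rootedSum_empty_left, hV, if_false, norm_zero]
      exact mul_nonneg (prod_nonneg fun _ _ => (Real.exp_pos _).le) (hforest _ _)
    obtain ⟨k, hk, hkb⟩ := exists_prod_erase_le (fun _ => norm_nonneg _) hW (hst W)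
    obtain ⟨W, hkW, rfl⟩ : ∃ W', k ∉ W' ∧ insert k W' = W :=
      ⟨W.erase k, notMem_erase _ _, insert_erase hk⟩
    rw [erase_insert hkW] at hkb
    obtain ⟨hkV, hWV⟩ := disjoint_insert_left.1 hWV
    have hkWV : k ∉ W ∪ V := by simp [hkW, hkV]
    rw [insert_union, card_insert_of_notMem hkWV, add_left_inj] at hn
    rw [insert_union, prod_insert hkWV, mul_assoc]
    refine norm_rootedSum_insert_le (prod_nonneg fun _ _ => (Real.exp_pos _).le) hkW hkV hWV hkb
      fun S hS => ?_
    have hunion : W ∪ S ∪ V \ S = W ∪ V := by rw [union_assoc, union_sdiff_of_subset hS]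
    simpa only [hunion] using ih (W := W ∪ S) (V := V \ S)
      (disjoint_union_left.2 ⟨hWV.mono_right sdiff_subset, disjoint_sdiff⟩) (by rw [hunion, hn])

theorem norm_connSum_le_treeSum_zeta
    (hst : ∀ V : Finset ι, ∏ e ∈ edges V, ‖1 + ζ e‖ ≤ ∏ i ∈ V, Real.exp (b i))
    (hV : V.Nonempty) :
    ‖connSum ζ V‖ ≤ (∏ i ∈ V, Real.exp (2 * b i)) * treeSum (fun e => ‖ζ e‖) V := by
  obtain ⟨r, hr⟩ := hV
  obtain ⟨V, hrV, rfl⟩ : ∃ V', r ∉ V' ∧ insert r V' = V :=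
    ⟨V.erase r, notMem_erase _ _, insert_erase hr⟩
  calc ‖connSum ζ (insert r V)‖ = ‖rootedSum ζ {r} V‖ := by rw [rootedSum_singleton ζ hrV]
    _ ≤ (∏ i ∈ insert r V, Real.exp (2 * b i)) * forestSum (fun e => ‖ζ e‖) {r} V :=
        norm_rootedSum_le hst (disjoint_singleton_left.2 hrV)
    _ ≤ _ := mul_le_mul_of_nonneg_left (forestSum_singleton_le (fun e => norm_nonneg _) hrV)
        (prod_nonneg fun _ _ => (Real.exp_pos _).le)

end StabilityBound

end KirkwoodSalsburg

/-! ### The tree bound in terms of `u` -/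

section CrossSum

variable {v : ι} {V : Finset ι}

theorem norm_crossSum_le {R : Type*} [NormedCommRing R] {u : Sym2 ι → R} {m : Sym2 ι → ℝ}
    {c : Finset ι → R} {d : Finset ι → ℝ} {K : ℝ} (hm : ∀ e, ‖u e‖ ≤ m e)
    (h : ∀ S ⊆ V, (V \ S).Nonempty →
      ‖c (insert v S)‖ * ‖c (V \ S)‖ ≤ K * (d (insert v S) * d (V \ S))) :
    ‖crossSum u c v V‖ ≤ K * crossSum m d v V := by
  rw [crossSum, crossSum, mul_sum]
  refine norm_sum_le_of_le _ fun S hS => ?_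
  rcases (V \ S).eq_empty_or_nonempty with hempty | hne
  · simp [hempty]
  have hum : ‖∑ i ∈ insert v S, ∑ j ∈ V \ S, u s(i, j)‖ ≤
      ∑ i ∈ insert v S, ∑ j ∈ V \ S, m s(i, j) :=
    norm_sum_le_of_le _ fun i _ => norm_sum_le_of_le _ fun j _ => hm _
  calc _ ≤ ‖∑ i ∈ insert v S, ∑ j ∈ V \ S, u s(i, j)‖ * (‖c (insert v S)‖ * ‖c (V \ S)‖) :=
        (norm_mul_le _ _).trans (mul_le_mul_of_nonneg_left (norm_mul_le _ _) (norm_nonneg _))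
    _ ≤ (∑ i ∈ insert v S, ∑ j ∈ V \ S, m s(i, j)) * (K * (d (insert v S) * d (V \ S))) :=
        mul_le_mul hum (h S (mem_powerset.1 hS) hne) (by positivity) ((norm_nonneg _).trans hum)
    _ = _ := mul_left_comm ..

variable {R : Type*} [CommSemiring R] (ζ : Sym2 ι → R)

theorem sum_filter_mem_powerset_connSum_mul_fullProd {j : ι} (hj : j ∈ V) :
    ∑ T ∈ V.powerset with j ∈ T, connSum ζ T * fullProd ζ (V \ T) = fullProd ζ V := by
  obtain ⟨W, hjW, rfl⟩ : ∃ W, j ∉ W ∧ insert j W = V :=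
    ⟨V.erase j, notMem_erase _ _, insert_erase hj⟩
  have hvanish (T) (hT : T ∈ W.powerset) :
      (if j ∈ T then connSum ζ T * fullProd ζ (insert j W \ T) else 0) = 0 :=
    if_neg fun h => hjW (mem_powerset.1 hT h)
  rw [sum_filter, sum_powerset_insert hjW, sum_congr rfl hvanish, sum_const_zero, zero_add,
    fullProd_insert_eq_sum_connSum ζ hjW]
  refine sum_congr rfl fun T _ => ?_
  rw [if_pos (mem_insert_self _ _), insert_sdiff_insert, sdiff_insert_of_notMem hjW]

theorem sum_mul_connSum_mul_fullProd (x : ι → R) (V : Finset ι) :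
    ∑ T ∈ V.powerset, (∑ j ∈ T, x j) * (connSum ζ T * fullProd ζ (V \ T)) =
      (∑ j ∈ V, x j) * fullProd ζ V := by
  simp only [sum_mul]
  rw [sum_comm' (t' := V) (s' := fun j => {T ∈ V.powerset | j ∈ T})]
  · refine sum_congr rfl fun j hj => ?_
    rw [← mul_sum, sum_filter_mem_powerset_connSum_mul_fullProd ζ hj]
  · intro T j
    simp only [mem_powerset, mem_filter]
    exact ⟨fun h => ⟨h, h.1 h.2⟩, fun h => h.1⟩

theorem sum_crossSum_mul_fullProd (u : Sym2 ι → R) (v : ι) (V : Finset ι) :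
    ∑ Q ∈ V.powerset, crossSum u (connSum ζ) v Q * fullProd ζ (V \ Q) =
      ∑ S ∈ V.powerset, (∑ i ∈ insert v S, ∑ j ∈ V \ S, u s(i, j)) *
        (connSum ζ (insert v S) * fullProd ζ (V \ S)) := by
  simp only [crossSum]
  rw [sum_congr rfl fun Q _ => sum_mul Q.powerset _ _,
    sum_powerset_powerset_comm V fun S T U => (∑ i ∈ insert v S, ∑ j ∈ T, u s(i, j)) *
      (connSum ζ (insert v S) * connSum ζ T) * fullProd ζ U]
  refine sum_congr rfl fun S _ => ?_
  rw [sum_comm (s := insert v S), mul_left_comm,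
    ← sum_mul_connSum_mul_fullProd ζ (fun j => ∑ i ∈ insert v S, u s(i, j)), mul_sum]
  refine sum_congr rfl fun T _ => ?_
  rw [sum_comm (s := insert v S)]
  ring

end CrossSum

section Interpolation

/-- The interaction `ζ` of the potential `t * u`. -/
def scaledZeta (u : Sym2 ι → ℂ) (t : ℝ) (e : Sym2 ι) : ℂ := Complex.exp (-(t * u e)) - 1

theorem hasDerivAt_exp_neg_mul (z : ℂ) (t : ℝ) :
    HasDerivAt (fun t : ℝ => Complex.exp (-(t * z))) (-z * Complex.exp (-(t * z))) t := by
  have h : HasDerivAt (fun t : ℝ => -((t : ℂ) * z)) (-(1 * z)) t :=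
    ((Complex.ofRealCLM.hasDerivAt (x := t)).mul_const z).neg
  convert h.cexp using 1
  ring

theorem hasDerivAt_fullProd_scaledZeta (u : Sym2 ι → ℂ) (V : Finset ι) (t : ℝ) :
    HasDerivAt (fun t => fullProd (scaledZeta u t) V)
      (-(∑ e ∈ edges V, u e) * fullProd (scaledZeta u t) V) t := by
  have hexp (t : ℝ) :
      fullProd (scaledZeta u t) V = Complex.exp (-(t * ∑ e ∈ edges V, u e)) := by
    simp [fullProd, scaledZeta, ← Complex.exp_sum, mul_sum]
  simp only [hexp]
  exact hasDerivAt_exp_neg_mul _ t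

theorem differentiable_connSum_scaledZeta (u : Sym2 ι → ℂ) (V : Finset ι) :
    Differentiable ℝ fun t => connSum (scaledZeta u t) V := by
  have hζ (e) : Differentiable ℝ fun t => scaledZeta u t e := fun t =>
    ((hasDerivAt_exp_neg_mul (u e) t).sub_const 1).differentiableAt
  unfold connSum
  fun_prop

variable {u : Sym2 ι → ℂ} {v : ι} {V : Finset ι} {t : ℝ}

theorem sum_deriv_add_mul_fullProd {D : Finset ι → ℂ}
    (hD : ∀ V, HasDerivAt (fun t => connSum (scaledZeta u t) V) (D V) t) (hv : v ∉ V) :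
    ∑ S ∈ V.powerset,
        (D (insert v S) + (∑ e ∈ edges (insert v S), u e) * connSum (scaledZeta u t) (insert v S)) *
          fullProd (scaledZeta u t) (V \ S) =
      -∑ S ∈ V.powerset, (∑ i ∈ insert v S, ∑ j ∈ V \ S, u s(i, j)) *
        (connSum (scaledZeta u t) (insert v S) * fullProd (scaledZeta u t) (V \ S)) := by
  set F := fullProd (scaledZeta u t)
  set C := connSum (scaledZeta u t)
  have hderiv : -(∑ e ∈ edges (insert v V), u e) * F (insert v V) =
      ∑ S ∈ V.powerset, (D (insert v S) * F (V \ S) +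
        C (insert v S) * (-(∑ e ∈ edges (V \ S), u e) * F (V \ S))) := by
    refine (hasDerivAt_fullProd_scaledZeta u (insert v V) t).unique ?_
    simp only [fullProd_insert_eq_sum_connSum _ hv]
    exact HasDerivAt.fun_sum fun S _ => (hD _).mul (hasDerivAt_fullProd_scaledZeta u _ t)
  have hedges (S) (hS : S ∈ V.powerset) :
      ∑ e ∈ edges (insert v V), u e = ∑ e ∈ edges (insert v S), u e +
        ∑ e ∈ edges (V \ S), u e + ∑ i ∈ insert v S, ∑ j ∈ V \ S, u s(i, j) := by
    rw [← sum_edges_union (disjoint_insert_sdiff hv), insert_union,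
      union_sdiff_of_subset (mem_powerset.1 hS)]
  rw [show F (insert v V) = _ from fullProd_insert_eq_sum_connSum _ hv, mul_sum, ← sub_eq_zero,
    ← sum_sub_distrib] at hderiv
  rw [eq_neg_iff_add_eq_zero, ← sum_add_distrib, ← neg_eq_zero, ← hderiv, ← sum_neg_distrib]
  refine sum_congr rfl fun S hS => ?_
  rw [hedges S hS]
  ring

theorem hasDerivAt_connSum_scaledZeta (u : Sym2 ι → ℂ) (hv : v ∉ V) (t : ℝ) :
    HasDerivAt (fun t => connSum (scaledZeta u t) (insert v V))
      (-(∑ e ∈ edges (insert v V), u e) * connSum (scaledZeta u t) (insert v V) -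
        crossSum u (connSum (scaledZeta u t)) v V) t := by
  set D : Finset ι → ℂ := fun V => deriv (fun t => connSum (scaledZeta u t) V) t
  have hD (V) : HasDerivAt (fun t => connSum (scaledZeta u t) V) (D V) t :=
    (differentiable_connSum_scaledZeta u V t).hasDerivAt
  have hsolve : D (insert v V) +
      (∑ e ∈ edges (insert v V), u e) * connSum (scaledZeta u t) (insert v V) =
        -crossSum u (connSum (scaledZeta u t)) v V := by
    refine eq_of_sum_powerset_mul_eq (F := fullProd (scaledZeta u t))
      (f := fun V => D (insert v V) +
        (∑ e ∈ edges (insert v V), u e) * connSum (scaledZeta u t) (insert v V))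
      (g := fun V => -crossSum u (connSum (scaledZeta u t)) v V) (fullProd_empty _) V
      fun Q hQ => ?_
    simp only [neg_mul, sum_neg_distrib]
    rw [sum_deriv_add_mul_fullProd hD fun h => hv (hQ h), sum_crossSum_mul_fullProd]
  exact (hD (insert v V)).congr_deriv (by linear_combination hsolve)

theorem hasDerivAt_exp_mul_connSum_scaledZeta (u : Sym2 ι → ℂ) (hv : v ∉ V) (t : ℝ) :
    HasDerivAt (fun t : ℝ => Complex.exp (t * ∑ e ∈ edges (insert v V), u e) *
        connSum (scaledZeta u t) (insert v V))
      (-(Complex.exp (t * ∑ e ∈ edges (insert v V), u e) *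
        crossSum u (connSum (scaledZeta u t)) v V)) t := by
  have hexp := hasDerivAt_exp_neg_mul (-∑ e ∈ edges (insert v V), u e) t
  simp only [mul_neg, neg_neg] at hexp
  refine (hexp.mul (hasDerivAt_connSum_scaledZeta u hv t)).congr_deriv ?_
  ring

theorem connSum_zero {R : Type*} [CommSemiring R] (hV : V.Nontrivial) :
    connSum (fun _ => (0 : R)) V = 0 := by
  classical
  obtain ⟨i, hi, j, hj, hij⟩ := hV
  refine sum_eq_zero fun E hE => ?_
  rcases E.eq_empty_or_nonempty with rfl | ⟨e, he⟩
  · have hji : j = i := (mem_filter.1 hE).2 {i} (fun _ _ h => by simp at h) i hi j hj rfl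
    exact absurd hji.symm hij
  · exact prod_eq_zero he rfl

theorem hasDerivAt_treeSum {ω : Sym2 ι → ℝ → ℝ} {ω' : Sym2 ι → ℝ}
    (h : ∀ e, HasDerivAt (ω e) (ω' e) t) (V : Finset ι) :
    HasDerivAt (fun t => treeSum (fun e => ω e t) V)
      (∑ E ∈ trees V, ∑ e ∈ E, ω' e * ∏ f ∈ E.erase e, ω f t) t := by
  refine HasDerivAt.fun_sum fun E _ => ?_
  simpa only [smul_eq_mul, mul_comm] using HasDerivAt.fun_finsetProd (u := E) fun e _ => h e

theorem sum_trees_mul_prod_erase_le {κ m w : Sym2 ι → ℝ} {α : ℝ} (hκ : ∀ e, 0 ≤ κ e)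
    (hw : ∀ e, 0 ≤ w e) (hα : ∑ e ∈ edges V, κ e ≤ α) :
    ∑ E ∈ trees V, ∑ e ∈ E, m e * ∏ f ∈ E.erase e, w f ≤
      α * treeSum w V + ∑ E ∈ trees V, ∑ e ∈ E, (m e - κ e * w e) * ∏ f ∈ E.erase e, w f := by
  rw [treeSum, mul_sum, ← sum_add_distrib]
  refine sum_le_sum fun E hE => ?_
  have hsub (e) (he : e ∈ E) : (m e - κ e * w e) * ∏ f ∈ E.erase e, w f =
      m e * ∏ f ∈ E.erase e, w f - κ e * ∏ f ∈ E, w f := by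
    rw [← mul_prod_erase E _ he]
    ring
  have hκE : ∑ e ∈ E, κ e ≤ α :=
    (sum_le_sum_of_subset_of_nonneg (mem_trees.1 hE).subset_edges fun _ _ _ => hκ _).trans hα
  have hprod : (∑ e ∈ E, κ e) * ∏ f ∈ E, w f ≤ α * ∏ f ∈ E, w f :=
    mul_le_mul_of_nonneg_right hκE (prod_nonneg fun _ _ => hw _)
  rw [sum_congr rfl hsub, sum_sub_distrib, ← sum_mul]
  linarith

/-- Both sides, multiplied by `exp (t * U)` with `U` the total potential, are compared through their
derivatives. -/
theorem norm_connSum_scaledZeta_le_of_norm_crossSum_le {y y' : ℝ → ℝ} {β : ℝ} (hv : v ∉ V)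
    (hV : V.Nonempty) (hy0 : 0 ≤ y 0) (hy : ∀ t, HasDerivAt y (y' t) t)
    (h : ∀ t, 0 ≤ t → ‖crossSum u (connSum (scaledZeta u t)) v V‖ ≤
      Real.exp (t * β) * ((∑ e ∈ edges (insert v V), (u e).re + β) * y t + y' t))
    (ht : 0 ≤ t) :
    ‖connSum (scaledZeta u t) (insert v V)‖ ≤ Real.exp (t * β) * y t := by
  set U : ℂ := ∑ e ∈ edges (insert v V), u e
  have hre : U.re = ∑ e ∈ edges (insert v V), (u e).re := by simp [U]
  rw [← hre] at h
  have hnorm (t : ℝ) : ‖Complex.exp (t * U)‖ = Real.exp (t * U.re) := by simp [Complex.norm_exp]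
  have hconn := hasDerivAt_exp_mul_connSum_scaledZeta u hv
  have hbound (t : ℝ) : HasDerivAt (fun t : ℝ => Real.exp (t * (U.re + β)) * y t)
      (Real.exp (t * (U.re + β)) * ((U.re + β) * y t + y' t)) t := by
    refine ((hasDerivAt_mul_const (U.re + β)).exp.mul (hy t)).congr_deriv ?_
    ring
  have hcomparison := image_norm_le_of_norm_deriv_right_le_deriv_boundary (a := 0) (b := t)
    (fun x _ => (hconn x).continuousAt.continuousWithinAt) (fun x _ => (hconn x).hasDerivWithinAt)
    (B := fun t => Real.exp (t * (U.re + β)) * y t) ?_ hbound ?_ (Set.right_mem_Icc.2 ht)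
  · rw [norm_mul, hnorm] at hcomparison
    simp only [mul_add, Real.exp_add, mul_assoc] at hcomparison
    exact le_of_mul_le_mul_left hcomparison (Real.exp_pos _)
  · have hzero : scaledZeta u 0 = fun _ => 0 := by ext; simp [scaledZeta]
    obtain ⟨k, hk⟩ := hV
    rw [hzero, connSum_zero ⟨v, mem_insert_self v V, k, mem_insert_of_mem hk, fun h => hv (h ▸ hk)⟩]
    simpa using hy0
  · intro x hx
    rw [norm_neg, norm_mul, hnorm]
    refine (mul_le_mul_of_nonneg_left (h x hx.1) (Real.exp_pos _).le).trans_eq ?_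
    rw [← mul_assoc, ← Real.exp_add, ← mul_add]

/-- The weights `κ` are the part of the potential that stability keeps; a larger `κ` makes the
solution `ω` of its differential equation, hence the tree sum, smaller. -/
theorem norm_connSum_scaledZeta_le {κ m : Sym2 ι → ℝ} {ω : Sym2 ι → ℝ → ℝ}
    {b : ι → ℝ} (hκ : ∀ e, 0 ≤ κ e) (hm : ∀ e, ‖u e‖ ≤ m e) (hω : ∀ e t, 0 ≤ t → 0 ≤ ω e t)
    (hω' : ∀ e t, HasDerivAt (ω e) (m e - κ e * ω e t) t) (hb : ∀ i, 0 ≤ b i)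
    (hst : ∀ V : Finset ι, ∑ e ∈ edges V, κ e ≤ ∑ e ∈ edges V, (u e).re + ∑ i ∈ V, b i)
    (hV : V.Nonempty) (ht : 0 ≤ t) :
    ‖connSum (scaledZeta u t) V‖ ≤
      Real.exp (t * ∑ i ∈ V, b i) * treeSum (fun e => ω e t) V := by
  induction hn : V.card using Nat.strong_induction_on generalizing V t with
  | _ n ih =>
  obtain ⟨v, hvV⟩ := hV
  obtain ⟨V, hv, rfl⟩ : ∃ V', v ∉ V' ∧ insert v V' = V :=
    ⟨V.erase v, notMem_erase _ _, insert_erase hvV⟩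
  rcases V.eq_empty_or_nonempty with rfl | hV
  · simpa [connSum_singleton] using mul_nonneg ht (hb v)
  refine norm_connSum_scaledZeta_le_of_norm_crossSum_le hv hV
    (treeSum_nonneg (fun e => hω e 0 le_rfl) _) (fun t => hasDerivAt_treeSum (fun e => hω' e t) _)
    (fun t ht => ?_) ht
  have hm0 (e) : 0 ≤ m e := (norm_nonneg _).trans (hm e)
  refine (norm_crossSum_le hm fun S hS hVS => ?_).trans (mul_le_mul_of_nonneg_left
    ((crossSum_treeSum_le (fun e => hω e t ht) hm0 hv).trans
      (sum_trees_mul_prod_erase_le hκ (fun e => hω e t ht) (hst _))) (Real.exp_pos _).le)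
  rw [card_insert_of_notMem hv] at hn
  have hcard : (V \ S).card + (insert v S).card = V.card + 1 := by
    rw [card_insert_of_notMem fun h => hv (hS h), ← add_assoc, card_sdiff_add_card_eq_card hS]
  have hpos : 0 < (V \ S).card := card_pos.2 hVS
  have hpos' : 0 < (insert v S).card := card_pos.2 (insert_nonempty _ _)
  have hroot := ih _ (by omega) (insert_nonempty v S) ht rfl
  have hrest := ih _ (by omega) hVS ht rfl
  refine (mul_le_mul hroot hrest (norm_nonneg _) ((norm_nonneg _).trans hroot)).trans_eq ?_
  rw [mul_mul_mul_comm, ← Real.exp_add, ← mul_add, ← sum_union (disjoint_insert_sdiff hv),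
    insert_union, union_sdiff_of_subset hS]

end Interpolation

section SoftCore

open Filter Topology

variable {α : Type*} {u : Sym2 α → WithTop ℂ} {s A k t : ℝ}

theorem norm_expNeg_coe (z : ℂ) : ‖expNeg (z : WithTop ℂ)‖ = Real.exp (-z.re) := by
  rw [expNeg_coe, Complex.norm_exp, Complex.neg_re]

/-- The potential `u` with its hard core replaced by a finite repulsion of strength `s`. -/
def softCore (u : Sym2 α → WithTop ℂ) (s : ℝ) (e : Sym2 α) : ℂ := (u e).untopD (s : ℂ)

open Classical in
/-- The solution `ω` with `ω(0) = 0` of the equation `ω' = |softCore u s| - κ ω`, where `κ` is equal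
to `k` on the hard core and to `0` elsewhere. -/
def softWeight (u : Sym2 α → WithTop ℂ) (s k : ℝ) (e : Sym2 α) (t : ℝ) : ℝ :=
  if u e = ⊤ then s * ((1 - Real.exp (-(k * t))) / k) else ‖(u e).untopD 0‖ * t

theorem softWeight_nonneg (hs : 0 ≤ s) (hk : 0 < k) (ht : 0 ≤ t) (e : Sym2 α) :
    0 ≤ softWeight u s k e t := by
  rw [softWeight]
  split_ifs
  · have hexp : Real.exp (-(k * t)) ≤ 1 := Real.exp_le_one_iff.2 (by nlinarith)
    exact mul_nonneg hs (div_nonneg (by linarith) hk.le)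
  · positivity

open Classical in
theorem hasDerivAt_softWeight (hs : 0 ≤ s) (hk : k ≠ 0) (e : Sym2 α) (t : ℝ) :
    HasDerivAt (softWeight u s k e)
      (‖softCore u s e‖ - (if u e = ⊤ then k else 0) * softWeight u s k e t) t := by
  unfold softWeight softCore
  cases hu : u e with
  | top =>
    simp only [if_true, WithTop.untopD_top]
    have hlin : HasDerivAt (fun t : ℝ => -(k * t)) (-(k * 1)) t :=
      ((hasDerivAt_id t).const_mul k).neg
    refine (((hlin.exp.const_sub 1).div_const k).const_mul s).congr_deriv ?_
    rw [Complex.norm_real, Real.norm_of_nonneg hs]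
    field_simp
    ring
  | coe z =>
    simp only [WithTop.coe_ne_top, if_false, WithTop.untopD_coe, zero_mul, sub_zero]
    simpa using (hasDerivAt_id t).const_mul ‖z‖

open Classical in
theorem neg_norm_untopD_le_re_softCore_sub (hA : 0 ≤ A) (e : Sym2 α) :
    -‖(u e).untopD 0‖ ≤ (softCore u (A + k) e).re - if u e = ⊤ then k else 0 := by
  cases hu : u e with
  | top => simp [softCore, hu, hA]
  | coe z =>
    simp only [softCore, hu, WithTop.coe_ne_top, if_false, WithTop.untopD_coe, sub_zero]
    exact (abs_le.1 (Complex.abs_re_le_norm z)).1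

theorem tendsto_scaledZeta_softCore (u : Sym2 α → WithTop ℂ) (A : ℝ) (e : Sym2 α) :
    Tendsto (fun k => scaledZeta (softCore u (A + k)) 1 e) atTop (𝓝 (expNeg (u e) - 1)) := by
  simp only [scaledZeta, softCore, Complex.ofReal_one, one_mul]
  refine Tendsto.sub_const ?_ 1
  cases u e with
  | top =>
    simp only [WithTop.untopD_top, expNeg_top, ← Complex.ofReal_neg, ← Complex.ofReal_exp]
    rw [← Complex.ofReal_zero]
    exact (Complex.continuous_ofReal.tendsto 0).comp
      (Real.tendsto_exp_neg_atTop_nhds_zero.comp (tendsto_atTop_add_const_left _ A tendsto_id))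
  | coe z => exact tendsto_const_nhds

theorem tendsto_softWeight_one (u : Sym2 α → WithTop ℂ) (A : ℝ) (e : Sym2 α) :
    Tendsto (fun k => softWeight u (A + k) k e 1) atTop (𝓝 ‖(u e).untopD 1‖) := by
  unfold softWeight
  cases u e with
  | top =>
    have hlim : Tendsto (fun k : ℝ => (A * k⁻¹ + 1) * (1 - Real.exp (-k))) atTop
        (𝓝 ((A * 0 + 1) * (1 - 0))) :=
      ((tendsto_inv_atTop_zero.const_mul A).add_const 1).mul
        (Real.tendsto_exp_neg_atTop_nhds_zero.const_sub 1)
    simp only [mul_zero, zero_add, sub_zero, mul_one] at hlim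
    simp only [if_true, WithTop.untopD_top, norm_one, mul_one]
    refine hlim.congr' ?_
    filter_upwards [eventually_ne_atTop 0] with k hk
    field_simp
  | coe z => simp

end SoftCore

section HardCoreLimit

open Filter Topology

variable {u : Sym2 ι → WithTop ℂ} {b : ι → ℝ} {A k : ℝ}

open Classical in
/-- A single hard-core pair contributes enough repulsion to compensate all the other pairs. -/
theorem sum_ite_le_sum_re_softCore_add (hb : ∀ i, 0 ≤ b i) {W : Finset ι}
    (hst : ∏ e ∈ edges W, ‖expNeg (u e)‖ ≤ ∏ i ∈ W, Real.exp (b i))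
    (hA : ∑ e ∈ edges W, ‖(u e).untopD 0‖ ≤ A) :
    ∑ e ∈ edges W, (if u e = ⊤ then k else 0) ≤
      ∑ e ∈ edges W, (softCore u (A + k) e).re + ∑ i ∈ W, b i := by
  rw [← sub_le_iff_le_add', ← neg_le_neg_iff, neg_sub, ← sum_sub_distrib]
  by_cases hex : ∃ e ∈ edges W, u e = ⊤
  · obtain ⟨e, heW, he⟩ := hex
    have hA0 : 0 ≤ A := (sum_nonneg fun _ _ => norm_nonneg _).trans hA
    calc -∑ i ∈ W, b i ≤ 0 := neg_nonpos.2 (sum_nonneg fun i _ => hb i)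
      _ ≤ A + ∑ f ∈ (edges W).erase e, -‖(u f).untopD 0‖ := by
          rw [sum_neg_distrib, ← sub_eq_add_neg, sub_nonneg]
          exact (sum_le_sum_of_subset_of_nonneg (erase_subset e _)
            fun _ _ _ => norm_nonneg _).trans hA
      _ ≤ A + ∑ f ∈ (edges W).erase e, ((softCore u (A + k) f).re - if u f = ⊤ then k else 0) :=
          add_le_add_right (sum_le_sum fun f _ => neg_norm_untopD_le_re_softCore_sub hA0 f) A
      _ = _ := by
          rw [← add_sum_erase _ _ heW]
          simp [softCore, he]
  · push Not at hex
    have hprod : ∏ e ∈ edges W, ‖expNeg (u e)‖ = Real.exp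
        (-∑ e ∈ edges W, ((softCore u (A + k) e).re - if u e = ⊤ then k else 0)) := by
      rw [← sum_neg_distrib, Real.exp_sum]
      refine prod_congr rfl fun e he => ?_
      obtain ⟨z, hz⟩ := WithTop.ne_top_iff_exists.1 (hex e he)
      simp [softCore, ← hz, norm_expNeg_coe]
    rw [hprod, ← Real.exp_sum, Real.exp_le_exp] at hst
    linarith

theorem norm_connSum_softCore_le [Fintype ι] (hb : ∀ i, 0 ≤ b i)
    (hst : ∀ V : Finset ι, ∏ e ∈ edges V, ‖expNeg (u e)‖ ≤ ∏ i ∈ V, Real.exp (b i))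
    (hA : ∑ e, ‖(u e).untopD 0‖ ≤ A) (hk : 0 < k) {V : Finset ι} (hV : V.Nonempty) :
    ‖connSum (scaledZeta (softCore u (A + k)) 1) V‖ ≤
      (∏ i ∈ V, Real.exp (b i)) * treeSum (fun e => softWeight u (A + k) k e 1) V := by
  classical
  have hA0 : 0 ≤ A := (sum_nonneg fun _ _ => norm_nonneg _).trans hA
  have hs : 0 ≤ A + k := add_nonneg hA0 hk.le
  rw [← Real.exp_sum, ← one_mul (∑ i ∈ V, b i)]
  refine norm_connSum_scaledZeta_le (κ := fun e => if u e = ⊤ then k else 0)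
    (fun e => by split_ifs <;> simp [hk.le]) (fun e => le_rfl)
    (fun e t ht => softWeight_nonneg hs hk ht e) (fun e t => hasDerivAt_softWeight hs hk.ne' e t) hb
    (fun W => sum_ite_le_sum_re_softCore_add hb (hst W) ?_) hV zero_le_one
  exact (sum_le_sum_of_subset_of_nonneg (subset_univ _) fun _ _ _ => norm_nonneg _).trans hA

theorem norm_connSum_le_treeSum_ubar [Finite ι] (hb : ∀ i, 0 ≤ b i)
    (hst : ∀ V : Finset ι, ∏ e ∈ edges V, ‖expNeg (u e)‖ ≤ ∏ i ∈ V, Real.exp (b i))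
    {V : Finset ι} (hV : V.Nonempty) :
    ‖connSum (fun e => expNeg (u e) - 1) V‖ ≤
      (∏ i ∈ V, Real.exp (b i)) * treeSum (fun e => ‖(u e).untopD 1‖) V := by
  have := Fintype.ofFinite ι
  set A : ℝ := ∑ e : Sym2 ι, ‖(u e).untopD 0‖
  have hconn : Tendsto (fun k => connSum (scaledZeta (softCore u (A + k)) 1) V) atTop
      (𝓝 (connSum (fun e => expNeg (u e) - 1) V)) :=
    tendsto_finsetSum _ fun E _ => tendsto_finsetProd _ fun e _ => tendsto_scaledZeta_softCore u A e
  have htree : Tendsto (fun k => treeSum (fun e => softWeight u (A + k) k e 1) V) atTop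
      (𝓝 (treeSum (fun e => ‖(u e).untopD 1‖) V)) :=
    tendsto_finsetSum _ fun E _ => tendsto_finsetProd _ fun e _ => tendsto_softWeight_one u A e
  refine le_of_tendsto_of_tendsto hconn.norm (htree.const_mul _) ?_
  filter_upwards [eventually_gt_atTop 0] with k hk
  exact norm_connSum_softCore_le hb hst le_rfl hk hV

end HardCoreLimit

section Relabeling

variable {κ : Type*} [DecidableEq κ]

theorem edges_map (f : κ ↪ ι) (V : Finset κ) : edges (V.map f) = (edges V).map f.sym2Map := by
  ext e
  induction e with | _ i j
  simp only [mk_mem_edges, mem_map, Function.Embedding.sym2Map_apply]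
  constructor
  · rintro ⟨⟨a, ha, rfl⟩, ⟨b, hb, rfl⟩, h⟩
    exact ⟨s(a, b), mk_mem_edges.2 ⟨ha, hb, fun h' => h (h' ▸ rfl)⟩, rfl⟩
  · rintro ⟨e, he, h⟩
    induction e with | _ a b
    rw [mk_mem_edges] at he
    rw [Sym2.map_mk, Sym2.eq_iff] at h
    rcases h with ⟨rfl, rfl⟩ | ⟨rfl, rfl⟩
    · exact ⟨⟨a, he.1, rfl⟩, ⟨b, he.2.1, rfl⟩, fun h => he.2.2 (f.injective h)⟩
    · exact ⟨⟨b, he.2.1, rfl⟩, ⟨a, he.1, rfl⟩, fun h => he.2.2 (f.injective h).symm⟩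

theorem fullProd_map {R : Type*} [CommSemiring R] (ζ : Sym2 ι → R) (f : κ ↪ ι) (V : Finset κ) :
    fullProd ζ (V.map f) = fullProd (fun e => ζ (e.map f)) V := by
  simp [fullProd, edges_map]

theorem connSum_map {R : Type*} [CommRing R] (ζ : Sym2 ι → R) (f : κ ↪ ι) {V : Finset κ}
    (hV : V.Nonempty) : connSum ζ (V.map f) = connSum (fun e => ζ (e.map f)) V := by
  obtain ⟨v, hv⟩ := hV
  obtain ⟨V, hvV, rfl⟩ : ∃ V', v ∉ V' ∧ insert v V' = V :=
    ⟨V.erase v, notMem_erase _ _, insert_erase hv⟩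
  refine eq_of_sum_powerset_mul_eq (F := fullProd fun e => ζ (e.map f))
    (f := fun S => connSum ζ ((insert v S).map f))
    (g := fun S => connSum (fun e => ζ (e.map f)) (insert v S)) (fullProd_empty _) V fun Q hQ => ?_
  have hvQ : v ∉ Q := fun h => hvV (hQ h)
  rw [← fullProd_insert_eq_sum_connSum _ hvQ, ← fullProd_map, map_insert,
    fullProd_insert_eq_sum_connSum _ (by simpa using hvQ)]
  refine sum_bij (fun S _ => S.map f) ?_ ?_ ?_ ?_
  · intro S hS
    simpa using hS
  · intro S _ T _ h
    simpa using h
  · intro T hT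
    obtain ⟨S, hS, rfl⟩ := subset_map_iff.1 (mem_powerset.1 hT)
    exact ⟨S, mem_powerset.2 hS, rfl⟩
  · intro S _
    rw [map_insert, ← fullProd_map, ← Finset.map_sdiff]

theorem TreeOn.map (f : κ ↪ ι) {V : Finset κ} {E : Finset (Sym2 κ)} (h : TreeOn V E) :
    TreeOn (V.map f) (E.map f.sym2Map) := by
  induction h with
  | single v => simpa using TreeOn.single (f v)
  | @join V₁ V₂ E₁ E₂ i j hd _ _ hi hj ih₁ ih₂ =>
    have hjoin := TreeOn.join ((disjoint_map f).2 hd) ih₁ ih₂ (mem_map_of_mem f hi)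
      (mem_map_of_mem f hj)
    rwa [← map_union, ← map_union, show s(f i, f j) = f.sym2Map s(i, j) from rfl,
      ← map_insert] at hjoin

theorem TreeOn.exists_eq_map (f : κ ↪ ι) {W : Finset ι} {E : Finset (Sym2 ι)} (h : TreeOn W E) :
    ∀ V : Finset κ, W = V.map f → ∃ E', TreeOn V E' ∧ E = E'.map f.sym2Map := by
  induction h with
  | single v =>
    intro V hV
    obtain ⟨a, -, rfl⟩ := mem_map.1 (hV ▸ mem_singleton_self v)
    rw [← map_singleton, map_inj] at hV
    subst hV
    exact ⟨∅, .single a, rfl⟩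
  | @join V₁ V₂ E₁ E₂ i j hd _ _ hi hj ih₁ ih₂ =>
    intro V hV
    obtain ⟨W₁, -, rfl⟩ := subset_map_iff.1 (hV ▸ subset_union_left : V₁ ⊆ V.map f)
    obtain ⟨W₂, -, rfl⟩ := subset_map_iff.1 (hV ▸ subset_union_right : V₂ ⊆ V.map f)
    obtain ⟨F₁, h₁, rfl⟩ := ih₁ W₁ rfl
    obtain ⟨F₂, h₂, rfl⟩ := ih₂ W₂ rfl
    obtain ⟨a, ha, rfl⟩ := mem_map.1 hi
    obtain ⟨b, hb, rfl⟩ := mem_map.1 hj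
    rw [← map_union, map_inj] at hV
    subst hV
    refine ⟨_, .join ((disjoint_map f).1 hd) h₁ h₂ ha hb, ?_⟩
    rw [map_insert, map_union]
    rfl

theorem treeSum_map {R : Type*} [CommSemiring R] (w : Sym2 ι → R) (f : κ ↪ ι) (V : Finset κ) :
    treeSum w (V.map f) = treeSum (fun e => w (e.map f)) V := by
  symm
  refine sum_bij (fun E _ => E.map f.sym2Map) ?_ ?_ ?_ ?_
  · intro E hE
    exact mem_trees.2 ((mem_trees.1 hE).map f)
  · intro E _ E' _ h
    simpa using h
  · intro E hE
    obtain ⟨E', h1, h2⟩ := (mem_trees.1 hE).exists_eq_map f V rfl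
    exact ⟨E', mem_trees.2 h1, h2.symm⟩
  · intro E _
    simp

end Relabeling

/-! ### The exponential formula -/

section ExponentialSeries

theorem sum_range_mul_mul_pow {R : Type*} [CommSemiring R] (f g : ℕ → R) (t : R) (n : ℕ) :
    (∑ k ∈ range (n + 1), f k * g (n - k)) * t ^ n =
      ∑ k ∈ range (n + 1), (f k * t ^ k) * (g (n - k) * t ^ (n - k)) := by
  rw [sum_mul]
  refine sum_congr rfl fun k hk => ?_
  rw [← pow_mul_pow_sub t (Nat.lt_succ_iff.1 (mem_range.1 hk))]
  ring

theorem sum_range_sum_range_mul_le {R : Type*} [CommSemiring R] [PartialOrder R]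
    [IsOrderedRing R] {f g : ℕ → R} (hf : ∀ n, 0 ≤ f n) (hg : ∀ n, 0 ≤ g n) (N : ℕ) :
    ∑ n ∈ range N, ∑ k ∈ range (n + 1), f k * g (n - k) ≤
      (∑ k ∈ range N, f k) * ∑ n ∈ range (N + 1), g n := by
  rw [sum_mul_sum, ← sum_product', sum_sigma']
  refine sum_le_sum_of_injOn (fun p : (_ : ℕ) × ℕ => (p.2, p.1 - p.2)) ?_ ?_
    (fun _ _ => le_rfl) fun p _ => mul_nonneg (hf _) (hg _)
  · rintro ⟨n, k⟩ hp
    simp only [mem_sigma, mem_range, mem_product] at hp ⊢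
    omega
  · rintro ⟨n, k⟩ hp ⟨n', k'⟩ hp' heq
    simp only [coe_sigma, Set.mem_sigma_iff, mem_coe, mem_range, Prod.mk.injEq] at hp hp' heq
    obtain rfl : k = k' := heq.1
    obtain rfl : n = n' := by omega
    rfl

theorem hasDerivAt_sum_range_mul_pow_succ (c : ℕ → ℝ) (N : ℕ) (t : ℝ) :
    HasDerivAt (fun t => ∑ k ∈ range N, c k * t ^ (k + 1))
      (∑ k ∈ range N, (k + 1) * c k * t ^ k) t := by
  refine (HasDerivAt.fun_sum fun k _ => (hasDerivAt_pow (k + 1) t).const_mul _).congr_deriv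
    (sum_congr rfl fun k _ => ?_)
  push_cast [Nat.add_sub_cancel]
  ring

theorem le_mul_exp_of_deriv_le_mul {P Q P' Q' : ℝ → ℝ} (hP : ∀ t, HasDerivAt P (P' t) t)
    (hQ : ∀ t, HasDerivAt Q (Q' t) t) (h : ∀ t ∈ Set.Ioo (0 : ℝ) 1, P' t ≤ Q' t * P t) :
    P 1 ≤ P 0 * Real.exp (Q 1 - Q 0) := by
  have hderiv (t : ℝ) : HasDerivAt (fun t => P t * Real.exp (-Q t))
      ((P' t - Q' t * P t) * Real.exp (-Q t)) t := by
    refine ((hP t).mul (hQ t).neg.exp).congr_deriv ?_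
    rw [Pi.neg_apply]
    ring
  have hanti : AntitoneOn (fun t => P t * Real.exp (-Q t)) (Set.Icc 0 1) := by
    refine antitoneOn_of_deriv_nonpos (convex_Icc 0 1)
      (fun t _ => (hderiv t).continuousAt.continuousWithinAt)
      (fun t _ => (hderiv t).differentiableAt.differentiableWithinAt) fun t ht => ?_
    rw [interior_Icc] at ht
    rw [(hderiv t).deriv]
    exact mul_nonpos_of_nonpos_of_nonneg (sub_nonpos.2 (h t ht)) (Real.exp_pos _).le
  have hle : P 1 * Real.exp (-Q 1) ≤ P 0 * Real.exp (-Q 0) :=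
    hanti (Set.left_mem_Icc.2 zero_le_one) (Set.right_mem_Icc.2 zero_le_one) zero_le_one
  calc P 1 = P 1 * Real.exp (-Q 1) * Real.exp (Q 1) := by
        rw [mul_assoc, ← Real.exp_add, neg_add_cancel, Real.exp_zero, mul_one]
    _ ≤ P 0 * Real.exp (-Q 0) * Real.exp (Q 1) := by gcongr
    _ = P 0 * Real.exp (Q 1 - Q 0) := by
        rw [mul_assoc, ← Real.exp_add, neg_add_eq_sub]

/-- The generating polynomials satisfy `P' ≤ Q' P`. -/
theorem sum_range_le_exp_sum_range {A B : ℕ → ℝ} (hA : ∀ n, 0 ≤ A n) (hB : ∀ n, 0 ≤ B n)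
    (hA0 : A 0 ≤ 1) (N : ℕ)
    (h : ∀ n < N, (n + 1) * A (n + 1) ≤ ∑ k ∈ range (n + 1), (k + 1) * B k * A (n - k)) :
    ∑ n ∈ range (N + 1), A n ≤ Real.exp (∑ k ∈ range N, B k) := by
  have hP (t : ℝ) : HasDerivAt (fun t => ∑ n ∈ range (N + 1), A n * t ^ n)
      (∑ n ∈ range N, (n + 1) * A (n + 1) * t ^ n) t := by
    simp only [sum_range_succ' (fun n => A n * _ ^ n), pow_zero]
    exact (hasDerivAt_sum_range_mul_pow_succ (fun n => A (n + 1)) N t).add_const _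
  have hexp := le_mul_exp_of_deriv_le_mul hP (hasDerivAt_sum_range_mul_pow_succ B N)
    fun t ht => ?_
  · simp only [one_pow, mul_one, ne_eq, Nat.add_eq_zero_iff, one_ne_zero, and_false,
      not_false_eq_true, zero_pow, mul_zero, sum_const_zero, sub_zero,
      sum_range_succ' (fun n => A n * 0 ^ n), pow_zero, zero_add] at hexp
    exact hexp.trans (mul_le_of_le_one_left (Real.exp_pos _).le hA0)
  · have ht0 : 0 ≤ t := ht.1.le
    calc ∑ n ∈ range N, (n + 1) * A (n + 1) * t ^ n
        ≤ ∑ n ∈ range N, ∑ k ∈ range (n + 1), ((k + 1) * B k * t ^ k) *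
          (A (n - k) * t ^ (n - k)) := by
          refine sum_le_sum fun n hn => ?_
          rw [← sum_range_mul_mul_pow (fun k => (k + 1) * B k) A]
          exact mul_le_mul_of_nonneg_right (h n (mem_range.1 hn)) (pow_nonneg ht0 n)
      _ ≤ (∑ k ∈ range N, (k + 1) * B k * t ^ k) * ∑ n ∈ range (N + 1), A n * t ^ n :=
          sum_range_sum_range_mul_le (f := fun k : ℕ => (k + 1) * B k * t ^ k)
            (fun k => mul_nonneg (mul_nonneg (by positivity) (hB k)) (pow_nonneg ht0 k))
            (fun n => mul_nonneg (hA n) (pow_nonneg ht0 n)) N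

theorem ne_top_of_succ_mul_le_sum {A B : ℕ → ℝ≥0∞} {N : ℕ} (hA0 : A 0 ≠ ∞)
    (hB : ∀ k < N, B k ≠ ∞)
    (h : ∀ n < N, ((n + 1 : ℕ) : ℝ≥0∞) * A (n + 1) ≤
      ∑ k ∈ range (n + 1), ((k + 1 : ℕ) : ℝ≥0∞) * B k * A (n - k)) :
    ∀ n ≤ N, A n ≠ ∞ := by
  intro n
  induction n using Nat.strong_induction_on with
  | _ n ih =>
    intro hn
    cases n with
    | zero => exact hA0
    | succ n =>
      have hmul : ((n + 1 : ℕ) : ℝ≥0∞) * A (n + 1) ≠ ∞ := by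
        refine ne_top_of_le_ne_top (ENNReal.sum_ne_top.2 fun k hk => ?_) (h n hn)
        have hk := mem_range.1 hk
        exact ENNReal.mul_ne_top (ENNReal.mul_ne_top (ENNReal.natCast_ne_top _)
          (hB k (by omega))) (ih (n - k) (by omega) (by omega))
      rintro htop
      rw [htop, ENNReal.mul_top (Nat.cast_ne_zero.2 n.succ_ne_zero)] at hmul
      exact hmul rfl

theorem sum_range_le_ofReal_exp {A B : ℕ → ℝ≥0∞} {β : ℝ} (hA0 : A 0 ≤ 1) (N : ℕ)
    (hB : ∑ k ∈ range N, B k ≤ ENNReal.ofReal β) (hβ : 0 ≤ β)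
    (h : ∀ n < N, ((n + 1 : ℕ) : ℝ≥0∞) * A (n + 1) ≤
      ∑ k ∈ range (n + 1), ((k + 1 : ℕ) : ℝ≥0∞) * B k * A (n - k)) :
    ∑ n ∈ range (N + 1), A n ≤ ENNReal.ofReal (Real.exp β) := by
  have hBtop (k) (hk : k < N) : B k ≠ ∞ := ne_top_of_le_ne_top ENNReal.ofReal_ne_top
    ((single_le_sum (fun _ _ => zero_le) (mem_range.2 hk)).trans hB)
  have hAtop := ne_top_of_succ_mul_le_sum (ne_top_of_le_ne_top ENNReal.one_ne_top hA0) hBtop h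
  have hreal (n) (hn : n < N) : (n + 1) * (A (n + 1)).toReal ≤
      ∑ k ∈ range (n + 1), (k + 1) * (B k).toReal * (A (n - k)).toReal := by
    have htop : ∀ k ∈ range (n + 1), ((k + 1 : ℕ) : ℝ≥0∞) * B k * A (n - k) ≠ ∞ := by
      intro k hk
      have hk := mem_range.1 hk
      exact ENNReal.mul_ne_top (ENNReal.mul_ne_top (ENNReal.natCast_ne_top _)
        (hBtop k (by omega))) (hAtop _ (by omega))
    have hle := ENNReal.toReal_mono (ENNReal.sum_ne_top.2 htop) (h n hn)
    rw [ENNReal.toReal_sum htop] at hle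
    simp only [ENNReal.toReal_mul, ENNReal.toReal_natCast] at hle
    exact_mod_cast hle
  have hAtop' : ∀ n ∈ range (N + 1), A n ≠ ∞ := fun n hn =>
    hAtop n (Nat.lt_succ_iff.1 (mem_range.1 hn))
  rw [ENNReal.le_ofReal_iff_toReal_le (ENNReal.sum_ne_top.2 hAtop') (Real.exp_pos _).le,
    ENNReal.toReal_sum hAtop']
  refine (sum_range_le_exp_sum_range (fun _ => ENNReal.toReal_nonneg)
    (fun _ => ENNReal.toReal_nonneg) (ENNReal.toReal_le_of_le_ofReal zero_le_one (by simpa)) N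
    hreal).trans (Real.exp_le_exp.2 ?_)
  rw [← ENNReal.toReal_sum fun k hk => hBtop k (mem_range.1 hk)]
  exact ENNReal.toReal_le_of_le_ofReal hβ hB

theorem norm_mul_ofReal_pow_le {t : ℝ} (ht : |t| ≤ 1) (z : ℂ) (n : ℕ) :
    ‖z * (t : ℂ) ^ n‖ ≤ ‖z‖ := by
  rw [norm_mul, norm_pow, Complex.norm_real]
  exact mul_le_of_le_one_right (norm_nonneg _) (pow_le_one₀ (norm_nonneg _) ht)

theorem norm_natCast_add_one_mul (n : ℕ) (z : ℂ) : ‖(n + 1 : ℂ) * z‖ = (n + 1 : ℝ) * ‖z‖ := by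
  rw [norm_mul, ← Nat.cast_succ, Complex.norm_natCast, Nat.cast_succ]

theorem hasDerivAt_tsum_mul_pow_succ {d : ℕ → ℂ} (hd : Summable fun k : ℕ => (k + 1 : ℝ) * ‖d k‖)
    {t : ℝ} (ht : t ∈ Metric.ball (0 : ℝ) 1) :
    HasDerivAt (fun t : ℝ => ∑' k, d k * (t : ℂ) ^ (k + 1))
      (∑' k : ℕ, (k + 1 : ℂ) * d k * (t : ℂ) ^ k) t := by
  refine hasDerivAt_tsum_of_isPreconnected hd Metric.isOpen_ball
    (convex_ball (0 : ℝ) 1).isPreconnected (g := fun k (t : ℝ) => d k * (t : ℂ) ^ (k + 1))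
    (g' := fun k (t : ℝ) => (k + 1 : ℂ) * d k * (t : ℂ) ^ k) (fun k s _ => ?_) (fun k s hs => ?_)
    (Metric.mem_ball_self one_pos) (by simp) ht
  · have hpow : HasDerivAt (fun s : ℝ => (s : ℂ) ^ (k + 1)) (((k + 1 : ℕ) : ℂ) * (s : ℂ) ^ k) s :=
      ((Complex.ofRealCLM.hasDerivAt (x := s)).pow (k + 1)).congr_deriv (by simp)
    refine (hpow.const_mul (d k)).congr_deriv ?_
    push_cast
    ring
  · exact (norm_mul_ofReal_pow_le (mem_ball_zero_iff.1 hs).le _ k).trans_eq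
      (norm_natCast_add_one_mul k (d k))

theorem continuousOn_tsum_mul_pow_succ {d : ℕ → ℂ} (hd : Summable fun k => ‖d k‖) :
    ContinuousOn (fun t : ℝ => ∑' k, d k * (t : ℂ) ^ (k + 1)) (Set.Icc 0 1) :=
  continuousOn_tsum (fun k => by fun_prop) hd fun k _ ht =>
    norm_mul_ofReal_pow_le ((abs_of_nonneg ht.1).trans_le ht.2) _ _

theorem summable_norm_of_summable_succ_mul_norm {d : ℕ → ℂ}
    (hd : Summable fun n : ℕ => (n + 1 : ℝ) * ‖d n‖) : Summable fun n => ‖d n‖ :=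
  hd.of_nonneg_of_le (fun _ => norm_nonneg _)
    fun n => le_mul_of_one_le_left (norm_nonneg _) (by simp)

theorem eq_mul_exp_of_deriv_eq_mul {P Q P' Q' : ℝ → ℂ} (hPc : ContinuousOn P (Set.Icc 0 1))
    (hQc : ContinuousOn Q (Set.Icc 0 1)) (hP : ∀ t ∈ Set.Ico (0 : ℝ) 1, HasDerivAt P (P' t) t)
    (hQ : ∀ t ∈ Set.Ico (0 : ℝ) 1, HasDerivAt Q (Q' t) t)
    (h : ∀ t ∈ Set.Ico (0 : ℝ) 1, P' t = Q' t * P t) :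
    P 1 = P 0 * Complex.exp (Q 1 - Q 0) := by
  have hconst : P 1 * Complex.exp (-Q 1) = P 0 * Complex.exp (-Q 0) := by
    refine constant_of_has_deriv_right_zero (f := fun t => P t * Complex.exp (-Q t))
      (hPc.mul hQc.neg.cexp) (fun t ht => ?_) 1 (Set.right_mem_Icc.2 zero_le_one)
    refine (((hP t ht).mul (hQ t ht).neg.cexp).congr_deriv ?_).hasDerivWithinAt
    rw [h t ht]
    ring
  rw [sub_eq_neg_add, Complex.exp_add, ← mul_assoc, ← hconst, mul_assoc, ← Complex.exp_add,
    neg_add_cancel, Complex.exp_zero, mul_one]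

theorem tsum_succ_mul_pow_eq_mul {p c : ℕ → ℂ} (hp : Summable fun n => ‖p n‖)
    (hc : Summable fun n : ℕ => (n + 1 : ℝ) * ‖c n‖)
    (h : ∀ n : ℕ, (n + 1 : ℂ) * p (n + 1) =
      ∑ k ∈ range (n + 1), (k + 1 : ℂ) * c k * p (n - k)) {t : ℝ} (ht : |t| ≤ 1) :
    ∑' k : ℕ, (k + 1 : ℂ) * p (k + 1) * (t : ℂ) ^ k =
      (∑' k : ℕ, (k + 1 : ℂ) * c k * (t : ℂ) ^ k) * ∑' n, p n * (t : ℂ) ^ n := by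
  rw [tsum_mul_tsum_eq_tsum_sum_range_of_summable_norm
    (hc.of_nonneg_of_le (fun _ => norm_nonneg _) fun k =>
      (norm_mul_ofReal_pow_le ht _ k).trans_eq (norm_natCast_add_one_mul k (c k)))
    (hp.of_nonneg_of_le (fun _ => norm_nonneg _) fun n => norm_mul_ofReal_pow_le ht _ n)]
  exact tsum_congr fun n => by rw [h n, sum_range_mul_mul_pow (fun k => (k + 1 : ℂ) * c k) p]

/-- The generating functions satisfy `P' = C' P` and `P(0) = 1`. -/
theorem tsum_eq_exp_tsum {p c : ℕ → ℂ} (hp : Summable fun n : ℕ => (n + 1 : ℝ) * ‖p (n + 1)‖)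
    (hc : Summable fun n : ℕ => (n + 1 : ℝ) * ‖c n‖) (hp0 : p 0 = 1)
    (h : ∀ n : ℕ, (n + 1 : ℂ) * p (n + 1) =
      ∑ k ∈ range (n + 1), (k + 1 : ℂ) * c k * p (n - k)) :
    ∑' n, p n = Complex.exp (∑' n, c n) := by
  have hp' : Summable fun n => ‖p n‖ :=
    (summable_nat_add_iff 1).1 (summable_norm_of_summable_succ_mul_norm hp)
  have hsplit (t : ℝ) (ht : |t| ≤ 1) :
      1 + ∑' k, p (k + 1) * (t : ℂ) ^ (k + 1) = ∑' n, p n * (t : ℂ) ^ n := by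
    have hsum : Summable fun n => p n * (t : ℂ) ^ n :=
      (hp'.of_nonneg_of_le (fun _ => norm_nonneg _) fun n => norm_mul_ofReal_pow_le ht _ n).of_norm
    simp [hsum.tsum_eq_zero_add, hp0]
  have hball (t : ℝ) (ht : t ∈ Set.Ico (0 : ℝ) 1) : t ∈ Metric.ball (0 : ℝ) 1 :=
    mem_ball_zero_iff.2 ((abs_of_nonneg ht.1).trans_lt ht.2)
  have hexp := eq_mul_exp_of_deriv_eq_mul
    (P := fun t : ℝ => 1 + ∑' k, p (k + 1) * (t : ℂ) ^ (k + 1))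
    (continuousOn_const.add
      (continuousOn_tsum_mul_pow_succ (summable_norm_of_summable_succ_mul_norm hp)))
    (continuousOn_tsum_mul_pow_succ (summable_norm_of_summable_succ_mul_norm hc))
    (fun t ht => (hasDerivAt_tsum_mul_pow_succ hp (hball t ht)).const_add 1)
    (fun t ht => hasDerivAt_tsum_mul_pow_succ hc (hball t ht)) fun t ht => by
      have ht' : |t| ≤ 1 := (mem_ball_zero_iff.1 (hball t ht)).le
      rw [tsum_succ_mul_pow_eq_mul hp' hc h ht', ← hsplit t ht']
  rw [hsplit 1 (by simp)] at hexp
  simpa using hexp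

end ExponentialSeries

/-! ### Cluster functions as sums over edge sets -/

section Graphs

variable {X : Type*}

@[simp]
theorem expNeg_zero : expNeg 0 = 1 := by
  rw [← WithTop.coe_zero, expNeg_coe, neg_zero, Complex.exp_zero]

theorem expNeg_add (a b : WithTop ℂ) : expNeg (a + b) = expNeg a * expNeg b := by
  induction a with
  | top => simp [expNeg_top]
  | coe a =>
    induction b with
    | top => simp [expNeg_top]
    | coe b => rw [← WithTop.coe_add, expNeg_coe, expNeg_coe, expNeg_coe, neg_add, Complex.exp_add]

theorem expNeg_sum {α : Type*} (s : Finset α) (f : α → WithTop ℂ) :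
    expNeg (∑ i ∈ s, f i) = ∏ i ∈ s, expNeg (f i) := by
  classical
  induction s using Finset.induction_on with
  | empty => simp
  | insert a s ha ih => rw [sum_insert ha, prod_insert ha, expNeg_add, ih]

theorem mem_pairs {n : ℕ} {p : Fin n × Fin n} : p ∈ pairs n ↔ p.1 < p.2 := by
  simp [pairs]

theorem prod_pairs_filter {R : Type*} [CommMonoid R] {n : ℕ} (f : Sym2 (Fin n) → R)
    {E : Finset (Sym2 (Fin n))} (hE : E ⊆ edges univ) :
    ∏ p ∈ (pairs n).filter fun p => s(p.1, p.2) ∈ E, f s(p.1, p.2) = ∏ e ∈ E, f e := by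
  refine prod_bij (fun p _ => s(p.1, p.2)) ?_ ?_ ?_ fun _ _ => rfl
  · intro p hp
    exact (mem_filter.1 hp).2
  · rintro ⟨i, j⟩ hp ⟨i', j'⟩ hp' h
    have h1 := mem_pairs.1 (mem_filter.1 hp).1
    have h2 := mem_pairs.1 (mem_filter.1 hp').1
    rcases Sym2.eq_iff.1 h with ⟨rfl, rfl⟩ | ⟨rfl, rfl⟩
    · rfl
    · exact absurd h1 (not_lt.2 (le_of_lt h2))
  · intro e he
    induction e with | _ i j
    have hij := (mk_mem_edges.1 (hE he)).2.2
    rcases lt_or_gt_of_ne hij with h | h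
    · exact ⟨(i, j), mem_filter.2 ⟨mem_pairs.2 h, he⟩, rfl⟩
    · exact ⟨(j, i), mem_filter.2 ⟨mem_pairs.2 h, by rwa [Sym2.eq_swap]⟩, Sym2.eq_swap⟩

theorem prod_pairs {R : Type*} [CommMonoid R] {n : ℕ} (f : Sym2 (Fin n) → R) :
    ∏ p ∈ pairs n, f s(p.1, p.2) = ∏ e ∈ edges univ, f e := by
  rw [← prod_pairs_filter f subset_rfl, filter_true_of_mem]
  intro p hp
  simpa using (mem_pairs.1 hp).ne

/-- The potential as a function on unordered pairs. -/
def symmPotential (u : X → X → WithTop ℂ) (hu : ∀ x y, u x y = u y x) : Sym2 X → WithTop ℂ :=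
  Sym2.lift ⟨u, hu⟩

variable {u : X → X → WithTop ℂ} (hu : ∀ x y, u x y = u y x)

/-- The function `ζ` on unordered pairs of labels of the points `x`. -/
def edgeZeta {ι : Type*} (x : ι → X) (e : Sym2 ι) : ℂ := expNeg (symmPotential u hu (e.map x)) - 1

@[simp]
theorem edgeZeta_mk {ι : Type*} (x : ι → X) (i j : ι) :
    edgeZeta hu x s(i, j) = zeta u (x i) (x j) := rfl

theorem boltzmann_eq_fullProd {n : ℕ} (x : Fin n → X) :
    boltzmann u x = fullProd (edgeZeta hu x) univ := by
  rw [boltzmann, expNeg_sum, fullProd, ← prod_pairs]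
  simp [zeta]

theorem connected_iff_connectedOn {V : Type*} [Fintype V] [Nonempty V] {G : SimpleGraph V}
    {E : Finset (Sym2 V)} (hE : ∀ i j, s(i, j) ∈ E ↔ G.Adj i j) :
    G.Connected ↔ ConnectedOn univ E := by
  constructor
  · intro h P hP i _ j _ hi
    obtain ⟨w⟩ := h.preconnected i j
    induction w with
    | nil => exact hi
    | cons hadj _ ih => exact ih (mem_univ _) (mem_univ _) (hP _ _ ((hE _ _).2 hadj) hi)
  · intro h
    refine ⟨fun i j => ?_⟩
    refine h {k | G.Reachable i k} ?_ i (mem_univ _) j (mem_univ _) (SimpleGraph.Reachable.refl i)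
    exact fun a b hab ha => SimpleGraph.Reachable.trans ha ((hE a b).1 hab).reachable

theorem edgeFinset_subset_edges_univ {V : Type*} [Fintype V] [DecidableEq V] (G : SimpleGraph V)
    [Fintype G.edgeSet] : G.edgeFinset ⊆ edges univ := by
  intro e he
  induction e with | _ i j
  exact mk_mem_edges.2 ⟨mem_univ i, mem_univ j, (SimpleGraph.mem_edgeFinset.1 he).ne⟩

open Classical in
theorem sum_connected_eq_sum_connectedOn {V R : Type*} [Fintype V] [DecidableEq V] [Nonempty V]
    [AddCommMonoid R] (f : Finset (Sym2 V) → R) :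
    ∑ G : SimpleGraph V with G.Connected, f G.edgeFinset =
      ∑ E ∈ (edges univ).powerset with ConnectedOn univ E, f E := by
  refine sum_bij (fun G _ => G.edgeFinset) (fun G hG => ?_) (fun G _ G' _ h => ?_)
    (fun E hE => ?_) fun _ _ => rfl
  · exact mem_filter.2 ⟨mem_powerset.2 (edgeFinset_subset_edges_univ G),
      (connected_iff_connectedOn fun i j => by simp).1 (mem_filter.1 hG).2⟩
  · exact SimpleGraph.edgeFinset_inj.1 h
  · obtain ⟨hsub, hconn⟩ := mem_filter.1 hE
    obtain ⟨G, hadj⟩ : ∃ G : SimpleGraph V, ∀ i j, s(i, j) ∈ E ↔ G.Adj i j := by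
      refine ⟨.fromEdgeSet E, fun i j => ?_⟩
      rw [SimpleGraph.fromEdgeSet_adj, mem_coe]
      exact ⟨fun h => ⟨h, (mk_mem_edges.1 (mem_powerset.1 hsub h)).2.2⟩, fun h => h.1⟩
    refine ⟨G, mem_filter.2 ⟨mem_univ _, (connected_iff_connectedOn hadj).2 hconn⟩, ?_⟩
    ext e
    induction e with | _ i j
    rw [hadj, SimpleGraph.mem_edgeFinset, SimpleGraph.mem_edgeSet]

theorem phi_eq_connSum {n : ℕ} (x : Fin (n + 1) → X) :
    phi u x = (((n + 1)! : ℕ) : ℂ)⁻¹ * connSum (edgeZeta hu x) univ := by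
  classical
  have hprod (G : SimpleGraph (Fin (n + 1))) :
      ∏ p ∈ pairs (n + 1) with G.Adj p.1 p.2, zeta u (x p.1) (x p.2) =
        ∏ e ∈ G.edgeFinset, edgeZeta hu x e := by
    simp [← prod_pairs_filter (edgeZeta hu x) (edgeFinset_subset_edges_univ G)]
  rw [phi, connSum, ← sum_connected_eq_sum_connectedOn fun E => ∏ e ∈ E, edgeZeta hu x e]
  simp only [hprod]

theorem ofReal_norm_phi {n : ℕ} (x : Fin (n + 1) → X) :
    ENNReal.ofReal ‖phi u x‖ =
      (((n + 1)! : ℕ) : ℝ≥0∞)⁻¹ * ENNReal.ofReal ‖connSum (edgeZeta hu x) univ‖ := by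
  rw [phi_eq_connSum hu, norm_mul, norm_inv, Complex.norm_natCast,
    ENNReal.ofReal_mul (by positivity), ENNReal.ofReal_inv_of_pos (by positivity),
    ENNReal.ofReal_natCast]

end Graphs

/-! ### Integrals of tree sums -/

section ProductMeasure

variable {X : Type*} [MeasurableSpace X] (ν : Measure X) [SigmaFinite ν]

theorem measurePreserving_comp_equiv {ι κ : Type*} [Fintype ι] [Fintype κ] (e : κ ≃ ι) :
    MeasurePreserving (fun x : ι → X => x ∘ e) (Measure.pi fun _ => ν)
      (Measure.pi fun _ => ν) := by
  convert measurePreserving_piCongrLeft (fun _ : κ => ν) e.symm using 1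
  ext x k
  have happly := Equiv.piCongrLeft_apply_apply (fun _ : κ => X) e.symm x (e k)
  rw [Equiv.symm_apply_apply] at happly
  rw [MeasurableEquiv.coe_piCongrLeft, happly]
  rfl

theorem measurePreserving_split {ι κ σ : Type*} [Fintype ι] [Fintype κ] [Fintype σ]
    (e : κ ⊕ σ ≃ ι) :
    MeasurePreserving (fun x : ι → X => (fun i => x (e (Sum.inl i)), fun i => x (e (Sum.inr i))))
      (Measure.pi fun _ => ν) ((Measure.pi fun _ => ν).prod (Measure.pi fun _ => ν)) :=
  (measurePreserving_sumPiEquivProdPi (fun _ : κ ⊕ σ => ν)).comp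
    (measurePreserving_comp_equiv ν e)

end ProductMeasure

section SubsetsContainingZero

theorem map_finSumEquivOfFinset_inl {N k m : ℕ} {T : Finset (Fin N)} (hk : #T = k)
    (hm : #Tᶜ = m) :
    (univ : Finset (Fin k)).map (Function.Embedding.inl.trans
      (finSumEquivOfFinset hk hm).toEmbedding) = T := by
  conv_rhs => rw [← map_orderEmbOfFin_univ T hk]
  congr 1

theorem map_finSumEquivOfFinset_inr {N k m : ℕ} {T : Finset (Fin N)} (hk : #T = k)
    (hm : #Tᶜ = m) :
    (univ : Finset (Fin m)).map (Function.Embedding.inr.trans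
      (finSumEquivOfFinset hk hm).toEmbedding) = Tᶜ := by
  conv_rhs => rw [← map_orderEmbOfFin_univ Tᶜ hm]
  congr 1

theorem sum_powerset_erase_zero {R : Type*} [CommSemiring R] {n : ℕ} (f : Finset (Fin (n + 1)) → R)
    (g : ℕ → R) (h : ∀ S ⊆ univ.erase 0, f S = g #S) :
    ∑ S ∈ (univ.erase (0 : Fin (n + 1))).powerset, f S =
      ∑ k ∈ range (n + 1), (n.choose k : R) * g k := by
  rw [sum_congr rfl fun S hS => h S (mem_powerset.1 hS), sum_powerset_apply_card]
  simp

theorem card_insert_zero {n : ℕ} {S : Finset (Fin (n + 1))} (hS : S ⊆ univ.erase 0) :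
    #(insert 0 S) = #S + 1 :=
  card_insert_of_notMem fun h => notMem_erase _ _ (hS h)

theorem card_compl_insert_zero {n : ℕ} {S : Finset (Fin (n + 1))} (hS : S ⊆ univ.erase 0) :
    #(insert 0 S)ᶜ = n - #S := by
  rw [card_compl, card_insert_zero hS, Fintype.card_fin, Nat.add_sub_add_right]

theorem compl_insert_zero {n : ℕ} (S : Finset (Fin (n + 1))) :
    (insert 0 S)ᶜ = univ.erase 0 \ S := by
  ext i
  simp

end SubsetsContainingZero

section AddPoint

variable {X α κ R : Type*} [CommSemiring R]

/-- The configuration `y` with the additional point `x`, which carries the label `none`. -/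
def addPoint (x : X) (y : α → X) (o : Option α) : X := o.elim x y

theorem addPoint_comp_optionMap (x : X) (y : α → X) (f : κ ↪ α) :
    addPoint x y ∘ f.optionMap = addPoint x (y ∘ f) := by
  ext o
  cases o <;> rfl

theorem treeSum_map_comp [DecidableEq α] [DecidableEq κ] (K : Sym2 X → R) (x : α → X) (f : κ ↪ α)
    (V : Finset κ) :
    treeSum (fun e => K (e.map x)) (V.map f) = treeSum (fun e => K (e.map (x ∘ f))) V := by
  simp only [treeSum_map, Sym2.map_map]

theorem treeSum_insertNth (K : Sym2 X → R) {n : ℕ} (j : Fin (n + 1)) (z : X) (y : Fin n → X) :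
    treeSum (fun e => K (e.map (j.insertNth z y : Fin (n + 1) → X))) univ =
      treeSum (fun e => K (e.map (addPoint z y))) univ := by
  have huniv : (univ : Finset (Fin (n + 1))) = univ.map (finSuccEquiv' j).symm.toEmbedding := by
    simp
  have hcomp : (j.insertNth z y : Fin (n + 1) → X) ∘ (finSuccEquiv' j).symm.toEmbedding =
      addPoint z y := by
    ext o
    cases o <;> simp [addPoint]
  rw [huniv, treeSum_map_comp, hcomp]

theorem treeSum_addPoint_map [DecidableEq α] [Fintype κ] [DecidableEq κ] (K : Sym2 X → R) (x : X)
    (y : α → X) (f : κ ↪ α) :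
    treeSum (fun e => K (e.map (addPoint x y)))
        (insert none ((univ.map f).map Function.Embedding.some)) =
      treeSum (fun e => K (e.map (addPoint x (y ∘ f)))) univ := by
  have hmap : insert none ((univ.map f).map Function.Embedding.some) =
      (univ : Finset (Option κ)).map f.optionMap := by
    ext o
    cases o <;> simp
  rw [hmap, treeSum_map_comp, addPoint_comp_optionMap]

/-- The total weight of the trees on a root at `x` and on the points `y` in which the branch at the
root that contains the point `0` has the set of labels `insert 0 S`. -/
def branchWeight {n : ℕ} (K : Sym2 X → R) (x : X) (y : Fin (n + 1) → X)
    (S : Finset (Fin (n + 1))) : R :=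
  (∑ j ∈ insert 0 S, K s(x, y j)) * treeSum (fun e => K (e.map y)) (insert 0 S) *
    treeSum (fun e => K (e.map (addPoint x y)))
      (insert none ((insert 0 S)ᶜ.map Function.Embedding.some))

theorem treeSum_addPoint_le {n : ℕ} (K : Sym2 X → ℝ≥0∞) (x : X) (y : Fin (n + 1) → X) :
    treeSum (fun e => K (e.map (addPoint x y))) univ ≤
      ∑ S ∈ (univ.erase 0).powerset, branchWeight K x y S := by
  have huniv : (univ : Finset (Option (Fin (n + 1)))) =
      insert none (insert (some 0) ((univ.erase 0).map Function.Embedding.some)) := by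
    ext o
    cases o <;> simp
  rw [huniv]
  refine (treeSum_insert_insert_le (fun _ => zero_le) (by simp) (by simp)).trans_eq (Eq.symm ?_)
  refine sum_bij (fun S _ => S.map Function.Embedding.some) ?_ ?_ ?_ ?_
  · exact fun S hS => mem_powerset.2 (map_subset_map.2 (mem_powerset.1 hS))
  · exact fun S _ T _ h => map_injective _ h
  · intro T hT
    obtain ⟨S, hS, rfl⟩ := subset_map_iff.1 (mem_powerset.1 hT)
    exact ⟨S, mem_powerset.2 hS, rfl⟩
  · intro S _
    have hinsert : insert (some 0) (S.map Function.Embedding.some) =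
        (insert 0 S).map Function.Embedding.some := by simp
    rw [hinsert, sum_map, treeSum_map_comp, branchWeight, compl_insert_zero, Finset.map_sdiff]
    rfl

end AddPoint

section TreeIntegral

variable {X : Type*} [MeasurableSpace X] {ν : Measure X} {K : Sym2 X → ℝ≥0∞} {c : X → ℝ≥0∞}

theorem measurable_addPoint {α : Type*} :
    Measurable fun p : X × (α → X) => addPoint p.1 p.2 := by
  refine measurable_pi_iff.2 fun o => ?_
  cases o with
  | none => exact measurable_fst
  | some i => exact (measurable_pi_apply i).comp measurable_snd

theorem measurable_treeSum {ι : Type*} [DecidableEq ι]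
    (hK : Measurable fun p : X × X => K s(p.1, p.2)) (V : Finset ι) :
    Measurable fun x : ι → X => treeSum (fun e => K (e.map x)) V := by
  refine Finset.measurable_sum _ fun E _ => Finset.measurable_prod _ fun e _ => ?_
  induction e with | _ i j
  exact hK.comp (f := fun x : ι → X => (x i, x j))
    ((measurable_pi_apply i).prodMk (measurable_pi_apply j))

theorem measurable_prod_comp {ι : Type*} [Fintype ι] (hc : Measurable c) :
    Measurable fun x : ι → X => ∏ i, c (x i) :=
  Finset.measurable_prod _ fun i _ => hc.comp (measurable_pi_apply i)

/-- The integral of the tree sums, over the positions of all the points but the root `x`. -/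
def treeIntegral (ν : Measure X) (K : Sym2 X → ℝ≥0∞) (c : X → ℝ≥0∞) (n : ℕ) (x : X) : ℝ≥0∞ :=
  ∫⁻ y : Fin n → X, treeSum (fun e => K (e.map (addPoint x y))) univ * ∏ i, c (y i)
    ∂Measure.pi fun _ => ν

theorem treeIntegral_zero (x : X) : treeIntegral ν K c 0 x = 1 := by
  simp [treeIntegral]

theorem measurable_kernel_left (hK : Measurable fun p : X × X => K s(p.1, p.2)) (x : X) :
    Measurable fun z => K s(x, z) :=
  hK.comp measurable_prodMk_left

theorem measurable_treeIntegrand (hK : Measurable fun p : X × X => K s(p.1, p.2))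
    (hc : Measurable c) (n : ℕ) :
    Measurable fun p : X × (Fin n → X) =>
      treeSum (fun e => K (e.map (addPoint p.1 p.2))) univ * ∏ i, c (p.2 i) :=
  ((measurable_treeSum hK _).comp measurable_addPoint).mul
    ((measurable_prod_comp hc).comp measurable_snd)

theorem measurable_treeIntegrand_right (hK : Measurable fun p : X × X => K s(p.1, p.2))
    (hc : Measurable c) (n : ℕ) (x : X) :
    Measurable fun y : Fin n → X =>
      treeSum (fun e => K (e.map (addPoint x y))) univ * ∏ i, c (y i) :=
  ((measurable_treeSum hK _).comp (measurable_addPoint.comp measurable_prodMk_left)).mul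
    (measurable_prod_comp hc)

theorem measurable_sum_kernel_mul_treeSum {ι : Type*} [DecidableEq ι]
    (hK : Measurable fun p : X × X => K s(p.1, p.2)) (x : X) (V : Finset ι) :
    Measurable fun y : ι → X => (∑ j ∈ V, K s(x, y j)) * treeSum (fun e => K (e.map y)) V :=
  (Finset.measurable_sum _ fun j _ => (measurable_kernel_left hK x).comp
    (measurable_pi_apply j)).mul (measurable_treeSum hK _)

theorem measurable_branchWeight {n : ℕ} (hK : Measurable fun p : X × X => K s(p.1, p.2)) (x : X)
    (S : Finset (Fin (n + 1))) : Measurable fun y => branchWeight K x y S :=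
  (measurable_sum_kernel_mul_treeSum hK x _).mul
    ((measurable_treeSum hK _).comp (measurable_addPoint.comp measurable_prodMk_left))

variable [SigmaFinite ν]

theorem measurable_treeIntegral (hK : Measurable fun p : X × X => K s(p.1, p.2))
    (hc : Measurable c) (n : ℕ) : Measurable (treeIntegral ν K c n) :=
  (measurable_treeIntegrand hK hc n).lintegral_prod_right'

theorem lintegral_kernel_mul_treeSum (hK : Measurable fun p : X × X => K s(p.1, p.2))
    (hc : Measurable c) {n : ℕ} (x : X) (j : Fin (n + 1)) :
    ∫⁻ y : Fin (n + 1) → X, K s(x, y j) * treeSum (fun e => K (e.map y)) univ * ∏ i, c (y i)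
        ∂Measure.pi (fun _ => ν) =
      ∫⁻ z, K s(x, z) * c z * treeIntegral ν K c n z ∂ν := by
  have hinsert (p : X × (Fin n → X)) :
      (MeasurableEquiv.piFinSuccAbove (fun _ => X) j).symm p = j.insertNth p.1 p.2 := rfl
  have hmeas : Measurable fun p : X × (Fin n → X) => K s(x, p.1) * c p.1 *
      (treeSum (fun e => K (e.map (addPoint p.1 p.2))) univ * ∏ i, c (p.2 i)) :=
    (((measurable_kernel_left hK x).mul hc).comp measurable_fst).mul
      (measurable_treeIntegrand hK hc n)
  rw [← (measurePreserving_piFinSuccAbove (fun _ : Fin (n + 1) => ν) j).symm.lintegral_comp_emb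
    (MeasurableEquiv.measurableEmbedding _)]
  simp only [hinsert, Fin.insertNth_apply_same, treeSum_insertNth, Fin.prod_univ_succAbove _ j,
    Fin.insertNth_apply_succAbove, mul_mul_mul_comm (K _) _ (c _)]
  rw [lintegral_prod _ hmeas.aemeasurable]
  refine lintegral_congr fun z => ?_
  dsimp only
  rw [lintegral_const_mul _ (measurable_treeIntegrand_right hK hc n z), treeIntegral]

theorem lintegral_sum_kernel_mul_treeSum (hK : Measurable fun p : X × X => K s(p.1, p.2))
    (hc : Measurable c) (n : ℕ) (x : X) :
    ∫⁻ y : Fin (n + 1) → X, (∑ j, K s(x, y j)) * treeSum (fun e => K (e.map y)) univ *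
        ∏ i, c (y i) ∂Measure.pi (fun _ => ν) =
      ((n + 1 : ℕ) : ℝ≥0∞) * ∫⁻ z, K s(x, z) * c z * treeIntegral ν K c n z ∂ν := by
  simp only [sum_mul]
  rw [lintegral_finsetSum]
  · simp [lintegral_kernel_mul_treeSum hK hc]
  · exact fun j _ => (((measurable_kernel_left hK x).comp (measurable_pi_apply j)).mul
      (measurable_treeSum hK _)).mul (measurable_prod_comp hc)

theorem lintegral_branchWeight_mul_prod (hK : Measurable fun p : X × X => K s(p.1, p.2))
    (hc : Measurable c) {n : ℕ} (x : X) {S : Finset (Fin (n + 1))} (hS : S ⊆ univ.erase 0) :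
    ∫⁻ y : Fin (n + 1) → X, branchWeight K x y S * ∏ i, c (y i) ∂Measure.pi (fun _ => ν) =
      ((#S + 1 : ℕ) : ℝ≥0∞) * (∫⁻ z, K s(x, z) * c z * treeIntegral ν K c #S z ∂ν) *
        treeIntegral ν K c (n - #S) x := by
  have hk := card_insert_zero hS
  have hm := card_compl_insert_zero hS
  set e := finSumEquivOfFinset hk hm
  set f := Function.Embedding.inl.trans e.toEmbedding with hf
  set g := Function.Embedding.inr.trans e.toEmbedding with hg
  have hbranch : Measurable fun y : Fin (#S + 1) → X =>
      (∑ j, K s(x, y j)) * treeSum (fun e => K (e.map y)) univ * ∏ i, c (y i) :=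
    (measurable_sum_kernel_mul_treeSum hK x univ).mul (measurable_prod_comp hc)
  have hrest := measurable_treeIntegrand_right hK hc (n - #S) x
  rw [← lintegral_sum_kernel_mul_treeSum hK hc, treeIntegral,
    ← lintegral_prod_mul hbranch.aemeasurable hrest.aemeasurable,
    ← (measurePreserving_split ν e).lintegral_comp
      (by exact (hbranch.comp measurable_fst).mul (hrest.comp measurable_snd))]
  refine lintegral_congr fun y => ?_
  have hprod : ∏ i, c (y i) = (∏ i, c (y (f i))) * ∏ i, c (y (g i)) := by
    rw [← Equiv.prod_comp e, Fintype.prod_sum_type]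
    rfl
  have hweight : branchWeight K x y S = (∑ i, K s(x, y (f i))) *
      treeSum (fun e => K (e.map (y ∘ f))) univ *
      treeSum (fun e => K (e.map (addPoint x (y ∘ g)))) univ := by
    rw [branchWeight, ← map_finSumEquivOfFinset_inr hk hm, ← hg, treeSum_addPoint_map,
      ← map_finSumEquivOfFinset_inl hk hm, ← hf, sum_map, treeSum_map_comp]
  rw [hprod, hweight]
  exact mul_mul_mul_comm _ _ _ _

theorem treeIntegral_succ_le (hK : Measurable fun p : X × X => K s(p.1, p.2))
    (hc : Measurable c) (n : ℕ) (x : X) :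
    treeIntegral ν K c (n + 1) x ≤ ∑ k ∈ range (n + 1), (n.choose k : ℝ≥0∞) *
      (((k + 1 : ℕ) : ℝ≥0∞) * (∫⁻ z, K s(x, z) * c z * treeIntegral ν K c k z ∂ν) *
        treeIntegral ν K c (n - k) x) := by
  calc treeIntegral ν K c (n + 1) x
      ≤ ∫⁻ y : Fin (n + 1) → X, ∑ S ∈ (univ.erase 0).powerset,
          branchWeight K x y S * ∏ i, c (y i) ∂Measure.pi fun _ => ν := by
        refine lintegral_mono fun y => ?_
        rw [← sum_mul]
        exact mul_le_mul_left (treeSum_addPoint_le K x y) _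
    _ = ∑ S ∈ (univ.erase 0).powerset, ∫⁻ y : Fin (n + 1) → X,
          branchWeight K x y S * ∏ i, c (y i) ∂Measure.pi fun _ => ν :=
        lintegral_finsetSum _ fun S _ =>
          (measurable_branchWeight hK x S).mul (measurable_prod_comp hc)
    _ = _ := sum_powerset_erase_zero _ (fun k => ((k + 1 : ℕ) : ℝ≥0∞) *
          (∫⁻ z, K s(x, z) * c z * treeIntegral ν K c k z ∂ν) * treeIntegral ν K c (n - k) x)
          fun S hS => lintegral_branchWeight_mul_prod hK hc x hS

theorem succ_mul_inv_factorial_succ (n : ℕ) :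
    ((n + 1 : ℕ) : ℝ≥0∞) * (((n + 1)! : ℕ) : ℝ≥0∞)⁻¹ = ((n ! : ℕ) : ℝ≥0∞)⁻¹ := by
  rw [Nat.factorial_succ, Nat.cast_mul, ENNReal.mul_inv (.inr (ENNReal.natCast_ne_top _))
    (.inl (ENNReal.natCast_ne_top _)), ← mul_assoc, ENNReal.mul_inv_cancel
    (Nat.cast_ne_zero.2 n.succ_ne_zero) (ENNReal.natCast_ne_top _), one_mul]

theorem ennreal_inv_factorial_mul_choose {n k : ℕ} (hkn : k ≤ n) :
    ((n ! : ℕ) : ℝ≥0∞)⁻¹ * (n.choose k : ℝ≥0∞) =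
      ((k ! : ℕ) : ℝ≥0∞)⁻¹ * (((n - k)! : ℕ) : ℝ≥0∞)⁻¹ := by
  have hchoose : (n.choose k * (k ! * (n - k)!) : ℝ≥0∞) = n ! := by
    rw [← mul_assoc]
    exact_mod_cast Nat.choose_mul_factorial_mul_factorial hkn
  rw [← ENNReal.mul_inv (.inr (ENNReal.natCast_ne_top _)) (.inl (ENNReal.natCast_ne_top _))]
  refine ENNReal.eq_inv_of_mul_eq_one_left ?_
  rw [mul_assoc, hchoose, ENNReal.inv_mul_cancel (Nat.cast_ne_zero.2 n.factorial_ne_zero)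
    (ENNReal.natCast_ne_top _)]

theorem succ_mul_treeIntegral_succ_le (hK : Measurable fun p : X × X => K s(p.1, p.2))
    (hc : Measurable c) (n : ℕ) (x : X) :
    ((n + 1 : ℕ) : ℝ≥0∞) * ((((n + 1)! : ℕ) : ℝ≥0∞)⁻¹ * treeIntegral ν K c (n + 1) x) ≤
      ∑ k ∈ range (n + 1), ((k + 1 : ℕ) : ℝ≥0∞) *
        (∫⁻ z, K s(x, z) * c z * (((k ! : ℕ) : ℝ≥0∞)⁻¹ * treeIntegral ν K c k z) ∂ν) *
        ((((n - k)! : ℕ) : ℝ≥0∞)⁻¹ * treeIntegral ν K c (n - k) x) := by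
  rw [← mul_assoc, succ_mul_inv_factorial_succ]
  refine (mul_le_mul_right (treeIntegral_succ_le hK hc n x) _).trans_eq ?_
  rw [mul_sum]
  refine sum_congr rfl fun k hk => ?_
  have hkn : k ≤ n := Nat.lt_succ_iff.1 (mem_range.1 hk)
  have hmeas : Measurable fun z => K s(x, z) * c z * treeIntegral ν K c k z :=
    ((measurable_kernel_left hK x).mul hc).mul (measurable_treeIntegral hK hc k)
  simp only [mul_left_comm _ ((k ! : ℕ) : ℝ≥0∞)⁻¹]
  rw [lintegral_const_mul _ hmeas, ← mul_assoc, ennreal_inv_factorial_mul_choose hkn]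
  ring

theorem sum_treeIntegral_le (hK : Measurable fun p : X × X => K s(p.1, p.2))
    (hc : Measurable c) {a : X → ℝ} (ha : ∀ x, 0 ≤ a x)
    (hcrit : ∀ᵐ x ∂ν, ∫⁻ z, K s(x, z) * c z * ENNReal.ofReal (Real.exp (a z)) ∂ν ≤
      ENNReal.ofReal (a x)) (N : ℕ) :
    ∀ᵐ x ∂ν, ∑ n ∈ range (N + 1), ((n ! : ℕ) : ℝ≥0∞)⁻¹ * treeIntegral ν K c n x ≤
      ENNReal.ofReal (Real.exp (a x)) := by
  induction N with
  | zero =>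
    refine .of_forall fun x => ?_
    simpa [treeIntegral_zero] using ha x
  | succ N ih =>
    filter_upwards [hcrit] with x hx
    refine sum_range_le_ofReal_exp (by simp [treeIntegral_zero]) (N + 1)
      (B := fun k => ∫⁻ z, K s(x, z) * c z *
        (((k ! : ℕ) : ℝ≥0∞)⁻¹ * treeIntegral ν K c k z) ∂ν) ?_ (ha x)
      fun n _ => succ_mul_treeIntegral_succ_le hK hc n x
    refine le_trans ?_ hx
    have hmeas (k : ℕ) : Measurable fun z => K s(x, z) * c z *
        (((k ! : ℕ) : ℝ≥0∞)⁻¹ * treeIntegral ν K c k z) :=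
      ((measurable_kernel_left hK x).mul hc).mul ((measurable_treeIntegral hK hc k).const_mul _)
    rw [← lintegral_finsetSum _ fun k _ => hmeas k]
    refine lintegral_mono_ae ?_
    filter_upwards [ih] with z hz
    rw [← mul_sum]
    gcongr

theorem tsum_treeIntegral_le (hK : Measurable fun p : X × X => K s(p.1, p.2))
    (hc : Measurable c) {a : X → ℝ} (ha : ∀ x, 0 ≤ a x)
    (hcrit : ∀ᵐ x ∂ν, ∫⁻ z, K s(x, z) * c z * ENNReal.ofReal (Real.exp (a z)) ∂ν ≤
      ENNReal.ofReal (a x)) :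
    ∀ᵐ x ∂ν, ∑' n : ℕ, (((n + 1)! : ℕ) : ℝ≥0∞)⁻¹ * treeIntegral ν K c (n + 1) x ≤
      ENNReal.ofReal (Real.exp (a x) - 1) := by
  filter_upwards [ae_all_iff.2 (sum_treeIntegral_le hK hc ha hcrit)] with x hx
  rw [ENNReal.tsum_eq_iSup_nat, ENNReal.ofReal_sub _ zero_le_one, ENNReal.ofReal_one]
  refine iSup_le fun N => ENNReal.le_sub_of_add_le_right ENNReal.one_ne_top ?_
  have hN := hx N
  rw [sum_range_succ'] at hN
  simpa [treeIntegral_zero] using hN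

end TreeIntegral

/-! ### Integration against a complex measure -/

section Cons

variable {X : Type*} [MeasurableSpace X]

theorem coe_piFinSuccAbove_symm_zero (n : ℕ) :
    ⇑(MeasurableEquiv.piFinSuccAbove (fun _ : Fin (n + 1) => X) 0).symm =
      fun p : X × (Fin n → X) => (Fin.cons p.1 p.2 : Fin (n + 1) → X) := by
  ext p i
  change (Fin.insertNth 0 p.1 p.2 : Fin (n + 1) → X) i = _
  rw [Fin.insertNth_zero']

theorem measurableEmbedding_cons (n : ℕ) :
    MeasurableEmbedding fun p : X × (Fin n → X) => (Fin.cons p.1 p.2 : Fin (n + 1) → X) := by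
  rw [← coe_piFinSuccAbove_symm_zero]
  exact MeasurableEquiv.measurableEmbedding _

theorem measurePreserving_cons (ν : Measure X) [SigmaFinite ν] (n : ℕ) :
    MeasurePreserving (fun p : X × (Fin n → X) => (Fin.cons p.1 p.2 : Fin (n + 1) → X))
      (ν.prod (Measure.pi fun _ => ν)) (Measure.pi fun _ => ν) := by
  rw [← coe_piFinSuccAbove_symm_zero]
  exact (measurePreserving_piFinSuccAbove (fun _ : Fin (n + 1) => ν) 0).symm

variable {ν : Measure X} [SigmaFinite ν]

theorem lintegral_pi_succ {n : ℕ} {f : (Fin (n + 1) → X) → ℝ≥0∞} (hf : Measurable f) :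
    ∫⁻ x, f x ∂Measure.pi (fun _ => ν) =
      ∫⁻ x, ∫⁻ y : Fin n → X, f (Fin.cons x y) ∂Measure.pi (fun _ => ν) ∂ν := by
  rw [← (measurePreserving_cons ν n).lintegral_comp hf]
  exact lintegral_prod _ (hf.comp (measurableEmbedding_cons n).measurable).aemeasurable

theorem lintegral_pi_prod {c : X → ℝ≥0∞} (hc : Measurable c) (n : ℕ) :
    ∫⁻ x : Fin n → X, ∏ i, c (x i) ∂Measure.pi (fun _ => ν) = (∫⁻ x, c x ∂ν) ^ n := by
  induction n with
  | zero => simp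
  | succ n ih =>
    rw [lintegral_pi_succ (measurable_prod_comp hc), pow_succ', ← ih, ← lintegral_mul_const _ hc]
    refine lintegral_congr fun x => ?_
    simp only [Fin.prod_univ_succ, Fin.cons_zero, Fin.cons_succ]
    exact lintegral_const_mul _ (measurable_prod_comp hc)

theorem integrable_comp_cons {n : ℕ} {f : (Fin (n + 1) → X) → ℂ}
    (hf : Integrable f (Measure.pi fun _ => ν)) :
    Integrable (fun p : X × (Fin n → X) => f (Fin.cons p.1 p.2))
      (ν.prod (Measure.pi fun _ => ν)) :=
  ((measurePreserving_cons ν n).integrable_comp_emb (measurableEmbedding_cons n)).2 hf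

theorem integral_pi_succ {n : ℕ} {f : (Fin (n + 1) → X) → ℂ}
    (hf : Integrable f (Measure.pi fun _ => ν)) :
    ∫ x, f x ∂Measure.pi (fun _ => ν) =
      ∫ x, ∫ y : Fin n → X, f (Fin.cons x y) ∂Measure.pi (fun _ => ν) ∂ν := by
  rw [← (measurePreserving_cons ν n).integral_comp (measurableEmbedding_cons n)]
  exact integral_prod _ (integrable_comp_cons hf)

end Cons

section Phase

variable {X : Type*} [MeasurableSpace X] {μ : ComplexMeasure X} {h : X → ℂ}

/-- The polar decomposition `dμ = h d|μ|` of a complex measure, with `h` of modulus one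
everywhere. -/
structure IsPhase (μ : ComplexMeasure X) (h : X → ℂ) : Prop where
  measurable : Measurable h
  norm_eq_one : ∀ x, ‖h x‖ = 1
  withDensityᵥ_eq : μ.variation.withDensityᵥ h = μ

namespace IsPhase

theorem integrable_mul (hh : IsPhase μ h) {f : X → ℂ} (hf : Integrable f μ.variation) :
    Integrable (fun x => f x * h x) μ.variation :=
  hf.mul_bdd (c := 1) hh.measurable.aestronglyMeasurable
    (.of_forall fun x => (hh.norm_eq_one x).le)

theorem measurable_prod (hh : IsPhase μ h) {ι : Type*} [Fintype ι] :
    Measurable fun x : ι → X => ∏ i, h (x i) :=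
  Finset.measurable_prod _ fun i _ => hh.measurable.comp (measurable_pi_apply i)

theorem norm_prod_eq_one (hh : IsPhase μ h) {ι : Type*} [Fintype ι] (x : ι → X) :
    ‖∏ i, h (x i)‖ = 1 := by
  simp [hh.norm_eq_one]

theorem lipschitzWith_integral_mul (hh : IsPhase μ h) :
    LipschitzWith 1 fun f : X →₁[μ.variation] ℂ => ∫ x, f x * h x ∂μ.variation := by
  refine LipschitzWith.of_dist_le_mul fun f g => ?_
  rw [dist_eq_norm, dist_eq_norm, ← integral_sub (hh.integrable_mul (L1.integrable_coeFn f))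
    (hh.integrable_mul (L1.integrable_coeFn g)), L1.norm_eq_integral_norm, NNReal.coe_one, one_mul]
  refine (norm_integral_le_integral_norm _).trans_eq (integral_congr_ae ?_)
  filter_upwards [Lp.coeFn_sub f g] with x hx
  rw [hx, Pi.sub_apply, ← sub_mul, norm_mul, hh.norm_eq_one, mul_one]

theorem integrable_mul_prod (hh : IsPhase μ h) {ι : Type*} [Fintype ι] {f : (ι → X) → ℂ}
    (hf : Integrable f (Measure.pi fun _ => μ.variation)) :
    Integrable (fun x => f x * ∏ i, h (x i)) (Measure.pi fun _ => μ.variation) :=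
  hf.mul_bdd (c := 1) hh.measurable_prod.aestronglyMeasurable
    (.of_forall fun x => (hh.norm_prod_eq_one x).le)

end IsPhase

theorem measurable_rnDeriv_complexMeasure (μ : ComplexMeasure X) (ν : Measure X) :
    Measurable (μ.rnDeriv ν) :=
  measurable_of_re_im (SignedMeasure.measurable_rnDeriv _ _) (SignedMeasure.measurable_rnDeriv _ _)

theorem apply_eq_zero_of_variation_eq_zero (s : Set X)
    (hs : μ.variation.toENNRealVectorMeasure s = 0) : μ s = 0 := by
  by_cases hsm : MeasurableSet s
  · rw [Measure.toENNRealVectorMeasure_apply_measurable hsm] at hs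
    simpa [hs] using μ.enorm_measure_le_variation s
  · exact μ.not_measurable hsm

theorem setIntegral_signedMeasure_rnDeriv {s : SignedMeasure X} {ν : Measure X} [SigmaFinite ν]
    (hs : s.AbsolutelyContinuous ν.toENNRealVectorMeasure) {t : Set X} (ht : MeasurableSet t) :
    ∫ x in t, s.rnDeriv ν x ∂ν = s t := by
  rw [← withDensityᵥ_apply (SignedMeasure.integrable_rnDeriv _ _) ht,
    SignedMeasure.withDensityᵥ_rnDeriv_eq s ν hs]

variable [IsFiniteMeasure μ.variation]

instance isFiniteMeasure_absPi (μ : ComplexMeasure X) [IsFiniteMeasure μ.variation] (n : ℕ) :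
    IsFiniteMeasure (absPi μ n) :=
  inferInstanceAs (IsFiniteMeasure (Measure.pi fun _ : Fin n => μ.variation))

theorem withDensityᵥ_rnDeriv_variation : μ.variation.withDensityᵥ (μ.rnDeriv μ.variation) = μ := by
  have hint := μ.integrable_rnDeriv μ.variation
  ext s hs
  rw [withDensityᵥ_apply hint hs]
  apply Complex.ext
  · rw [← RCLike.re_eq_complex_re, ← integral_re hint.integrableOn]
    exact setIntegral_signedMeasure_rnDeriv (s := ComplexMeasure.re μ)
      (fun t ht => congrArg Complex.re (apply_eq_zero_of_variation_eq_zero t ht)) hs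
  · rw [← RCLike.im_eq_complex_im, ← integral_im hint.integrableOn]
    exact setIntegral_signedMeasure_rnDeriv (s := ComplexMeasure.im μ)
      (fun t ht => congrArg Complex.im (apply_eq_zero_of_variation_eq_zero t ht)) hs

theorem norm_rnDeriv_variation_ae_eq_one :
    ∀ᵐ x ∂μ.variation, ‖μ.rnDeriv μ.variation x‖ = 1 := by
  have hvar := Measure.variation_withDensityᵥ (μ.integrable_rnDeriv μ.variation)
  rw [withDensityᵥ_rnDeriv_variation] at hvar
  have henorm : (fun x => ‖μ.rnDeriv μ.variation x‖ₑ) =ᵐ[μ.variation] fun _ => 1 := by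
    refine (withDensity_eq_iff_of_sigmaFinite
      (measurable_rnDeriv_complexMeasure _ _).enorm.aemeasurable aemeasurable_const).1 ?_
    rw [← hvar]
    exact withDensity_one.symm
  filter_upwards [henorm] with x hx
  simpa [enorm_eq_nnnorm, ← NNReal.coe_eq_one] using hx

theorem exists_isPhase (μ : ComplexMeasure X) [IsFiniteMeasure μ.variation] :
    ∃ h, IsPhase μ h := by
  classical
  set g := μ.rnDeriv μ.variation
  have hg : Measurable g := measurable_rnDeriv_complexMeasure _ _
  refine ⟨fun x => if ‖g x‖ = 1 then g x else 1,
    .ite (hg.norm (measurableSet_singleton 1)) hg measurable_const, fun x => ?_, ?_⟩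
  · split_ifs with hx
    · exact hx
    · exact norm_one
  · conv_rhs => rw [← withDensityᵥ_rnDeriv_variation (μ := μ)]
    refine WithDensityᵥEq.congr_ae ?_
    filter_upwards [norm_rnDeriv_variation_ae_eq_one] with x hx using if_pos hx

namespace IsPhase

theorem integrable (hh : IsPhase μ h) : Integrable h μ.variation := by
  simpa using hh.integrable_mul (integrable_const 1)

theorem vectorIntegral_indicator (hh : IsPhase μ h) (c : ℂ) {s : Set X} (hs : MeasurableSet s) :
    VectorMeasure.integral μ (s.indicator fun _ => c) (ContinuousLinearMap.mul ℝ ℂ) =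
      ∫ x, s.indicator (fun _ => c) x * h x ∂μ.variation := by
  have hμs : μ s = ∫ x in s, h x ∂μ.variation := by
    rw [← withDensityᵥ_apply hh.integrable hs, hh.withDensityᵥ_eq]
  have hmul (x : X) : s.indicator (fun _ => c) x * h x = s.indicator (fun x => c * h x) x :=
    (Set.indicator_mul_left s (fun _ => c) h).symm
  simp_rw [hmul]
  rw [integral_indicator hs, integral_const_mul, VectorMeasure.integral_indicator_const c hs, hμs]
  rfl

theorem vectorIntegral_eq (hh : IsPhase μ h) {f : X → ℂ} (hf : Integrable f μ.variation) :
    VectorMeasure.integral μ f (ContinuousLinearMap.mul ℝ ℂ) = ∫ x, f x * h x ∂μ.variation := by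
  refine Integrable.induction (fun f => VectorMeasure.integral μ f (ContinuousLinearMap.mul ℝ ℂ) =
    ∫ x, f x * h x ∂μ.variation) ?_ ?_ ?_ ?_ hf
  · exact fun c s hs _ => hh.vectorIntegral_indicator c hs
  · intro f g _ hf hg hfe hge
    rw [VectorMeasure.integral_add hf hg, hfe, hge,
      ← integral_add (hh.integrable_mul hf) (hh.integrable_mul hg)]
    simp only [Pi.add_apply, add_mul]
  · exact isClosed_eq VectorMeasure.continuous_integral hh.lipschitzWith_integral_mul.continuous
  · intro f g hfg _ hf
    rw [← VectorMeasure.integral_congr_ae hfg, hf]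
    exact integral_congr_ae (hfg.mono fun x hx => by simp only [hx])

theorem iterIntegral_eq (hh : IsPhase μ h) {n : ℕ} {f : (Fin n → X) → ℂ}
    (hf : Integrable f (absPi μ n)) :
    iterIntegral μ n f = ∫ x, f x * ∏ i, h (x i) ∂absPi μ n := by
  induction n with
  | zero =>
    rw [iterIntegral, absPi, Measure.pi_of_empty, integral_dirac' _ _ .of_subsingleton_dom,
      univ_eq_empty, prod_empty, mul_one]
    exact congrArg f (Subsingleton.elim _ _)
  | succ n ih =>
    have hcons := integrable_comp_cons hf
    have hphase : Integrable (fun p : X × (Fin n → X) => f (Fin.cons p.1 p.2) * ∏ i, h (p.2 i))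
        (μ.variation.prod (absPi μ n)) :=
      hcons.mul_bdd (c := 1) (hh.measurable_prod.comp measurable_snd).aestronglyMeasurable
        (.of_forall fun p => (hh.norm_prod_eq_one p.2).le)
    have hslice : (fun x => iterIntegral μ n fun y => f (Fin.cons x y)) =ᵐ[μ.variation]
        fun x => ∫ y, f (Fin.cons x y) * ∏ i, h (y i) ∂absPi μ n := by
      filter_upwards [hcons.prod_right_ae] with x hx using ih hx
    rw [iterIntegral, VectorMeasure.integral_congr_ae hslice,
      hh.vectorIntegral_eq hphase.integral_prod_left]
    refine Eq.trans (integral_congr_ae (.of_forall fun x => ?_))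
      (integral_pi_succ (hh.integrable_mul_prod hf)).symm
    simp only [← integral_mul_const, Fin.prod_univ_succ, Fin.cons_zero, Fin.cons_succ,
      mul_comm (h x), mul_assoc, absPi]

end IsPhase

theorem norm_iterIntegral_le {n : ℕ} {f : (Fin n → X) → ℂ} (hf : Integrable f (absPi μ n)) :
    ‖iterIntegral μ n f‖ ≤ (∫⁻ x, ENNReal.ofReal ‖f x‖ ∂absPi μ n).toReal := by
  obtain ⟨h, hh⟩ := exists_isPhase μ
  rw [hh.iterIntegral_eq hf]
  refine (norm_integral_le_lintegral_norm _).trans_eq ?_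
  simp [hh.norm_eq_one]

end Phase

/-! ### Bounds on the cluster functions -/

section Measurability

theorem measurable_of_measurable_coe {β : Type*} [MeasurableSpace β] {f : WithTop ℂ → β}
    (h : Measurable fun z : ℂ => f z) : Measurable f := fun _ hs => h hs

theorem measurable_expNeg : Measurable expNeg :=
  measurable_of_measurable_coe (Complex.measurable_exp.comp measurable_neg)

theorem measurable_untopD (w : ℂ) : Measurable fun z : WithTop ℂ => z.untopD w :=
  measurable_of_measurable_coe measurable_id

variable {X : Type*} [MeasurableSpace X] {u : X → X → WithTop ℂ}

theorem measurable_edgeZeta (hu : ∀ x y, u x y = u y x)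
    (hm : Measurable fun p : X × X => u p.1 p.2) {κ : Type*} (e : Sym2 κ) :
    Measurable fun x : κ → X => edgeZeta hu x e := by
  induction e with | _ i j
  exact ((measurable_expNeg.comp hm).sub_const 1).comp (f := fun x : κ → X => (x i, x j))
    ((measurable_pi_apply i).prodMk (measurable_pi_apply j))

theorem measurable_boltzmann (hu : ∀ x y, u x y = u y x)
    (hm : Measurable fun p : X × X => u p.1 p.2) (n : ℕ) :
    Measurable fun x : Fin n → X => boltzmann u x := by
  simp only [boltzmann_eq_fullProd hu]
  exact Finset.measurable_prod _ fun e _ => (measurable_edgeZeta hu hm e).const_add 1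

theorem measurable_phi (hu : ∀ x y, u x y = u y x)
    (hm : Measurable fun p : X × X => u p.1 p.2) (n : ℕ) :
    Measurable fun x : Fin (n + 1) → X => phi u x := by
  simp only [phi_eq_connSum hu]
  exact (Finset.measurable_sum _ fun _ _ =>
    Finset.measurable_prod _ fun e _ => measurable_edgeZeta hu hm e).const_mul _

end Measurability

section TreeGraph

variable {X : Type*} [MeasurableSpace X] {u : X → X → WithTop ℂ} {hu : ∀ x y, u x y = u y x}
  {μ : ComplexMeasure X} {a b : X → ℝ} {K : Sym2 X → ℝ≥0∞} {c : X → ℝ≥0∞}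

/-- The tree-graph inequality with edge kernel `K` and vertex weight `c`: at almost all
configurations, the sum over the connected graphs is bounded by a sum over trees. -/
def TreeGraphBound (μ : ComplexMeasure X) (hu : ∀ x y, u x y = u y x) (K : Sym2 X → ℝ≥0∞)
    (c : X → ℝ≥0∞) : Prop :=
  ∀ n, ∀ᵐ x ∂absPi μ (n + 1), ENNReal.ofReal ‖connSum (edgeZeta hu x) univ‖ ≤
    (∏ i, c (x i)) * treeSum (fun e => K (e.map x)) univ

/-- The function `|ζ|` on unordered pairs of points. -/
def zetaKernel (hu : ∀ x y, u x y = u y x) (e : Sym2 X) : ℝ≥0∞ :=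
  ENNReal.ofReal ‖expNeg (symmPotential u hu e) - 1‖

/-- The function `|ū|` on unordered pairs of points. -/
def ubarKernel (hu : ∀ x y, u x y = u y x) (e : Sym2 X) : ℝ≥0∞ :=
  ENNReal.ofReal ‖(symmPotential u hu e).untopD 1‖

theorem ofReal_treeSum {w : Sym2 ι → ℝ} (hw : ∀ e, 0 ≤ w e) (V : Finset ι) :
    ENNReal.ofReal (treeSum w V) = treeSum (fun e => ENNReal.ofReal (w e)) V := by
  rw [treeSum, treeSum, ENNReal.ofReal_sum_of_nonneg fun _ _ => prod_nonneg fun e _ => hw e]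
  exact sum_congr rfl fun _ _ => ENNReal.ofReal_prod_of_nonneg fun e _ => hw e

theorem ofReal_le_prod_mul_treeSum {w : Sym2 ι → ℝ} (hw : ∀ e, 0 ≤ w e) {V : Finset ι} {g : ι → ℝ}
    {r : ℝ} (h : r ≤ (∏ i ∈ V, Real.exp (g i)) * treeSum w V) :
    ENNReal.ofReal r ≤ (∏ i ∈ V, ENNReal.ofReal (Real.exp (g i))) *
      treeSum (fun e => ENNReal.ofReal (w e)) V := by
  rw [← ENNReal.ofReal_prod_of_nonneg fun _ _ => (Real.exp_pos _).le, ← ofReal_treeSum hw,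
    ← ENNReal.ofReal_mul (prod_nonneg fun _ _ => (Real.exp_pos _).le)]
  exact ENNReal.ofReal_le_ofReal h

theorem ofReal_mul_ofReal_exp_mul_ofReal_exp {r : ℝ} (hr : 0 ≤ r) (s t : ℝ) :
    ENNReal.ofReal r * ENNReal.ofReal (Real.exp s) * ENNReal.ofReal (Real.exp t) =
      ENNReal.ofReal (r * Real.exp (t + s)) := by
  rw [mul_assoc, ← ENNReal.ofReal_mul (Real.exp_pos _).le, ← Real.exp_add,
    ← ENNReal.ofReal_mul hr, add_comm]

variable [IsFiniteMeasure μ.variation]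

theorem Stable.ae_forall (hu : ∀ x y, u x y = u y x) (hst : Stable μ u b) (n : ℕ) :
    ∀ᵐ x ∂absPi μ n, ∀ V : Finset (Fin n),
      ∏ e ∈ edges V, ‖1 + edgeZeta hu x e‖ ≤ ∏ i ∈ V, Real.exp (b (x i)) := by
  refine ae_all_iff.2 fun V => ?_
  set e := finSumEquivOfFinset (rfl : #V = #V) (rfl : #Vᶜ = #Vᶜ)
  have hV : univ.map (Function.Embedding.inl.trans e.toEmbedding) = V :=
    map_finSumEquivOfFinset_inl rfl rfl
  have hmp := (measurePreserving_split μ.variation e).quasiMeasurePreserving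
  filter_upwards [hmp.ae (Measure.quasiMeasurePreserving_fst.ae (hst #V))] with x hx
  have hpairs := prod_pairs fun f => ‖1 + edgeZeta hu (fun i => x (e (Sum.inl i))) f‖
  simp only [edgeZeta_mk] at hpairs
  rw [hpairs] at hx
  rw [← hV, edges_map, prod_map, prod_map]
  refine (prod_congr rfl fun f _ => ?_).trans_le hx
  induction f with | _ i j
  rfl

theorem Stable.treeGraphBound_zetaKernel (hst : Stable μ u b) :
    TreeGraphBound μ hu (zetaKernel hu) fun x => ENNReal.ofReal (Real.exp (2 * b x)) := by
  intro n
  filter_upwards [hst.ae_forall hu (n + 1)] with x hx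
  exact ofReal_le_prod_mul_treeSum (fun _ => norm_nonneg _)
    (norm_connSum_le_treeSum_zeta (b := fun i => b (x i)) hx univ_nonempty)

theorem Stable.treeGraphBound_ubarKernel (hst : Stable μ u b) (hb : ∀ x, 0 ≤ b x) :
    TreeGraphBound μ hu (ubarKernel hu) fun x => ENNReal.ofReal (Real.exp (b x)) := by
  intro n
  filter_upwards [hst.ae_forall hu (n + 1)] with x hx
  simp only [edgeZeta, add_sub_cancel] at hx
  exact ofReal_le_prod_mul_treeSum (fun _ => norm_nonneg _)
    (norm_connSum_le_treeSum_ubar (b := fun i => b (x i)) (fun _ => hb _) hx univ_nonempty)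

theorem TreeGraphBound.ae_phi_cons_le (h : TreeGraphBound μ hu K c) :
    ∀ᵐ x ∂μ.variation, ∀ n : ℕ, ∀ᵐ y ∂absPi μ n,
      ENNReal.ofReal ‖phi u (Fin.cons x y : Fin (n + 1) → X)‖ ≤
        (((n + 1)! : ℕ) : ℝ≥0∞)⁻¹ * c x *
          (treeSum (fun e => K (e.map (addPoint x y))) univ * ∏ i, c (y i)) := by
  have hslice := ae_all_iff.2 fun n => Measure.ae_ae_of_ae_prod
    ((measurePreserving_cons μ.variation n).quasiMeasurePreserving.ae (h n))
  filter_upwards [hslice] with x hx n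
  filter_upwards [hx n] with y hy
  rw [ofReal_norm_phi hu, mul_assoc]
  gcongr
  refine hy.trans_eq ?_
  rw [Fin.prod_univ_succ, ← Fin.insertNth_zero', treeSum_insertNth]
  simp only [Fin.insertNth_zero', Fin.cons_zero, Fin.cons_succ]
  ring

theorem TreeGraphBound.ae_succ_mul_lintegral_phi_cons_le
    (hK : Measurable fun p : X × X => K s(p.1, p.2)) (hc : Measurable c)
    (h : TreeGraphBound μ hu K c) :
    ∀ᵐ x ∂μ.variation, ∀ n : ℕ, ((n + 1 : ℕ) : ℝ≥0∞) *
        ∫⁻ y, ENNReal.ofReal ‖phi u (Fin.cons x y : Fin (n + 1) → X)‖ ∂absPi μ n ≤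
      c x * (((n ! : ℕ) : ℝ≥0∞)⁻¹ * treeIntegral μ.variation K c n x) := by
  filter_upwards [h.ae_phi_cons_le] with x hx n
  calc ((n + 1 : ℕ) : ℝ≥0∞) *
        ∫⁻ y, ENNReal.ofReal ‖phi u (Fin.cons x y : Fin (n + 1) → X)‖ ∂absPi μ n
      ≤ ((n + 1 : ℕ) : ℝ≥0∞) * ∫⁻ y, (((n + 1)! : ℕ) : ℝ≥0∞)⁻¹ * c x *
          (treeSum (fun e => K (e.map (addPoint x y))) univ * ∏ i, c (y i)) ∂absPi μ n :=
        mul_le_mul_right (lintegral_mono_ae (hx n)) _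
    _ = ((n + 1 : ℕ) : ℝ≥0∞) * ((((n + 1)! : ℕ) : ℝ≥0∞)⁻¹ * c x *
          treeIntegral μ.variation K c n x) := by
        rw [lintegral_const_mul _ (measurable_treeIntegrand_right hK hc _ x)]
        rfl
    _ = c x * (((n ! : ℕ) : ℝ≥0∞)⁻¹ * treeIntegral μ.variation K c n x) := by
        rw [← succ_mul_inv_factorial_succ n]
        ring

theorem TreeGraphBound.ae_rootedClusterSum_le (hK : Measurable fun p : X × X => K s(p.1, p.2))
    (hc : Measurable c) (h : TreeGraphBound μ hu K c) (ha : ∀ x, 0 ≤ a x)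
    (hcrit : ∀ᵐ x ∂μ.variation, ∫⁻ z, K s(x, z) * c z * ENNReal.ofReal (Real.exp (a z))
      ∂μ.variation ≤ ENNReal.ofReal (a x)) :
    ∀ᵐ x ∂μ.variation, rootedClusterSum μ u x ≤ c x * ENNReal.ofReal (Real.exp (a x) - 1) := by
  filter_upwards [h.ae_succ_mul_lintegral_phi_cons_le hK hc, tsum_treeIntegral_le hK hc ha hcrit]
    with x hx hsum
  calc rootedClusterSum μ u x
      ≤ ∑' m : ℕ, c x * ((((m + 1)! : ℕ) : ℝ≥0∞)⁻¹ * treeIntegral μ.variation K c (m + 1) x) :=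
        ENNReal.tsum_le_tsum fun m => hx (m + 1)
    _ ≤ c x * ENNReal.ofReal (Real.exp (a x) - 1) := by
        rw [ENNReal.tsum_mul_left]
        gcongr

theorem ae_rootedClusterSum_le_of_zetaCriterion (hu : ∀ x y, u x y = u y x)
    (hm : Measurable fun p : X × X => u p.1 p.2) (hbm : Measurable b) (ha : ∀ x, 0 ≤ a x)
    (hst : Stable μ u b) (hcrit : ZetaCriterion μ u a b) :
    ∀ᵐ x ∂μ.variation, rootedClusterSum μ u x ≤
      ENNReal.ofReal ((Real.exp (a x) - 1) * Real.exp (2 * b x)) := by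
  have hroot := (hst.treeGraphBound_zetaKernel (hu := hu)).ae_rootedClusterSum_le
    ((measurable_expNeg.comp hm).sub_const 1).norm.ennreal_ofReal
    (hbm.const_mul 2).exp.ennreal_ofReal ha (hcrit.mono fun x hx => ?_)
  · filter_upwards [hroot] with x hx
    rwa [mul_comm (_ - _), ENNReal.ofReal_mul (Real.exp_pos _).le]
  · exact (lintegral_congr fun y =>
      ofReal_mul_ofReal_exp_mul_ofReal_exp (norm_nonneg _) _ _).trans_le hx

theorem ae_rootedClusterSum_le_of_ubarCriterion (hu : ∀ x y, u x y = u y x)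
    (hm : Measurable fun p : X × X => u p.1 p.2) (hbm : Measurable b) (ha : ∀ x, 0 ≤ a x)
    (hb : ∀ x, 0 ≤ b x) (hst : Stable μ u b) (hcrit : UbarCriterion μ u a b) :
    ∀ᵐ x ∂μ.variation, rootedClusterSum μ u x ≤
      ENNReal.ofReal ((Real.exp (a x) - 1) * Real.exp (b x)) := by
  have hroot := (hst.treeGraphBound_ubarKernel (hu := hu) hb).ae_rootedClusterSum_le
    ((measurable_untopD 1).comp hm).norm.ennreal_ofReal
    hbm.exp.ennreal_ofReal ha (hcrit.mono fun x hx => ?_)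
  · filter_upwards [hroot] with x hx
    rwa [mul_comm (_ - _), ENNReal.ofReal_mul (Real.exp_pos _).le]
  · exact (lintegral_congr fun y =>
      ofReal_mul_ofReal_exp_mul_ofReal_exp (norm_nonneg _) _ _).trans_le hx

theorem lintegral_rootedClusterSum_lt_top (hu : ∀ x y, u x y = u y x)
    (hm : Measurable fun p : X × X => u p.1 p.2) (hbm : Measurable b) (ha : ∀ x, 0 ≤ a x)
    (hb : ∀ x, 0 ≤ b x) (hst : Stable μ u b) (hcrit : ZetaCriterion μ u a b ∨ UbarCriterion μ u a b)
    (hint : ∫⁻ x, ENNReal.ofReal (Real.exp (a x + 2 * b x)) ∂μ.variation < ∞) :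
    ∫⁻ x, rootedClusterSum μ u x ∂μ.variation < ∞ := by
  refine (lintegral_mono_ae ?_).trans_lt hint
  rcases hcrit with hzeta | hubar
  · filter_upwards [ae_rootedClusterSum_le_of_zetaCriterion hu hm hbm ha hst hzeta] with x hx
    refine hx.trans (ENNReal.ofReal_le_ofReal ?_)
    rw [Real.exp_add]
    gcongr
    linarith
  · filter_upwards [ae_rootedClusterSum_le_of_ubarCriterion hu hm hbm ha hb hst hubar] with x hx
    refine hx.trans (ENNReal.ofReal_le_ofReal ?_)
    rw [Real.exp_add]
    gcongr <;> linarith [hb x]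

end TreeGraph

/-! ### Convergence of the two series -/

section Convergence

variable {X : Type*} [MeasurableSpace X] {u : X → X → WithTop ℂ} {μ : ComplexMeasure X}
  {b : X → ℝ}

theorem isFiniteMeasure_of_lintegral_exp_lt_top {ν : Measure X} {f : X → ℝ} (hf : ∀ x, 0 ≤ f x)
    (hint : ∫⁻ x, ENNReal.ofReal (Real.exp (f x)) ∂ν < ∞) : IsFiniteMeasure ν := by
  refine ⟨lt_of_le_of_lt ?_ hint⟩
  rw [← lintegral_one]
  refine lintegral_mono fun x => ?_
  rw [← ENNReal.ofReal_one]
  exact ENNReal.ofReal_le_ofReal (Real.one_le_exp (hf x))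

theorem integrable_of_lintegral_ofReal_norm_lt_top {α : Type*} [MeasurableSpace α] {ν : Measure α}
    {f : α → ℂ} (hf : Measurable f) (h : ∫⁻ x, ENNReal.ofReal ‖f x‖ ∂ν < ∞) : Integrable f ν :=
  ⟨hf.aestronglyMeasurable, by simpa only [HasFiniteIntegral, ofReal_norm] using h⟩

theorem tsum_inv_factorial_mul_pow_lt_top {M : ℝ≥0∞} (hM : M < ∞) :
    ∑' n : ℕ, ((n ! : ℕ) : ℝ≥0∞)⁻¹ * M ^ n < ∞ := by
  have hterm (n : ℕ) : ((n ! : ℕ) : ℝ≥0∞)⁻¹ * M ^ n = ENNReal.ofReal (M.toReal ^ n / n !) := by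
    rw [ENNReal.ofReal_div_of_pos (by positivity), ENNReal.ofReal_pow ENNReal.toReal_nonneg,
      ENNReal.ofReal_toReal hM.ne, ENNReal.ofReal_natCast, ENNReal.div_eq_inv_mul]
  simp_rw [hterm]
  exact (Real.summable_pow_div_factorial M.toReal).tsum_ofReal_lt_top

theorem partitionTerm_zero : partitionTerm μ u 0 = 1 := by
  simp [partitionTerm, iterIntegral, boltzmann, pairs]

variable [IsFiniteMeasure μ.variation]

theorem Stable.lintegral_boltzmann_le (hu : ∀ x y, u x y = u y x) (hbm : Measurable b)
    (hst : Stable μ u b) (n : ℕ) :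
    ∫⁻ x, ENNReal.ofReal ‖boltzmann u x‖ ∂absPi μ n ≤
      (∫⁻ x, ENNReal.ofReal (Real.exp (b x)) ∂μ.variation) ^ n := by
  rw [← lintegral_pi_prod hbm.exp.ennreal_ofReal]
  refine lintegral_mono_ae ?_
  filter_upwards [hst.ae_forall hu n] with x hx
  rw [boltzmann_eq_fullProd hu, fullProd, norm_prod,
    ← ENNReal.ofReal_prod_of_nonneg fun _ _ => (Real.exp_pos _).le]
  exact ENNReal.ofReal_le_ofReal (hx univ)

theorem Stable.tsum_lintegral_boltzmann_lt_top (hu : ∀ x y, u x y = u y x) (hbm : Measurable b)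
    (hst : Stable μ u b) (hM : ∫⁻ x, ENNReal.ofReal (Real.exp (b x)) ∂μ.variation < ∞) :
    ∑' n : ℕ, ((n ! : ℕ) : ℝ≥0∞)⁻¹ * ∫⁻ x, ENNReal.ofReal ‖boltzmann u x‖ ∂absPi μ n < ∞ :=
  (ENNReal.tsum_le_tsum fun n =>
    mul_le_mul_right (hst.lintegral_boltzmann_le hu hbm n) _).trans_lt
    (tsum_inv_factorial_mul_pow_lt_top hM)

theorem Stable.integrable_boltzmann (hu : ∀ x y, u x y = u y x)
    (hm : Measurable fun p : X × X => u p.1 p.2) (hbm : Measurable b) (hst : Stable μ u b)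
    (hM : ∫⁻ x, ENNReal.ofReal (Real.exp (b x)) ∂μ.variation < ∞) (n : ℕ) :
    Integrable (fun x : Fin n → X => boltzmann u x) (absPi μ n) :=
  integrable_of_lintegral_ofReal_norm_lt_top (measurable_boltzmann hu hm n)
    ((hst.lintegral_boltzmann_le hu hbm n).trans_lt (ENNReal.pow_lt_top hM))

theorem Stable.norm_partitionTerm_le (hu : ∀ x y, u x y = u y x)
    (hm : Measurable fun p : X × X => u p.1 p.2) (hbm : Measurable b) (hst : Stable μ u b)
    (hM : ∫⁻ x, ENNReal.ofReal (Real.exp (b x)) ∂μ.variation < ∞) (n : ℕ) :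
    ‖partitionTerm μ u n‖ ≤
      (∫⁻ x, ENNReal.ofReal (Real.exp (b x)) ∂μ.variation).toReal ^ n / n ! := by
  rw [partitionTerm, norm_mul, norm_inv, Complex.norm_natCast, inv_mul_eq_div]
  gcongr
  refine (norm_iterIntegral_le (hst.integrable_boltzmann hu hm hbm hM n)).trans ?_
  rw [← ENNReal.toReal_pow]
  exact ENNReal.toReal_mono (ENNReal.pow_lt_top hM).ne (hst.lintegral_boltzmann_le hu hbm n)

theorem Stable.summable_succ_mul_norm_partitionTerm (hu : ∀ x y, u x y = u y x)
    (hm : Measurable fun p : X × X => u p.1 p.2) (hbm : Measurable b) (hst : Stable μ u b)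
    (hM : ∫⁻ x, ENNReal.ofReal (Real.exp (b x)) ∂μ.variation < ∞) :
    Summable fun n : ℕ => (n + 1 : ℝ) * ‖partitionTerm μ u (n + 1)‖ := by
  set M := (∫⁻ x, ENNReal.ofReal (Real.exp (b x)) ∂μ.variation).toReal
  refine ((Real.summable_pow_div_factorial M).mul_left M).of_nonneg_of_le
    (fun n => by positivity) fun n => ?_
  calc (n + 1 : ℝ) * ‖partitionTerm μ u (n + 1)‖
      ≤ (n + 1) * (M ^ (n + 1) / (n + 1)!) := by
        gcongr
        exact hst.norm_partitionTerm_le hu hm hbm hM (n + 1)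
    _ = M * (M ^ n / n !) := by
        rw [Nat.factorial_succ]
        push_cast
        field_simp
        ring

theorem Stable.summable_partitionTerm (hu : ∀ x y, u x y = u y x)
    (hm : Measurable fun p : X × X => u p.1 p.2) (hbm : Measurable b) (hst : Stable μ u b)
    (hM : ∫⁻ x, ENNReal.ofReal (Real.exp (b x)) ∂μ.variation < ∞) :
    Summable fun n : ℕ => partitionTerm μ u n :=
  .of_norm_bounded (Real.summable_pow_div_factorial _) (hst.norm_partitionTerm_le hu hm hbm hM)

theorem measurable_lintegral_phi_cons (hu : ∀ x y, u x y = u y x)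
    (hm : Measurable fun p : X × X => u p.1 p.2) (n : ℕ) :
    Measurable fun x => ∫⁻ y, ENNReal.ofReal ‖phi u (Fin.cons x y : Fin (n + 1) → X)‖ ∂absPi μ n :=
  Measurable.lintegral_prod_right'
    (f := fun p : X × (Fin n → X) => ENNReal.ofReal ‖phi u (Fin.cons p.1 p.2 : Fin (n + 1) → X)‖)
    ((measurable_phi hu hm n).norm.ennreal_ofReal.comp (measurableEmbedding_cons n).measurable)

theorem lintegral_rootedClusterSum (hu : ∀ x y, u x y = u y x)
    (hm : Measurable fun p : X × X => u p.1 p.2) :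
    ∫⁻ x, rootedClusterSum μ u x ∂μ.variation = ∑' m : ℕ, ((m + 2 : ℕ) : ℝ≥0∞) *
      ∫⁻ x : Fin (m + 2) → X, ENNReal.ofReal ‖phi u x‖ ∂absPi μ (m + 2) := by
  have hmeas (m : ℕ) := measurable_lintegral_phi_cons (μ := μ) hu hm (m + 1)
  simp only [rootedClusterSum]
  rw [lintegral_tsum fun m => ((hmeas m).const_mul _).aemeasurable]
  refine tsum_congr fun m => ?_
  rw [lintegral_const_mul _ (hmeas m)]
  exact congrArg _ (lintegral_pi_succ (measurable_phi hu hm (m + 1)).norm.ennreal_ofReal).symm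

theorem tsum_succ_mul_lintegral_phi_lt_top (hu : ∀ x y, u x y = u y x)
    (hm : Measurable fun p : X × X => u p.1 p.2)
    (hroot : ∫⁻ x, rootedClusterSum μ u x ∂μ.variation < ∞) :
    ∑' m : ℕ, ((m + 1 : ℕ) : ℝ≥0∞) * ∫⁻ x, ENNReal.ofReal ‖phi u x‖ ∂absPi μ (m + 1) < ∞ := by
  rw [tsum_eq_zero_add' ENNReal.summable]
  refine ENNReal.add_lt_top.2 ⟨?_, (lintegral_rootedClusterSum hu hm).symm.trans_lt hroot⟩
  simp [phi_one]

theorem tsum_lintegral_phi_lt_top (hu : ∀ x y, u x y = u y x)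
    (hm : Measurable fun p : X × X => u p.1 p.2)
    (hroot : ∫⁻ x, rootedClusterSum μ u x ∂μ.variation < ∞) :
    ∑' m : ℕ, ∫⁻ x, ENNReal.ofReal ‖phi u x‖ ∂absPi μ (m + 1) < ∞ := by
  refine (ENNReal.tsum_le_tsum fun m => ?_).trans_lt
    (tsum_succ_mul_lintegral_phi_lt_top hu hm hroot)
  exact le_mul_of_one_le_left zero_le (mod_cast m.succ_pos)

theorem integrable_phi (hu : ∀ x y, u x y = u y x) (hm : Measurable fun p : X × X => u p.1 p.2)
    (hroot : ∫⁻ x, rootedClusterSum μ u x ∂μ.variation < ∞) (m : ℕ) :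
    Integrable (fun x : Fin (m + 1) → X => phi u x) (absPi μ (m + 1)) :=
  integrable_of_lintegral_ofReal_norm_lt_top (measurable_phi hu hm m)
    ((ENNReal.le_tsum m).trans_lt (tsum_lintegral_phi_lt_top hu hm hroot))

theorem summable_succ_mul_norm_clusterTerm (hu : ∀ x y, u x y = u y x)
    (hm : Measurable fun p : X × X => u p.1 p.2)
    (hroot : ∫⁻ x, rootedClusterSum μ u x ∂μ.variation < ∞) :
    Summable fun m : ℕ => (m + 1 : ℝ) * ‖clusterTerm μ u (m + 1)‖ := by
  have hsum := ENNReal.summable_toReal (tsum_succ_mul_lintegral_phi_lt_top hu hm hroot).ne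
  refine hsum.of_nonneg_of_le (fun m => by positivity) fun m => ?_
  rw [ENNReal.toReal_mul, ENNReal.toReal_natCast, Nat.cast_add_one]
  gcongr
  exact norm_iterIntegral_le (integrable_phi hu hm hroot m)

theorem summable_clusterTerm (hu : ∀ x y, u x y = u y x)
    (hm : Measurable fun p : X × X => u p.1 p.2)
    (hroot : ∫⁻ x, rootedClusterSum μ u x ∂μ.variation < ∞) :
    Summable fun m : ℕ => clusterTerm μ u (m + 1) :=
  (summable_norm_of_summable_succ_mul_norm
    (summable_succ_mul_norm_clusterTerm hu hm hroot)).of_norm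

end Convergence

/-! ### The recursion for the partition function -/

section Split

variable {X : Type*} [MeasurableSpace X] {ν : Measure X} [SigmaFinite ν] {κ τ σ : Type*}
  [Fintype κ] [Fintype τ] [Fintype σ] {F : (κ → X) → ℂ} {G : (σ → X) → ℂ}

theorem integrable_split_mul (e : κ ⊕ σ ≃ τ) (hF : Integrable F (Measure.pi fun _ => ν))
    (hG : Integrable G (Measure.pi fun _ => ν)) :
    Integrable (fun x : τ → X => F (fun i => x (e (Sum.inl i))) * G (fun i => x (e (Sum.inr i))))
      (Measure.pi fun _ => ν) :=
  (measurePreserving_split ν e).integrable_comp_of_integrable (hF.mul_prod hG)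

theorem integral_split_mul (e : κ ⊕ σ ≃ τ) (hF : Integrable F (Measure.pi fun _ => ν))
    (hG : Integrable G (Measure.pi fun _ => ν)) :
    ∫ x : τ → X, F (fun i => x (e (Sum.inl i))) * G (fun i => x (e (Sum.inr i)))
        ∂Measure.pi (fun _ => ν) =
      (∫ x, F x ∂Measure.pi fun _ => ν) * ∫ x, G x ∂Measure.pi fun _ => ν := by
  have hmp := measurePreserving_split ν e
  rw [← integral_prod_mul, ← hmp.map_eq, integral_map hmp.measurable.aemeasurable]
  rw [hmp.map_eq]
  exact (hF.mul_prod hG).aestronglyMeasurable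

end Split

theorem complex_succ_mul_inv_factorial_succ (n : ℕ) :
    (n + 1 : ℂ) * (((n + 1)! : ℕ) : ℂ)⁻¹ = ((n ! : ℕ) : ℂ)⁻¹ := by
  rw [Nat.factorial_succ, Nat.cast_mul, mul_inv, Nat.cast_add_one,
    mul_inv_cancel_left₀ (Nat.cast_add_one_ne_zero n)]

theorem complex_inv_factorial_mul_choose {n k : ℕ} (hkn : k ≤ n) :
    ((n ! : ℕ) : ℂ)⁻¹ * (n.choose k : ℂ) = ((k ! : ℕ) : ℂ)⁻¹ * (((n - k)! : ℕ) : ℂ)⁻¹ := by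
  have hn : ((n ! : ℕ) : ℂ) ≠ 0 := Nat.cast_ne_zero.2 n.factorial_ne_zero
  rw [Nat.cast_choose ℂ hkn, div_eq_mul_inv, inv_mul_cancel_left₀ hn, mul_inv]

section Recursion

variable {X κ : Type*} [DecidableEq κ] {u : X → X → WithTop ℂ} (hu : ∀ x y, u x y = u y x)
  (h : X → ℂ)

/-- The sum over the connected graphs on the points `x i`, `i ∈ V`, with a factor `h (x i)` for
each point: for `h` a phase of `μ`, this is integrated against the powers of `|μ|`. -/
def connWeight (x : ι → X) (V : Finset ι) : ℂ := connSum (edgeZeta hu x) V * ∏ i ∈ V, h (x i)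

/-- The Boltzmann factor of the points `x i`, `i ∈ V`, with a factor `h (x i)` for each point. -/
def fullWeight (x : ι → X) (V : Finset ι) : ℂ := fullProd (edgeZeta hu x) V * ∏ i ∈ V, h (x i)

theorem edgeZeta_map {α β : Type*} (x : α → X) (f : β → α) :
    (fun e => edgeZeta hu x (e.map f)) = edgeZeta hu (x ∘ f) := by
  funext e
  rw [edgeZeta, Sym2.map_map, edgeZeta]

theorem connWeight_map (x : ι → X) (f : κ ↪ ι) {V : Finset κ} (hV : V.Nonempty) :
    connWeight hu h x (V.map f) = connWeight hu h (x ∘ f) V := by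
  rw [connWeight, connSum_map _ _ hV, edgeZeta_map, prod_map]
  rfl

theorem fullWeight_map (x : ι → X) (f : κ ↪ ι) (V : Finset κ) :
    fullWeight hu h x (V.map f) = fullWeight hu h (x ∘ f) V := by
  rw [fullWeight, fullProd_map, edgeZeta_map, prod_map]
  rfl

theorem fullWeight_univ_eq_sum {n : ℕ} (x : Fin (n + 1) → X) :
    fullWeight hu h x univ = ∑ S ∈ (univ.erase 0).powerset,
      connWeight hu h x (insert 0 S) * fullWeight hu h x (insert 0 S)ᶜ := by
  rw [fullWeight, ← insert_erase (mem_univ (0 : Fin (n + 1))),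
    fullProd_insert_eq_sum_connSum _ (notMem_erase _ _), sum_mul, insert_erase (mem_univ _)]
  refine sum_congr rfl fun S _ => ?_
  rw [connWeight, fullWeight, ← compl_insert_zero, ← prod_mul_prod_compl (insert 0 S)]
  ring

theorem connWeight_mul_fullWeight_eq {N k m : ℕ} {T : Finset (Fin N)} (hk : #T = k + 1)
    (hm : #Tᶜ = m) (x : Fin N → X) :
    connWeight hu h x T * fullWeight hu h x Tᶜ =
      connWeight hu h (fun i => x (finSumEquivOfFinset hk hm (Sum.inl i))) univ *
        fullWeight hu h (fun i => x (finSumEquivOfFinset hk hm (Sum.inr i))) univ := by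
  have hconn := connWeight_map hu h x
    (Function.Embedding.inl.trans (finSumEquivOfFinset hk hm).toEmbedding) univ_nonempty
  have hfull := fullWeight_map hu h x
    (Function.Embedding.inr.trans (finSumEquivOfFinset hk hm).toEmbedding) univ
  rw [map_finSumEquivOfFinset_inl] at hconn
  rw [map_finSumEquivOfFinset_inr] at hfull
  rw [hconn, hfull]
  rfl

variable {hu h} [MeasurableSpace X]

theorem integral_fullWeight_succ {ν : Measure X} [SigmaFinite ν]
    (hF : ∀ n, Integrable (fun x : Fin n → X => fullWeight hu h x univ) (Measure.pi fun _ => ν))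
    (hC : ∀ n, Integrable (fun x : Fin (n + 1) → X => connWeight hu h x univ)
      (Measure.pi fun _ => ν)) (n : ℕ) :
    ∫ x : Fin (n + 1) → X, fullWeight hu h x univ ∂Measure.pi (fun _ => ν) =
      ∑ k ∈ range (n + 1), (n.choose k : ℂ) *
        ((∫ x : Fin (k + 1) → X, connWeight hu h x univ ∂Measure.pi fun _ => ν) *
          ∫ x : Fin (n - k) → X, fullWeight hu h x univ ∂Measure.pi fun _ => ν) := by
  simp_rw [fullWeight_univ_eq_sum]
  rw [integral_finsetSum]
  · refine sum_powerset_erase_zero _ (fun k =>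
      (∫ x : Fin (k + 1) → X, connWeight hu h x univ ∂Measure.pi fun _ => ν) *
        ∫ x : Fin (n - k) → X, fullWeight hu h x univ ∂Measure.pi fun _ => ν) fun S hS => ?_
    simp_rw [connWeight_mul_fullWeight_eq hu h (card_insert_zero hS) (card_compl_insert_zero hS)]
    exact integral_split_mul _ (hC _) (hF _)
  · intro S hS
    rw [mem_powerset] at hS
    simp_rw [connWeight_mul_fullWeight_eq hu h (card_insert_zero hS) (card_compl_insert_zero hS)]
    exact integrable_split_mul _ (hC _) (hF _)

variable {μ : ComplexMeasure X}

theorem IsPhase.integrable_fullWeight (hh : IsPhase μ h) {n : ℕ}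
    (hF : Integrable (fun x : Fin n → X => boltzmann u x) (absPi μ n)) :
    Integrable (fun x : Fin n → X => fullWeight hu h x univ) (absPi μ n) :=
  hh.integrable_mul_prod (by simpa only [boltzmann_eq_fullProd hu, absPi] using hF)

theorem IsPhase.integrable_connWeight (hh : IsPhase μ h) {n : ℕ}
    (hC : Integrable (fun x : Fin (n + 1) → X => phi u x) (absPi μ (n + 1))) :
    Integrable (fun x : Fin (n + 1) → X => connWeight hu h x univ) (absPi μ (n + 1)) := by
  refine hh.integrable_mul_prod ((hC.const_mul (((n + 1)! : ℕ) : ℂ)).congr (.of_forall fun x => ?_))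
  simp only [phi_eq_connSum hu]
  exact mul_inv_cancel_left₀ (Nat.cast_ne_zero.2 (Nat.factorial_ne_zero _)) _

variable [IsFiniteMeasure μ.variation]

theorem IsPhase.partitionTerm_eq (hh : IsPhase μ h) {n : ℕ}
    (hF : Integrable (fun x : Fin n → X => boltzmann u x) (absPi μ n)) :
    partitionTerm μ u n = ((n ! : ℕ) : ℂ)⁻¹ * ∫ x, fullWeight hu h x univ ∂absPi μ n := by
  rw [partitionTerm, hh.iterIntegral_eq hF]
  simp only [boltzmann_eq_fullProd hu, fullWeight]

theorem IsPhase.clusterTerm_eq (hh : IsPhase μ h) {n : ℕ}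
    (hC : Integrable (fun x : Fin (n + 1) → X => phi u x) (absPi μ (n + 1))) :
    clusterTerm μ u (n + 1) =
      (((n + 1)! : ℕ) : ℂ)⁻¹ * ∫ x, connWeight hu h x univ ∂absPi μ (n + 1) := by
  rw [clusterTerm, hh.iterIntegral_eq hC, ← integral_const_mul]
  simp only [phi_eq_connSum hu, connWeight, mul_assoc]

theorem succ_mul_partitionTerm_succ (hu : ∀ x y, u x y = u y x)
    (hF : ∀ n, Integrable (fun x : Fin n → X => boltzmann u x) (absPi μ n))
    (hC : ∀ n, Integrable (fun x : Fin (n + 1) → X => phi u x) (absPi μ (n + 1))) (n : ℕ) :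
    (n + 1 : ℂ) * partitionTerm μ u (n + 1) =
      ∑ k ∈ range (n + 1), (k + 1 : ℂ) * clusterTerm μ u (k + 1) * partitionTerm μ u (n - k) := by
  obtain ⟨h, hh⟩ := exists_isPhase μ
  have hrec := integral_fullWeight_succ (hu := hu) (fun n => hh.integrable_fullWeight (hF n))
    (fun n => hh.integrable_connWeight (hC n)) n
  rw [hh.partitionTerm_eq (hu := hu) (hF _), ← mul_assoc, complex_succ_mul_inv_factorial_succ,
    absPi, hrec, mul_sum]
  refine sum_congr rfl fun k hk => ?_
  rw [hh.clusterTerm_eq (hu := hu) (hC k), hh.partitionTerm_eq (hu := hu) (hF _), ← mul_assoc,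
    ← mul_assoc (k + 1 : ℂ), complex_succ_mul_inv_factorial_succ,
    complex_inv_factorial_mul_choose (mem_range_succ_iff.1 hk), absPi, absPi]
  ring

theorem Stable.partitionFunction_eq_exp (hu : ∀ x y, u x y = u y x)
    (hm : Measurable fun p : X × X => u p.1 p.2) {b : X → ℝ} (hbm : Measurable b)
    (hst : Stable μ u b) (hM : ∫⁻ x, ENNReal.ofReal (Real.exp (b x)) ∂μ.variation < ∞)
    (hroot : ∫⁻ x, rootedClusterSum μ u x ∂μ.variation < ∞) :
    partitionFunction μ u = Complex.exp (∑' m : ℕ, clusterTerm μ u (m + 1)) :=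
  tsum_eq_exp_tsum (hst.summable_succ_mul_norm_partitionTerm hu hm hbm hM)
    (summable_succ_mul_norm_clusterTerm hu hm hroot) partitionTerm_zero
    (succ_mul_partitionTerm_succ hu (hst.integrable_boltzmann hu hm hbm hM)
      (integrable_phi hu hm hroot))

end Recursion

end ClusterExpansion

end

open ClusterExpansion in
theorem theorem1 {X : Type*} [MeasurableSpace X] (μ : ComplexMeasure X)
    (u : X → X → WithTop ℂ)
    (hu_meas : Measurable fun p : X × X => u p.1 p.2)
    (hu_symm : ∀ x y, u x y = u y x)
    (a b : X → ℝ) (ha_meas : Measurable a) (hb_meas : Measurable b)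
    (ha : ∀ x, 0 ≤ a x) (hb : ∀ x, 0 ≤ b x)
    (hstab : Stable μ u b)
    (hcrit : ZetaCriterion μ u a b ∨ UbarCriterion μ u a b)
    (hint : ∫⁻ y, ENNReal.ofReal (Real.exp (a y + 2 * b y)) ∂μ.variation < ∞) :
    -- the series defining the partition function converges absolutely
    ((∑' n : ℕ, ((n ! : ℕ) : ℝ≥0∞)⁻¹ *
        ∫⁻ x, ENNReal.ofReal ‖boltzmann u x‖ ∂absPi μ n) < ∞ ∧
      Summable fun n : ℕ => partitionTerm μ u n) ∧
    -- the series in the exponential (over n ≥ 1) converges absolutely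
    ((∑' m : ℕ, ∫⁻ x, ENNReal.ofReal ‖phi u x‖ ∂absPi μ (m + 1)) < ∞ ∧
      Summable fun m : ℕ => clusterTerm μ u (m + 1)) ∧
    -- the cluster expansion
    partitionFunction μ u = Complex.exp (∑' m : ℕ, clusterTerm μ u (m + 1)) ∧
    -- the bounds on the rooted cluster sums
    (ZetaCriterion μ u a b → ∀ᵐ x₁ ∂μ.variation,
      rootedClusterSum μ u x₁ ≤
        ENNReal.ofReal ((Real.exp (a x₁) - 1) * Real.exp (2 * b x₁))) ∧
    (UbarCriterion μ u a b → ∀ᵐ x₁ ∂μ.variation,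
      rootedClusterSum μ u x₁ ≤
        ENNReal.ofReal ((Real.exp (a x₁) - 1) * Real.exp (b x₁))) := by
  have hfin : IsFiniteMeasure μ.variation :=
    isFiniteMeasure_of_lintegral_exp_lt_top (fun x => by linarith [ha x, hb x]) hint
  have hM : ∫⁻ x, ENNReal.ofReal (Real.exp (b x)) ∂μ.variation < ∞ :=
    (lintegral_mono fun x => ENNReal.ofReal_le_ofReal
      (Real.exp_le_exp.2 (by linarith [ha x, hb x]))).trans_lt hint
  have hroot : ∫⁻ x, rootedClusterSum μ u x ∂μ.variation < ∞ :=
    lintegral_rootedClusterSum_lt_top hu_symm hu_meas hb_meas ha hb hstab hcrit hint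
  exact ⟨⟨hstab.tsum_lintegral_boltzmann_lt_top hu_symm hb_meas hM,
      hstab.summable_partitionTerm hu_symm hu_meas hb_meas hM⟩,
    ⟨tsum_lintegral_phi_lt_top hu_symm hu_meas hroot, summable_clusterTerm hu_symm hu_meas hroot⟩,
    hstab.partitionFunction_eq_exp hu_symm hu_meas hb_meas hM hroot,
    ae_rootedClusterSum_le_of_zetaCriterion hu_symm hu_meas hb_meas ha hstab,
    ae_rootedClusterSum_le_of_ubarCriterion hu_symm hu_meas hb_meas ha hb hstab⟩
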